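/- **Conventions.** Let $\mathcal V$ denote self-normalization: it maps a summable sequence $(x_n)$ of nonnegative numbers to $\left(x_n/\sum_j x_j\right)_n$, and a counting measure $\sum_i\delta_{x_i}$ on $(0,\infty)$ with $\sum_i x_i<\infty$ to $\sum_i\delta_{x_i/\sum_j x_j}$. A random mass-partition is a random counting measure $\sum_i\delta_{V_i}$ on $(0,\infty)$ with $\sum_i V_i=1$. It belongs to the *beta/gamma perpetuity family* if it has the law of $\sum_n\delta_{\tilde V_n}$ with $(\tilde V_n)=\mathcal V(G_n\Pi_n)$, $\Pi_n=\prod_{i=1}^{n-1}U_i$, where all the variables $G_n,U_n$ $(n\ge1)$ are independent, the $G_n$ have a common gamma distribution, each $U_n$ has a beta distribution, and $\sum_n G_n\Pi_n<\infty$ a.s. **Poisson-Dirichlet distributions.** Let $\alpha\in[0,1)$ and $\theta>-\alpha$. * If $\alpha=0$, let $\sum_i\delta_{(T_i,P_i)}$ be a Poisson process on $(0,\infty)^2$ with intensity $\mathrm{Leb}\times t^{-1}e^{-t}\,dt$. Then $\mathrm{PD}(0,\theta)$ is the law of $\mathcal V\left(\sum_{T_i\le\theta}\delta_{P_i}\right)$.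 * If $0<\alpha<1$, let $\sum_i\delta_{(T_i,P_i)}$ be a Poisson process on $(0,\infty)^2$, under a probability measure $\mathbb P$, with intensity $\mathrm{Leb}\times\frac{\alpha}{\Gamma(1-\alpha)}u^{-\alpha-1}du$. Let $(E_i)$ be i.i.d. standard exponential variables, independent of $(T_i,P_i)_i$. Put $Z_1=\min\{E_i/P_i: T_i\le1\}$ and $d\mathbb P^*=\frac{Z_1^{\theta}}{\Gamma(\theta/\alpha+1)}\,d\mathbb P$. Then $\mathrm{PD}(\alpha,\theta)$ is the law of $\mathcal V\left(\sum_{T_i\le1}\delta_{P_i}\right)$ under $\mathbb P^*$. **Proposition.** Let $\alpha\in[0,1)$ and $\theta>-\alpha$. 1. The distribution $\mathrm{PD}(\alpha,\theta)$ belongs to the beta/gamma perpetuity family. If $G_n\sim\mathrm{gamma}(1-\alpha,1)$ and $U_n\sim\mathrm{beta}(\theta+n\alpha,1)$, $n\ge1$, are all independent and $\Pi_n=\prod_{i=1}^{n-1}U_i$, then $\sum_nG_n\Pi_n<\infty$ a.s., and the mass-partition $\mathcal V(G_n\Pi_n)$ has law $\mathrm{PD}(\alpha,\theta)$. 2. Suppose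 $\alpha>0$. Then $\mathbb P^*$ is a probability measure. Let $\tilde P_1,\tilde P_2,\dots$ be the jumps $P_i$ with $T_i\le1$, listed by increasing value of $E_i/P_i$ (size-biased order), and let $(\tilde V_n)=\mathcal V(\tilde P_n)$. Then $\mathbb P^*$-a.s. $\sum_n\delta_{\tilde V_n}=\mathcal V\left(\sum_{T_i\le1}\delta_{P_i}\right)$. Moreover, under $\mathbb P^*$ there are the equalities in law of random sequences $$(\tilde V_n)\overset{d}{=}\mathcal V(G_n\Pi_n)\qquad\text{and}\qquad(\tilde V_n)\overset{d}{=}\mathcal V\left(G_n\,(D_1'+D_2+\dots+D_n)^{-1/\alpha}\right).$$ In the first, $G_n,U_n$ are as in part 1. In the second, $G_n\sim\mathrm{gamma}(1-\alpha,1)$, $D_1'\sim\mathrm{gamma}(\theta/\alpha+1,1)$ and $D_n\sim\mathrm{Exp}(1)$ for $n\ge2$ are all independent, and the sequence inside $\mathcal V$ is a.s. summable. -/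

import Mathlib

open MeasureTheory ProbabilityTheory
open scoped ENNReal

noncomputable section

namespace MassPartition

/-! Counting measures on the line are Mathlib measures `m : Measure ℝ`, and random counting
measures are measurable maps into `Measure ℝ` with its standard sigma-algebra, generated by the
evaluations `m ↦ m B` (on the space of counting measures this is the Borel sigma-algebra of the
vague topology).  The law of a random counting measure is a `Measure (Measure ℝ)`. -/

/-- The counting measure `∑ₙ δ_{xₙ}` of a sequence of points. -/
def countingMeasure {X : Type*} [MeasurableSpace X] (x : ℕ → X) : Measure X :=
  Measure.sum (fun n => Measure.dirac (x n))

/-- Self-normalization of a counting measure: `∑ δ_{xᵢ}` is sent to `∑ δ_{xᵢ / ∑ⱼ xⱼ}`. -/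
def normalize (m : Measure ℝ) : Measure ℝ :=
  m.map (fun x => x / ∫ y, y ∂m)

/-- Self-normalization of a sequence: `(xₙ)` is sent to `(xₙ / ∑ⱼ xⱼ)`. -/
def normalizeSeq (x : ℕ → ℝ) : ℕ → ℝ :=
  fun n => x n / ∑' j, x j

/-- Under `P`, the random measure `N` is a Poisson process with intensity measure `ν`: counts of
sets of finite intensity have the Poisson distribution, counts of disjoint sets are independent. -/
structure IsPoissonProcess {Ω X : Type*} [MeasurableSpace Ω] [MeasurableSpace X]
    (N : Ω → Measure X) (ν : Measure X) (P : Measure Ω) : Prop where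
  hasLaw_count : ∀ B : Set X, MeasurableSet B → ν B ≠ ∞ →
    HasLaw (fun ω => N ω B)
      ((poissonMeasure (ν B).toNNReal).map (fun k : ℕ => (k : ℝ≥0∞))) P
  indep_count : ∀ (k : ℕ) (B : Fin k → Set X), (∀ i, MeasurableSet (B i)) →
    (∀ i j, i ≠ j → Disjoint (B i) (B j)) →
    iIndepFun (fun i ω => N ω (B i)) P

/-- The Lévy measure `t⁻¹ e⁻ᵗ dt` on `(0,∞)` of the gamma subordinator. -/
def gammaLevy : Measure ℝ :=
  (volume.restrict (Set.Ioi 0)).withDensity (fun t => ENNReal.ofReal (t⁻¹ * Real.exp (-t)))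

/-- The Lévy measure `(α / Γ(1-α)) u^{-(α+1)} du` on `(0,∞)` of the `α`-stable subordinator. -/
def stableLevy (α : ℝ) : Measure ℝ :=
  (volume.restrict (Set.Ioi 0)).withDensity
    (fun u => ENNReal.ofReal (α / Real.Gamma (1 - α) * u ^ (-(α + 1))))

/-- The random variables `(Tᵢ, Jᵢ)` are the jump times and jump sizes of a driftless subordinator
with Lévy measure `μ`: `∑ δ_{(Tᵢ, Jᵢ)}` is a Poisson process on `(0,∞)²` with intensity
`Leb × μ`. -/
structure IsSubordinatorJumps {Ω : Type*} [MeasurableSpace Ω] (μ : Measure ℝ)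
    (T J : ℕ → Ω → ℝ) (P : Measure Ω) : Prop where
  measurable_time : ∀ i, Measurable (T i)
  measurable_jump : ∀ i, Measurable (J i)
  poisson : IsPoissonProcess (fun ω => countingMeasure (fun i => (T i ω, J i ω)))
    ((volume.restrict (Set.Ioi 0)).prod μ) P

/-- `E` is an i.i.d. sequence of standard exponential marks, independent of all the points
`(Tᵢ, Jᵢ)`. -/
structure IsExpMarking {Ω : Type*} [MeasurableSpace Ω]
    (T J E : ℕ → Ω → ℝ) (P : Measure Ω) : Prop where
  hasLaw_mark : ∀ i, HasLaw (E i) (expMeasure 1) P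
  indep_marks : iIndepFun E P
  indep_points : IndepFun (fun ω i => E i ω) (fun ω i => (T i ω, J i ω)) P

/-- The random mass-partition given by the normalized jumps up to time `s`, that is the
self-normalization of `∑_{Tᵢ ≤ s} δ_{Jᵢ}`. -/
def jumpPartition {Ω : Type*} (T J : ℕ → Ω → ℝ) (s : ℝ) (ω : Ω) : Measure ℝ :=
  normalize (((countingMeasure (fun i => (T i ω, J i ω))).restrict
    {q : ℝ × ℝ | q.1 ≤ s}).map Prod.snd)

/-- `Z₁`, the smallest of the values `Eᵢ / Jᵢ` over the points with `Tᵢ ≤ 1`. -/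
def firstMark {Ω : Type*} (T J E : ℕ → Ω → ℝ) (ω : Ω) : ℝ :=
  sInf ((fun i => E i ω / J i ω) '' {i : ℕ | T i ω ≤ 1})

/-- The biased measure `P*`, with density `Z₁^θ / Γ(θ/α + 1)` with respect to `P`. -/
def biased {Ω : Type*} [MeasurableSpace Ω] (α θ : ℝ) (T J E : ℕ → Ω → ℝ) (P : Measure Ω) :
    Measure Ω :=
  P.withDensity
    (fun ω => ENNReal.ofReal (firstMark T J E ω ^ θ / Real.Gamma (θ / α + 1)))

/-- `ρ` is the Poisson-Dirichlet distribution `PD(α, θ)`, as a law on counting measures.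
For `α = 0` it is the law of the normalized jumps of the gamma subordinator up to time `θ`.
For `0 < α < 1` it is the law of the normalized jumps of the `α`-stable subordinator up to time
`1` after the change of measure with density proportional to `Z₁^θ`. -/
def IsPoissonDirichlet (α θ : ℝ) (ρ : Measure (Measure ℝ)) : Prop :=
  (α = 0 ∧ 0 < θ ∧
    ∃ (Ω : Type) (_ : MeasurableSpace Ω) (P : Measure Ω) (T J : ℕ → Ω → ℝ),
      IsProbabilityMeasure P ∧ IsSubordinatorJumps gammaLevy T J P ∧
      HasLaw (jumpPartition T J θ) ρ P) ∨
  (0 < α ∧ α < 1 ∧ -α < θ ∧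
    ∃ (Ω : Type) (_ : MeasurableSpace Ω) (P : Measure Ω) (T J E : ℕ → Ω → ℝ),
      IsProbabilityMeasure P ∧ IsSubordinatorJumps (stableLevy α) T J P ∧
      IsExpMarking T J E P ∧
      HasLaw (jumpPartition T J 1) ρ (biased α θ T J E P))

/-- The jumps `Jᵢ` with `Tᵢ ≤ 1` in size-biased order, that is listed by increasing value of
`Eᵢ / Jᵢ`: the entry `n` (counted from `0`) is the jump for which exactly `n` of the other ones
have a smaller value of `E / J`. -/
def sizeBiasedJump {Ω : Type*} (T J E : ℕ → Ω → ℝ) (ω : Ω) (n : ℕ) : ℝ :=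
  ∑' i : {i : ℕ // T i ω ≤ 1 ∧
    {j : ℕ | T j ω ≤ 1 ∧ E j ω / J j ω < E i ω / J i ω}.encard = n}, J i ω

/-- The sequence `Gₙ Πₙ` with `Πₙ = U₁ ⋯ Uₙ₋₁` (indices start from `0` in the code, so that the
empty product belongs to the first entry). -/
def perpetuityTerm {Ω : Type*} (G U : ℕ → Ω → ℝ) (ω : Ω) (n : ℕ) : ℝ :=
  G n ω * ∏ i ∈ Finset.range n, U i ω

/-- All the variables `Gₙ`, `Uₙ` are independent, `Gₙ` has the gamma distribution with shape `c`
and rate `r`, and `Uₙ` has the beta distribution with parameters `a n`, `b n`. -/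
structure IsBetaGammaInput {Ω : Type*} [MeasurableSpace Ω] (c r : ℝ) (a b : ℕ → ℝ)
    (G U : ℕ → Ω → ℝ) (P : Measure Ω) : Prop where
  hasLaw_gamma : ∀ n, HasLaw (G n) (gammaMeasure c r) P
  hasLaw_beta : ∀ n, HasLaw (U n) (betaMeasure (a n) (b n)) P
  indep : iIndepFun (Sum.elim G U) P

/-- `ρ` belongs to the beta/gamma perpetuity family, with the given parameters: it is the law of
the mass-partition obtained by self-normalization of the a.s. summable sequence `Gₙ Πₙ`. -/
def IsBetaGammaPerpetuity (c r : ℝ) (a b : ℕ → ℝ) (ρ : Measure (Measure ℝ)) : Prop :=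
  0 < c ∧ 0 < r ∧ (∀ n, 0 < a n) ∧ (∀ n, 0 < b n) ∧
    ∃ (Ω : Type) (_ : MeasurableSpace Ω) (P : Measure Ω) (G U : ℕ → Ω → ℝ),
      IsProbabilityMeasure P ∧ IsBetaGammaInput c r a b G U P ∧
      (∀ᵐ ω ∂P, Summable (perpetuityTerm G U ω)) ∧
      HasLaw (fun ω => countingMeasure (normalizeSeq (perpetuityTerm G U ω))) ρ P

/-- The variables `Gₙ` and `Dₙ` are all independent, `Gₙ` is gamma with shape `1 - α` and rate `1`,
the first `D` is gamma with shape `θ/α + 1` and rate `1`, and the other `Dₙ` are standard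
exponential. -/
structure IsGammaArrivalInput {Ω : Type*} [MeasurableSpace Ω] (α θ : ℝ)
    (G D : ℕ → Ω → ℝ) (P : Measure Ω) : Prop where
  hasLaw_gamma : ∀ n, HasLaw (G n) (gammaMeasure (1 - α) 1) P
  hasLaw_first : HasLaw (D 0) (gammaMeasure (θ / α + 1) 1) P
  hasLaw_exp : ∀ n, HasLaw (D (n + 1)) (expMeasure 1) P
  indep : iIndepFun (Sum.elim G D) P

/-- The sequence `Gₙ (D₁ + ⋯ + Dₙ)^{-1/α}` (indices start from `0` in the code). -/
def arrivalTerm {Ω : Type*} (α : ℝ) (G D : ℕ → Ω → ℝ) (ω : Ω) (n : ℕ) : ℝ :=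
  G n ω * (∑ i ∈ Finset.range (n + 1), D i ω) ^ (-1 / α)

end MassPartition

end

open MassPartition

namespace MassPartition

open Filter Topology Set

/-! ### Exponentials of extended nonnegative reals -/

/-! Give each jump `J` up to time `s`, with its mark `E`, the point `(X, Y)` of the plane, where `X
= Λ(E/J)` for an increasing `Λ` and `Y` is a function of `(J, E)`. These points form a Poisson
process. If `Λ` and `Y` are chosen so that its intensity is Lebesgue measure on `(0,∞)` times a
probability law `γ`, then in increasing order of abscissa, which is the size-biased order of the
jumps, the points are `(D₁ + ⋯ + Dₙ, Yₙ)` with `Dₙ` i.i.d. standard exponential and `Yₙ` i.i.d. of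
law `γ`, all independent. This is `marked_jumps`; the two kinds of subordinator differ only in the
choice of `s`, `Λ`, `Y` and `γ`.

Stable case: `X = (E/J)^α` and `Y = E`. For fixed `e`, the map `u ↦ (e/u)^α` sends the stable Lévy
measure to `e^{-α}/Γ(1-α)` times Lebesgue measure, and the factor `e^{-α}` turns the exponential law
of the mark into `γ = gamma(1-α, 1)`. The jump is recovered as `J = Y X^{-1/α}`, and `Z₁^θ =
X₁^{θ/α}`. The change of measure therefore acts on `D₁` alone and makes it `gamma(θ/α+1, 1)`, which
gives the formula with arrivals. By the beta-gamma algebra the ratios `Uₙ = (Xₙ/Xₙ₊₁)^{1/α}` of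
successive sums are independent with laws `beta(θ+nα, 1)` (`map_sumRatio`). Since `Xₙ^{-1/α} =
X₁^{-1/α} U₁ ⋯ Uₙ₋₁`, normalization removes the common factor and leaves the perpetuity.

Gamma case: `s = θ`, `X = θ log(1 + E/J)` and `Y = J + E`. The intensity `θ j⁻¹ e^{-j} e^{-e}`
depends on `e` only through `y = j + e`, and `θ dj/j` on `(0,y)` becomes Lebesgue measure under `j ↦
θ log(y/j)`; so `Y` is standard exponential. Now `J = Y e^{-X/θ}`, and `Uₙ = e^{-Dₙ₊₁/θ}` has law
`beta(θ, 1)`.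

The Poisson facts are derived from the counts. The Laplace functional gives the void probabilities
of the marked process; those of the renewal sequence come from a one-step identity (`expTail_exp`);
and void probabilities determine the law of an ordered sequence (`ext_of_void`). Identities in law
are compared through canonical product measures, so they hold for any probability spaces carrying
the variables. -/

/-- The function `x ↦ e^{-x}` on `[0,∞]`. -/
noncomputable def expNeg (x : ℝ≥0∞) : ℝ≥0∞ := (EReal.exp (x : EReal))⁻¹

/-- The function `x ↦ -log x` on `[0,1]`. -/
noncomputable def negLog (x : ℝ≥0∞) : ℝ≥0∞ := (ENNReal.log x⁻¹).toENNReal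

lemma expNeg_zero : expNeg 0 = 1 := by simp [expNeg]

lemma expNeg_antitone : Antitone expNeg := fun a b h => by
  unfold expNeg
  exact ENNReal.inv_le_inv.2 (EReal.exp_monotone (by exact_mod_cast h))

lemma expNeg_le_one (x : ℝ≥0∞) : expNeg x ≤ 1 := by
  rw [← expNeg_zero]; exact expNeg_antitone (zero_le)

lemma continuous_expNeg : Continuous expNeg := by
  unfold expNeg
  exact (ENNReal.continuous_exp.comp continuous_coe_ennreal_ereal).inv

lemma measurable_expNeg : Measurable expNeg := continuous_expNeg.measurable

lemma expNeg_ofReal {x : ℝ} (hx : 0 ≤ x) :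
    expNeg (ENNReal.ofReal x) = ENNReal.ofReal (Real.exp (-x)) := by
  unfold expNeg
  rw [EReal.coe_ennreal_ofReal, max_eq_left hx, EReal.exp_coe, Real.exp_neg,
    ENNReal.ofReal_inv_of_pos (Real.exp_pos x)]

lemma expNeg_add (x y : ℝ≥0∞) : expNeg (x + y) = expNeg x * expNeg y := by
  unfold expNeg
  rw [EReal.coe_ennreal_add, EReal.exp_add, ENNReal.mul_inv]
  · left; simp
  · right; simp

lemma expNeg_sum {ι : Type*} (s : Finset ι) (f : ι → ℝ≥0∞) :
    expNeg (∑ i ∈ s, f i) = ∏ i ∈ s, expNeg (f i) := by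
  classical
  induction s using Finset.induction_on with
  | empty => simp [expNeg_zero]
  | insert a s ha ih => rw [Finset.sum_insert ha, Finset.prod_insert ha, expNeg_add, ih]

/-- With infinite values allowed, every factor in `[0,1]`, zero included, is an exponential. A
product over the points of a process can thus be read as a Laplace functional. -/
lemma expNeg_negLog {x : ℝ≥0∞} (hx : x ≤ 1) : expNeg (negLog x) = x := by
  unfold expNeg negLog
  rw [EReal.coe_toENNReal, ENNReal.exp_log, inv_inv]
  simpa using hx

lemma negLog_measurable : Measurable negLog := by
  unfold negLog
  fun_prop

lemma expNeg_top : expNeg ⊤ = 0 := by simp [expNeg]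

lemma expNeg_tsum (f : ℕ → ℝ≥0∞) : expNeg (∑' i, f i) = ∏' i, expNeg (f i) := by
  have h1 : Tendsto (fun n => expNeg (∑ i ∈ Finset.range n, f i)) atTop
      (𝓝 (expNeg (∑' i, f i))) :=
    (continuous_expNeg.tendsto _).comp (ENNReal.tendsto_nat_tsum f)
  simp_rw [expNeg_sum] at h1
  exact tendsto_nhds_unique h1
    (ENNReal.multipliable_of_le_one fun i => expNeg_le_one (f i)).tendsto_prod_tprod_nat

/-! ### Laplace functional and intensity of a Poisson process -/

/-- The generating function of the Poisson law at `q = e^{-c}`: the exponential series in `rq` sums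
to `e^{rq}`, leaving `e^{-(1-q)r}`. -/
lemma lintegral_expNeg_poisson (r : NNReal) (c : ℝ≥0∞) (hc : c ≠ ∞) :
    ∫⁻ k, expNeg (c * (k : ℝ≥0∞)) ∂(poissonMeasure r) = expNeg ((1 - expNeg c) * r) := by
  lift c to NNReal using hc
  set q : ℝ := Real.exp (-(c : ℝ)) with hq
  have hq1 : q ≤ 1 := by rw [hq]; simp
  have hc' : (c : ℝ≥0∞) = ENNReal.ofReal c := by simp
  have hk : ∀ k : ℕ, expNeg (c * (k : ℝ≥0∞)) = ENNReal.ofReal (q ^ k) := by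
    intro k
    have : (c : ℝ≥0∞) * (k : ℝ≥0∞) = ENNReal.ofReal (c * k) := by
      rw [ENNReal.ofReal_mul c.coe_nonneg, hc']; simp
    rw [this, expNeg_ofReal (by positivity), hq, ← Real.exp_nat_mul]
    congr 2; ring
  have h1 : (1 - expNeg (c : ℝ≥0∞)) * (r : ℝ≥0∞) = ENNReal.ofReal ((1 - q) * r) := by
    rw [hc', expNeg_ofReal c.coe_nonneg, ENNReal.ofReal_mul (sub_nonneg.2 hq1),
      ENNReal.ofReal_sub _ (Real.exp_pos _).le]
    simp
  rw [h1, expNeg_ofReal (mul_nonneg (by linarith) r.coe_nonneg), poissonMeasure, lintegral_sum_measure]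
  simp_rw [lintegral_smul_measure, lintegral_dirac, hk, smul_eq_mul]
  have hs : HasSum (fun k : ℕ => Real.exp (-r) * (r : ℝ) ^ k / k.factorial * q ^ k)
      (Real.exp (-((1 - q) * r))) := by
    have h2 := NormedSpace.expSeries_div_hasSum_exp ((r : ℝ) * q)
    rw [← congrFun Real.exp_eq_exp_ℝ] at h2
    have h3 := h2.mul_left (Real.exp (-(r : ℝ)))
    rw [← Real.exp_add, show -(r : ℝ) + r * q = -((1 - q) * r) by ring] at h3
    have e : ∀ k : ℕ, Real.exp (-r) * (r : ℝ) ^ k / k.factorial * q ^ k =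
        Real.exp (-r) * (((r : ℝ) * q) ^ k / k.factorial) := fun k => by rw [mul_pow]; ring
    simpa only [e] using h3
  rw [← hs.tsum_eq, ENNReal.ofReal_tsum_of_nonneg (fun k => by positivity) hs.summable]
  refine tsum_congr fun k => ?_
  rw [← ENNReal.ofReal_mul (by positivity)]

lemma lintegral_natCast_poisson (r : NNReal) :
    ∫⁻ k, (k : ℝ≥0∞) ∂(poissonMeasure r) = r := by
  rw [poissonMeasure, lintegral_sum_measure]
  simp_rw [lintegral_smul_measure, lintegral_dirac, smul_eq_mul]
  rw [tsum_eq_zero_add' ENNReal.summable]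
  have hs : HasSum (fun k : ℕ => Real.exp (-r) * (r : ℝ) ^ (k + 1) / k.factorial) r := by
    have h2 := NormedSpace.expSeries_div_hasSum_exp (r : ℝ)
    rw [← congrFun Real.exp_eq_exp_ℝ] at h2
    have h3 := h2.mul_left ((r : ℝ) * Real.exp (-(r : ℝ)))
    rw [mul_assoc, ← Real.exp_add, neg_add_cancel, Real.exp_zero, mul_one] at h3
    have e : ∀ k : ℕ, Real.exp (-r) * (r : ℝ) ^ (k + 1) / k.factorial =
        (r : ℝ) * Real.exp (-r) * ((r : ℝ) ^ k / k.factorial) := fun k => by ring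
    simpa only [e] using h3
  simp only [Nat.cast_zero, mul_zero, zero_add]
  conv_rhs => rw [← ENNReal.ofReal_coe_nnreal, ← hs.tsum_eq,
    ENNReal.ofReal_tsum_of_nonneg (fun k => by positivity) hs.summable]
  refine tsum_congr fun k => ?_
  rw [← ENNReal.ofReal_natCast (k + 1), ← ENNReal.ofReal_mul (by positivity)]
  congr 1
  rw [Nat.factorial_succ]
  push_cast
  field_simp

section Poisson

variable {Ω X : Type*} [MeasurableSpace Ω] [MeasurableSpace X] {N : Ω → Measure X}
  {ν : Measure X} {P : Measure Ω}

lemma measurable_expNeg_simpleFunc (hN : Measurable N) {f : X → ℝ≥0∞} (hf : Measurable f) :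
    Measurable fun ω => expNeg (∫⁻ x, f x ∂(N ω)) :=
  measurable_expNeg.comp ((Measure.measurable_lintegral hf).comp hN)

/-- The integral of `f` is a linear combination of the counts of its level sets. These are disjoint,
so the counts are independent Poisson variables and the expectation factorizes. -/
lemma IsPoissonProcess.laplace_simpleFunc (hN : Measurable N) (h : IsPoissonProcess N ν P)
    (f : SimpleFunc X ℝ≥0∞) (hf : ∀ x, f x ≠ ∞) (hν : ∀ c, c ≠ 0 → ν (f ⁻¹' {c}) ≠ ∞) :
    ∫⁻ ω, expNeg (∫⁻ x, f x ∂(N ω)) ∂P = expNeg (∫⁻ x, (1 - expNeg (f x)) ∂ν) := by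
  classical
  -- The value `0` is left out: its level set may have infinite intensity, and it contributes to
  -- neither side.
  set F : Finset ℝ≥0∞ := f.range.filter (· ≠ 0) with hF
  have key : ∀ (g : ℝ≥0∞ → ℝ≥0∞), g 0 = 0 → ∀ m : Measure X,
      ∫⁻ x, g (f x) ∂m = ∑ i : Fin F.card, g (F.equivFin.symm i) *
        m (f ⁻¹' {(F.equivFin.symm i : ℝ≥0∞)}) := by
    intro g hg m
    have h1 : ∫⁻ x, g (f x) ∂m = ∑ c ∈ f.range, g c * m (f ⁻¹' {c}) := by
      rw [← SimpleFunc.map_lintegral, ← SimpleFunc.lintegral_eq_lintegral]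
      simp
    rw [h1, ← Finset.sum_filter_of_ne (p := (· ≠ 0)), ← hF, ← Finset.sum_coe_sort]
    · exact (Equiv.sum_comp F.equivFin.symm (fun c : F => g c * m (f ⁻¹' {(c : ℝ≥0∞)}))).symm
    · intro c _ hc h0
      subst h0
      simp [hg] at hc
  have hmeas : ∀ c : ℝ≥0∞, MeasurableSet (f ⁻¹' {c}) := fun c => f.measurableSet_preimage _
  have hNm : ∀ B, MeasurableSet B → Measurable fun ω => N ω B := fun B hB =>
    (Measure.measurable_coe hB).comp hN
  have hind := h.indep_count F.card (fun i => f ⁻¹' {(F.equivFin.symm i : ℝ≥0∞)})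
    (fun i => hmeas _) (fun i j hij => by
      refine Disjoint.preimage _ ?_
      rw [Set.disjoint_singleton]
      intro h'
      exact hij (F.equivFin.symm.injective (Subtype.ext h')))
  have hind' := hind.comp (fun i (a : ℝ≥0∞) => expNeg ((F.equivFin.symm i : ℝ≥0∞) * a))
    (fun i => measurable_expNeg.comp (measurable_const.mul measurable_id))
  rw [key (fun c => 1 - expNeg c) (by simp [expNeg_zero])]
  have key' : ∀ m : Measure X, ∫⁻ x, f x ∂m = ∑ i : Fin F.card, (F.equivFin.symm i : ℝ≥0∞) *
        m (f ⁻¹' {(F.equivFin.symm i : ℝ≥0∞)}) := key id rfl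
  simp_rw [key', expNeg_sum]
  have := lintegral_prod_eq_prod_lintegral_of_indepFun Finset.univ _ hind'
    (fun i => (measurable_expNeg.comp (measurable_const.mul measurable_id)).comp (hNm _ (hmeas _)))
  simp only [Function.comp_def] at this
  refine this.trans ?_
  refine Finset.prod_congr rfl fun i _ => ?_
  have hi := (Finset.mem_filter.1 (F.equivFin.symm i).2)
  obtain ⟨x, hx⟩ := SimpleFunc.mem_range.1 hi.1
  have hfin := hν _ hi.2
  have hlaw := h.hasLaw_count _ (hmeas (F.equivFin.symm i : ℝ≥0∞)) hfin
  have hm : Measurable fun a : ℝ≥0∞ => expNeg ((F.equivFin.symm i : ℝ≥0∞) * a) :=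
    measurable_expNeg.comp (measurable_const.mul measurable_id)
  rw [← lintegral_map hm (hNm _ (hmeas _)), hlaw.map_eq, lintegral_map hm (by fun_prop),
    lintegral_expNeg_poisson _ _ (hx ▸ hf x), ENNReal.coe_toNNReal hfin]

/-- The Laplace functional of a Poisson process. -/
theorem IsPoissonProcess.laplace [IsProbabilityMeasure P] (hN : Measurable N)
    (h : IsPoissonProcess N ν P) {f : X → ℝ≥0∞} (hf : Measurable f)
    (hν : ∀ c, c ≠ 0 → ν {x | c ≤ f x} ≠ ∞) :
    ∫⁻ ω, expNeg (∫⁻ x, f x ∂(N ω)) ∂P = expNeg (∫⁻ x, (1 - expNeg (f x)) ∂ν) := by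
  -- Finite-valued simple functions increasing to `f`. Their level sets at `c ≠ 0` lie in `{c ≤ f}`,
  -- hence have finite intensity. The limit is by dominated convergence under `P` and by monotone
  -- convergence under `ν`.
  set s := SimpleFunc.eapprox f
  have hle : ∀ n x, s n x ≤ f x := fun n x => by
    rw [← SimpleFunc.iSup_eapprox_apply hf x]
    exact le_iSup (fun n => SimpleFunc.eapprox f n x) n
  have hmono : Monotone s := SimpleFunc.monotone_eapprox f
  have hs : ∀ n, ∫⁻ ω, expNeg (∫⁻ x, s n x ∂(N ω)) ∂P
      = expNeg (∫⁻ x, (1 - expNeg (s n x)) ∂ν) := fun n =>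
    h.laplace_simpleFunc hN (s n) (fun x => (SimpleFunc.eapprox_lt_top f n x).ne) fun c hc =>
      ne_top_of_le_ne_top (hν c hc) (measure_mono fun x hx => by
        simp only [mem_preimage, mem_singleton_iff] at hx
        exact hx ▸ hle n x)
  have hlim : ∀ m : Measure X, Tendsto (fun n => ∫⁻ x, s n x ∂m) atTop (𝓝 (∫⁻ x, f x ∂m)) := by
    intro m
    refine lintegral_tendsto_of_tendsto_of_monotone (fun n => (s n).measurable.aemeasurable)
      (ae_of_all _ fun x n k hnk => hmono hnk x) (ae_of_all _ fun x => ?_)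
    rw [← SimpleFunc.iSup_eapprox_apply hf x]
    exact tendsto_atTop_iSup fun n k hnk => hmono hnk x
  have h1 : Tendsto (fun n => ∫⁻ ω, expNeg (∫⁻ x, s n x ∂(N ω)) ∂P) atTop
      (𝓝 (∫⁻ ω, expNeg (∫⁻ x, f x ∂(N ω)) ∂P)) := by
    refine tendsto_lintegral_of_dominated_convergence (fun _ => 1)
      (fun n => measurable_expNeg_simpleFunc hN (s n).measurable)
      (fun n => ae_of_all _ fun ω => expNeg_le_one _) (by simp)
      (ae_of_all _ fun ω => (continuous_expNeg.tendsto _).comp (hlim (N ω)))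
  have h2 : Tendsto (fun n => expNeg (∫⁻ x, (1 - expNeg (s n x)) ∂ν)) atTop
      (𝓝 (expNeg (∫⁻ x, (1 - expNeg (f x)) ∂ν))) := by
    refine (continuous_expNeg.tendsto _).comp ?_
    refine lintegral_tendsto_of_tendsto_of_monotone
      (fun n => (measurable_const.sub (measurable_expNeg.comp (s n).measurable)).aemeasurable)
      (ae_of_all _ fun x n k hnk => tsub_le_tsub_left (expNeg_antitone (hmono hnk x)) _)
      (ae_of_all _ fun x => ?_)
    have : Tendsto (fun n => s n x) atTop (𝓝 (f x)) := by
      rw [← SimpleFunc.iSup_eapprox_apply hf x]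
      exact tendsto_atTop_iSup fun n k hnk => hmono hnk x
    exact ENNReal.Tendsto.sub tendsto_const_nhds ((continuous_expNeg.tendsto _).comp this)
      (Or.inl ENNReal.one_ne_top)
  simp_rw [hs] at h1
  exact tendsto_nhds_unique h1 h2

/-- Campbell's formula for a Poisson process. -/
theorem IsPoissonProcess.campbell [SigmaFinite ν] (hN : Measurable N)
    (h : IsPoissonProcess N ν P) {f : X → ℝ≥0∞} (hf : Measurable f) :
    ∫⁻ ω, ∫⁻ x, f x ∂(N ω) ∂P = ∫⁻ x, f x ∂ν := by
  -- The formula says that the mean measure of the process is `ν`. On sets of finite intensity this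
  -- is the mean of a Poisson law; σ-finiteness extends it.
  have hb : P.bind N = ν := by
    have hfin : ∀ B, MeasurableSet B → ν B ≠ ∞ → P.bind N B = ν B := by
      intro B hB hν
      have hm : Measurable fun ω => N ω B := (Measure.measurable_coe hB).comp hN
      rw [Measure.bind_apply hB hN.aemeasurable, ← lintegral_map (f := fun a => a) measurable_id hm,
        (h.hasLaw_count B hB hν).map_eq, lintegral_map (f := fun a => a) measurable_id
          (by fun_prop),
        lintegral_natCast_poisson, ENNReal.coe_toNNReal hν]
    refine Measure.ext_of_iUnion_eq_univ (iUnion_spanningSets ν) fun n => ?_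
    ext B hB
    rw [Measure.restrict_apply hB, Measure.restrict_apply hB]
    exact hfin _ (hB.inter (measurableSet_spanningSets ν n)) (ne_top_of_le_ne_top
      (measure_spanningSets_lt_top ν n).ne (measure_mono inter_subset_right))
  rw [← hb, Measure.lintegral_bind hN.aemeasurable hf.aemeasurable]

end Poisson

/-! ### Void probabilities determine the law of an ordered sequence of points -/

/-- The sequences of points of the plane with increasing and unbounded abscissas. -/
def orderedSeqs : Set (ℕ → ℝ × ℝ) :=
  {z | (∀ n, (z n).1 < (z (n + 1)).1) ∧ ∀ m : ℕ, ∃ n, (m : ℝ) < (z n).1}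

lemma measurableSet_orderedSeqs : MeasurableSet orderedSeqs := by
  have h1 : MeasurableSet {z : ℕ → ℝ × ℝ | ∀ n, (z n).1 < (z (n + 1)).1} := by
    simp_rw [ofPred_forall]
    exact MeasurableSet.iInter fun n => measurableSet_lt (by fun_prop) (by fun_prop)
  have h2 : MeasurableSet {z : ℕ → ℝ × ℝ | ∀ m : ℕ, ∃ n, (m : ℝ) < (z n).1} := by
    simp_rw [ofPred_forall, ofPred_exists]
    exact MeasurableSet.iInter fun n => MeasurableSet.iUnion fun n =>
      measurableSet_lt (by fun_prop) (by fun_prop)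
  exact h1.inter h2

/-- An open box of the plane with rational vertices. -/
def ratBox (i : ℚ × ℚ × ℚ × ℚ) : Set (ℝ × ℝ) :=
  Ioo (i.1 : ℝ) i.2.1 ×ˢ Ioo (i.2.2.1 : ℝ) i.2.2.2

lemma measurableSet_ratBox (i) : MeasurableSet (ratBox i) :=
  measurableSet_Ioo.prod measurableSet_Ioo

lemma exists_ratBox {p : ℝ × ℝ} {s : Set (ℝ × ℝ)} (hs : s ∈ 𝓝 p) :
    ∃ i, p ∈ ratBox i ∧ ratBox i ⊆ s := by
  obtain ⟨u, hu, v, hv, huv⟩ := mem_nhds_prod_iff.1 (show s ∈ 𝓝 (p.1, p.2) from hs)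
  have key : ∀ (x : ℝ) (u : Set ℝ), u ∈ 𝓝 x → ∃ a b : ℚ, x ∈ Ioo (a : ℝ) b ∧
      Ioo (a : ℝ) b ⊆ u := by
    intro x u hu
    obtain ⟨l, r, hx, hlr⟩ := mem_nhds_iff_exists_Ioo_subset.1 hu
    obtain ⟨a, ha1, ha2⟩ := exists_rat_btwn hx.1
    obtain ⟨b, hb1, hb2⟩ := exists_rat_btwn hx.2
    exact ⟨a, b, ⟨ha2, hb1⟩, fun y hy => hlr ⟨ha1.trans hy.1, hy.2.trans hb2⟩⟩
  obtain ⟨a, b, h1, h2⟩ := key _ _ hu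
  obtain ⟨c, d, h3, h4⟩ := key _ _ hv
  exact ⟨(a, b, c, d), ⟨h1, h3⟩, (prod_mono h2 h4).trans huv⟩

lemma orderedSeqs_strictMono {z : ℕ → ℝ × ℝ} (hz : z ∈ orderedSeqs) :
    StrictMono fun n => (z n).1 := strictMono_nat_of_lt_succ hz.1

/-- The points of `w` have abscissas going to infinity, so only finitely many lie near a given
point. If that point is not one of them, a small rational box around it contains no point of `w`. -/
lemma range_subset_of_void {z w : ℕ → ℝ × ℝ} (hw : w ∈ orderedSeqs)
    (h : ∀ i, (∀ n, w n ∉ ratBox i) → ∀ n, z n ∉ ratBox i) : range z ⊆ range w := by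
  rintro _ ⟨n, rfl⟩
  by_contra hn
  obtain ⟨m, hm⟩ := exists_nat_gt ((z n).1)
  obtain ⟨k, hk⟩ := hw.2 m
  have hs : ({p : ℝ × ℝ | p.1 < m} ∩ (w '' Iic k)ᶜ) ∈ 𝓝 (z n) := by
    refine inter_mem ?_ ?_
    · exact (isOpen_lt continuous_fst continuous_const).mem_nhds hm
    · exact ((finite_Iic k).image w).isClosed.isOpen_compl.mem_nhds
        fun hh => hn (image_subset_range _ _ hh)
  obtain ⟨i, hi1, hi2⟩ := exists_ratBox hs
  refine h i (fun j hj => ?_) n hi1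
  rcases le_or_gt j k with hjk | hjk
  · exact (hi2 hj).2 ⟨j, hjk, rfl⟩
  · have h1 : (w j).1 < m := (hi2 hj).1
    have h2 := orderedSeqs_strictMono hw hjk
    simp only at h2
    linarith

/-- The indicators of the emptiness of the rational boxes. -/
def voidIndicator (z : ℕ → ℝ × ℝ) (i : ℚ × ℚ × ℚ × ℚ) : Prop := ∀ n, z n ∉ ratBox i

lemma measurableSet_void {B : Set (ℝ × ℝ)} (hB : MeasurableSet B) :
    MeasurableSet {z : ℕ → ℝ × ℝ | ∀ n, z n ∉ B} := by
  simp_rw [ofPred_forall]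
  exact MeasurableSet.iInter fun n => hB.compl.preimage (measurable_pi_apply n)

lemma measurable_voidIndicator : Measurable voidIndicator :=
  measurable_pi_iff.2 fun i => measurableSet_setOfPred.1 (measurableSet_void (measurableSet_ratBox i))

/-- The empty boxes determine the set of points, and a strictly increasing enumeration is determined
by its range. -/
lemma injOn_voidIndicator : InjOn voidIndicator orderedSeqs := by
  intro z hz w hw h
  have hr : range z = range w :=
    Subset.antisymm (range_subset_of_void hw fun i hi => (congrFun h i ▸ hi : voidIndicator z i))
      (range_subset_of_void hz fun i hi => (congrFun h i ▸ hi : voidIndicator w i))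
  have h1 : (fun n => (z n).1) = fun n => (w n).1 := by
    rw [← (orderedSeqs_strictMono hz).range_inj (orderedSeqs_strictMono hw)]
    rw [show (fun n => (z n).1) = Prod.fst ∘ z from rfl, range_comp, hr, ← range_comp]
    rfl
  funext n
  obtain ⟨k, hk⟩ : z n ∈ range w := hr ▸ mem_range_self n
  have : k = n := (orderedSeqs_strictMono hw).injective (by
    show (w k).1 = (w n).1
    rw [hk]; exact congrFun h1 n)
  rw [← hk, this]

/-- These sets form a π-system. For void indicators, the set attached to `F` says that a finite
union of boxes is empty, so void probabilities are enough to identify a law. -/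
lemma generateFrom_finset_forall (ι : Type*) :
    (MeasurableSpace.pi : MeasurableSpace (ι → Prop)) = MeasurableSpace.generateFrom
      (range fun F : Finset ι => {p : ι → Prop | ∀ i ∈ F, p i}) := by
  apply le_antisymm
  · refine iSup_le fun i => ?_
    rintro _ ⟨t, -, rfl⟩
    have hi : MeasurableSet[MeasurableSpace.generateFrom
      (range fun F : Finset ι => {p : ι → Prop | ∀ i ∈ F, p i})] {p : ι → Prop | p i} :=
      MeasurableSpace.measurableSet_generateFrom ⟨{i}, by simp⟩
    have : (fun p : ι → Prop => p i) ⁻¹' t =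
        ({p | p i} ∩ {_p | True ∈ t}) ∪ ({p | p i}ᶜ ∩ {_p | False ∈ t}) := by
      ext p
      by_cases hp : p i <;> simp [hp]
    rw [this]
    exact (hi.inter (MeasurableSet.const _)).union (hi.compl.inter (MeasurableSet.const _))
  · refine MeasurableSpace.generateFrom_le ?_
    rintro _ ⟨F, rfl⟩
    have : {p : ι → Prop | ∀ i ∈ F, p i} = ⋂ i ∈ F, {p | p i} := by ext; simp
    simp only [this]
    exact Finset.measurableSet_biInter F fun i _ => measurableSet_setOfPred.2 (measurable_pi_apply i)

/-- The law of an ordered sequence of points is determined by the void probabilities. -/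
theorem ext_of_void {μ ν : Measure (ℕ → ℝ × ℝ)} [IsProbabilityMeasure μ] [IsProbabilityMeasure ν]
    (hμ : ∀ᵐ z ∂μ, z ∈ orderedSeqs) (hν : ∀ᵐ z ∂ν, z ∈ orderedSeqs)
    (h : ∀ B, MeasurableSet B → (∃ R, ∀ q ∈ B, q.1 ≤ R) →
      μ {z | ∀ n, z n ∉ B} = ν {z | ∀ n, z n ∉ B}) : μ = ν := by
  have hmap : μ.map voidIndicator = ν.map voidIndicator := by
    have := Measure.isProbabilityMeasure_map (μ := μ) measurable_voidIndicator.aemeasurable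
    have := Measure.isProbabilityMeasure_map (μ := ν) measurable_voidIndicator.aemeasurable
    refine ext_of_generate_finite _ (generateFrom_finset_forall _) ?_ ?_ (by simp)
    · rintro _ ⟨F, rfl⟩ _ ⟨G, rfl⟩ -
      classical
      exact ⟨F ∪ G, by ext p; simp [or_imp, forall_and]⟩
    · rintro _ ⟨F, rfl⟩
      have hF : MeasurableSet {p : ℚ × ℚ × ℚ × ℚ → Prop | ∀ i ∈ F, p i} := by
        rw [generateFrom_finset_forall]
        exact MeasurableSpace.measurableSet_generateFrom ⟨F, rfl⟩
      have hpre : voidIndicator ⁻¹' {p | ∀ i ∈ F, p i} =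
          {z | ∀ n, z n ∉ ⋃ i ∈ F, ratBox i} := by
        ext z
        simp only [voidIndicator, mem_preimage, mem_ofPred_eq, mem_iUnion, not_exists]
        exact ⟨fun h n i hi => h i hi n, fun h i hi n => h n i hi⟩
      simp only [Measure.map_apply measurable_voidIndicator hF, hpre]
      refine h _ (Finset.measurableSet_biUnion F fun i _ => measurableSet_ratBox i) ?_
      obtain ⟨M, hM⟩ := (F.image fun i => i.2.1).bddAbove
      refine ⟨M, fun q hq => ?_⟩
      simp only [mem_iUnion] at hq
      obtain ⟨i, hi, hq⟩ := hq
      have := hM (Finset.mem_coe.2 (Finset.mem_image_of_mem _ hi))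
      exact hq.1.2.le.trans (by exact_mod_cast this)
  ext A hA
  -- By the Lusin-Souslin theorem the injective measurable image of a Borel set is measurable, so
  -- the law of the void indicators determines that of the sequence.
  have key : ∀ (m : Measure (ℕ → ℝ × ℝ)), (∀ᵐ z ∂m, z ∈ orderedSeqs) →
      m A = m.map voidIndicator (voidIndicator '' (A ∩ orderedSeqs)) := by
    intro m hm
    rw [Measure.map_apply measurable_voidIndicator
      ((hA.inter measurableSet_orderedSeqs).image_of_measurable_injOn measurable_voidIndicator
        (injOn_voidIndicator.mono inter_subset_right))]
    refine measure_congr ?_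
    filter_upwards [hm] with z hz
    refine propext ⟨fun hzA => ⟨z, ⟨hzA, hz⟩, rfl⟩, ?_⟩
    rintro ⟨w, ⟨hw1, hw2⟩, hwz⟩
    rw [← injOn_voidIndicator hw2 hz hwz]
    exact hw1
  rw [key μ hμ, key ν hν, hmap]

/-! ### Independent marks -/

/-- The probability that no marked point falls into `B`, for i.i.d. marks. -/
lemma measure_void_marking {Ω X Y : Type*} [MeasurableSpace Ω] [MeasurableSpace X]
    [MeasurableSpace Y] (Q : Measure Ω) {x : ℕ → Ω → X} (hx : ∀ i, Measurable (x i))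
    (m : Measure Y) [IsProbabilityMeasure m] {B : Set (X × Y)} (hB : MeasurableSet B) :
    (Q.prod (Measure.infinitePi fun _ : ℕ => m)) {p | ∀ i, (x i p.1, p.2 i) ∉ B} =
      ∫⁻ ω, ∏' i, m {y | (x i ω, y) ∉ B} ∂Q := by
  have hm : MeasurableSet {p : Ω × (ℕ → Y) | ∀ i, (x i p.1, p.2 i) ∉ B} := by
    simp_rw [ofPred_forall]
    exact MeasurableSet.iInter fun i => hB.compl.preimage (by fun_prop)
  rw [Measure.prod_apply hm]
  refine lintegral_congr fun ω => ?_
  have : Prod.mk ω ⁻¹' {p : Ω × (ℕ → Y) | ∀ i, (x i p.1, p.2 i) ∉ B} =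
      univ.pi fun i => {y | (x i ω, y) ∉ B} := by
    ext y; simp
  rw [this, Measure.infinitePi_pi_univ]
  exact fun i => hB.compl.preimage (by fun_prop)

/-! ### Product measures -/

/-- Replacing a coordinate of a product measure by an independent one. -/
lemma map_update_infinitePi {ι Y : Type*} [DecidableEq ι] [MeasurableSpace Y]
    (μ : ι → Measure Y) [∀ i, IsProbabilityMeasure (μ i)] (n : ι) (ν : Measure Y)
    [IsProbabilityMeasure ν] [∀ i, IsProbabilityMeasure (Function.update μ n ν i)] :
    ((Measure.infinitePi μ).prod ν).map (fun p => Function.update p.1 n p.2) =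
      Measure.infinitePi (Function.update μ n ν) := by
  have hm : Measurable fun p : (ι → Y) × Y => Function.update p.1 n p.2 := by
    refine measurable_pi_iff.2 fun i => ?_
    by_cases h : i = n
    · subst h; simpa using measurable_snd
    · simp only [Function.update_of_ne h]; fun_prop
  refine Measure.eq_infinitePi _ fun s t ht => ?_
  rw [Measure.map_apply hm (MeasurableSet.pi s.countable_toSet fun i _ => ht i)]
  have : (fun p : (ι → Y) × Y => Function.update p.1 n p.2) ⁻¹' (s : Set ι).pi t =
      (((s.erase n : Finset ι) : Set ι).pi t) ×ˢ (if n ∈ s then t n else univ) := by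
    ext p
    simp only [mem_preimage, Set.mem_pi, mem_prod, Finset.coe_erase]
    constructor
    · intro h
      refine ⟨fun i hi => ?_, ?_⟩
      · simpa [Function.update_of_ne (show i ≠ n from hi.2)] using h i hi.1
      · split_ifs with hn
        · simpa using h n hn
        · trivial
    · rintro ⟨h1, h2⟩ i hi
      by_cases hin : i = n
      · subst hin
        rw [if_pos (by simpa using hi)] at h2
        simpa using h2
      · simpa [Function.update_of_ne hin] using h1 i ⟨hi, hin⟩
  rw [this, Measure.prod_prod, Measure.infinitePi_pi _ fun i _ => ht i]
  by_cases hn : n ∈ s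
  · rw [if_pos hn, ← Finset.prod_erase_mul s _ hn]
    congr 1
    · exact Finset.prod_congr rfl fun i hi => by
        rw [Function.update_of_ne (Finset.ne_of_mem_erase hi)]
    · simp
  · rw [if_neg hn, Finset.erase_eq_of_notMem hn, measure_univ, mul_one]
    refine Finset.prod_congr rfl fun i hi => ?_
    rw [Function.update_of_ne (ne_of_mem_of_not_mem hi hn)]

/-- Resampling one coordinate from its own law preserves the product measure. This is the form of
Fubini used to integrate out the last waiting time. -/
lemma lintegral_infinitePi_update {ι Y : Type*} [DecidableEq ι] [MeasurableSpace Y]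
    (μ : ι → Measure Y) [∀ i, IsProbabilityMeasure (μ i)] (n : ι) {F : (ι → Y) → ℝ≥0∞}
    (hF : Measurable F) :
    ∫⁻ d, F d ∂(Measure.infinitePi μ) =
      ∫⁻ d, ∫⁻ s, F (Function.update d n s) ∂(μ n) ∂(Measure.infinitePi μ) := by
  have hm : Measurable fun p : (ι → Y) × Y => Function.update p.1 n p.2 := by
    refine measurable_pi_iff.2 fun i => ?_
    by_cases h : i = n
    · subst h; simpa using measurable_snd
    · simp only [Function.update_of_ne h]; fun_prop
  have : ∀ i, IsProbabilityMeasure (Function.update μ n (μ n) i) := by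
    simpa using fun i => (inferInstance : IsProbabilityMeasure (μ i))
  have h := map_update_infinitePi μ n (μ n)
  simp only [Function.update_eq_self] at h
  conv_lhs => rw [← h]
  rw [lintegral_map hF hm]
  exact lintegral_prod _ (hF.comp hm).aemeasurable

/-- Changing the density of one coordinate of a product measure. -/
lemma infinitePi_withDensity_eval {ι Y : Type*} [DecidableEq ι] [MeasurableSpace Y]
    (μ : ι → Measure Y) [∀ i, IsProbabilityMeasure (μ i)] (n : ι) {f : Y → ℝ≥0∞}
    (hf : Measurable f) (ν : Measure Y) [IsProbabilityMeasure ν] (hν : (μ n).withDensity f = ν)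
    [∀ i, IsProbabilityMeasure (Function.update μ n ν i)] :
    (Measure.infinitePi μ).withDensity (fun d => f (d n)) =
      Measure.infinitePi (Function.update μ n ν) := by
  rw [← map_update_infinitePi μ n ν]
  have hm : Measurable fun p : (ι → Y) × Y => Function.update p.1 n p.2 := by
    refine measurable_pi_iff.2 fun i => ?_
    by_cases h : i = n
    · subst h; simpa using measurable_snd
    · simp only [Function.update_of_ne h]; fun_prop
  ext A hA
  rw [withDensity_apply _ hA, ← lintegral_indicator hA,
    lintegral_infinitePi_update μ n
      (Measurable.indicator (f := fun d : ι → Y => f (d n)) (hf.comp (measurable_pi_apply n)) hA),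
    Measure.map_apply hm hA, Measure.prod_apply (hm hA)]
  refine lintegral_congr fun d => ?_
  have hs : MeasurableSet (Prod.mk d ⁻¹' ((fun p : (ι → Y) × Y => Function.update p.1 n p.2) ⁻¹' A)) :=
    measurable_prodMk_left (hm hA)
  rw [← hν, withDensity_apply _ hs, ← lintegral_indicator hs]
  refine lintegral_congr fun s => ?_
  simp only [indicator, Function.update_self]
  rfl

/-! ### Gamma and exponential distributions -/

lemma lintegral_gammaMeasure {a : ℝ} (f : ℝ → ℝ≥0∞) (hf : Measurable f) :
    ∫⁻ x, f x ∂(gammaMeasure a 1) =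
      ∫⁻ x in Ioi 0, ENNReal.ofReal (x ^ (a - 1) * Real.exp (-x) / Real.Gamma a) * f x := by
  have hmeas : Measurable (gammaPDF a 1) := (measurable_gammaPDFReal a 1).ennreal_ofReal
  rw [gammaMeasure, lintegral_withDensity_eq_lintegral_mul _ hmeas hf,
    ← lintegral_indicator measurableSet_Ioi]
  refine lintegral_congr_ae ?_
  filter_upwards [compl_mem_ae_iff.2 (measure_singleton (0 : ℝ))] with x hx
  rcases lt_or_gt_of_ne (show x ≠ 0 from hx) with h | h
  · rw [indicator_of_notMem (by simpa using h.le)]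
    simp [gammaPDF_of_neg h]
  · rw [indicator_of_mem (mem_Ioi.2 h)]
    simp only [Pi.mul_apply, gammaPDF_of_nonneg h.le]
    congr 2
    simp; ring

lemma lintegral_expMeasure (f : ℝ → ℝ≥0∞) (hf : Measurable f) :
    ∫⁻ x, f x ∂(expMeasure 1) = ∫⁻ x in Ioi 0, ENNReal.ofReal (Real.exp (-x)) * f x := by
  rw [expMeasure, lintegral_gammaMeasure f hf]
  simp

lemma ae_pos_gammaMeasure (a : ℝ) : ∀ᵐ x ∂(gammaMeasure a 1), 0 < x := by
  rw [ae_iff]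
  have hS : MeasurableSet {x : ℝ | ¬ 0 < x} := measurableSet_Ioi.compl
  rw [← lintegral_indicator_one hS, lintegral_gammaMeasure _ (measurable_one.indicator hS)]
  refine (setLIntegral_congr_fun measurableSet_Ioi fun x hx => ?_).trans lintegral_zero
  rw [indicator_of_notMem (by simpa using hx), mul_zero]

lemma ae_pos_expMeasure : ∀ᵐ x ∂(expMeasure 1), 0 < x := ae_pos_gammaMeasure 1

instance : IsProbabilityMeasure (expMeasure 1) := isProbabilityMeasure_expMeasure one_pos

/-! ### The renewal process with exponential waiting times -/

/-- The integrand is almost everywhere minus the derivative of `exp(-∫φ)`. As `φ` is only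
measurable, the fundamental theorem is applied through absolute continuity: the primitive is
1-Lipschitz, and `exp` is Lipschitz on the half-line below its maximum. -/
lemma integral_mul_exp_neg_integral {φ : ℝ → ℝ} (hφ : Measurable φ) (h0 : ∀ x, 0 ≤ φ x)
    (h1 : ∀ x, φ x ≤ 1) (a b : ℝ) :
    ∫ x in a..b, φ x * Real.exp (-∫ y in a..x, φ y) = 1 - Real.exp (-∫ y in a..b, φ y) := by
  have hint : ∀ u v : ℝ, IntervalIntegrable φ volume u v := fun u v => by
    refine (intervalIntegrable_const (c := (1 : ℝ))).mono_fun hφ.aestronglyMeasurable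
      (ae_of_all _ fun x => ?_)
    simp only
    rw [Real.norm_of_nonneg (h0 x)]; simpa using h1 x
  set L : ℝ → ℝ := fun x => -∫ y in a..x, φ y with hL
  have hLip : LipschitzWith 1 L := by
    refine LipschitzWith.of_dist_le_mul fun x y => ?_
    rw [hL, dist_neg_neg, Real.dist_eq, intervalIntegral.integral_interval_sub_left (hint _ _) (hint _ _)]
    have := intervalIntegral.norm_integral_le_of_norm_le_const (a := y) (b := x) (f := φ) (C := 1)
      (fun z _ => by rw [Real.norm_of_nonneg (h0 z)]; exact h1 z)
    simpa [Real.dist_eq] using this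
  obtain ⟨C, hC⟩ : ∃ C, ∀ x ∈ uIcc a b, L x ≤ C := by
    obtain ⟨C, hC⟩ := (isCompact_uIcc (a := a) (b := b)).bddAbove_image hLip.continuous.continuousOn
    exact ⟨C, fun x hx => hC (mem_image_of_mem _ hx)⟩
  have hexp : LipschitzOnWith (Real.exp C).toNNReal Real.exp (Iic C) := by
    refine Convex.lipschitzOnWith_of_nnnorm_deriv_le (𝕜 := ℝ)
      (fun x _ => Real.differentiableAt_exp) (fun x hx => ?_) (convex_Iic C)
    rw [Real.deriv_exp, ← NNReal.coe_le_coe, coe_nnnorm, Real.norm_of_nonneg (Real.exp_pos _).le,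
      Real.coe_toNNReal _ (Real.exp_pos _).le]
    exact Real.exp_le_exp.2 hx
  have hAC : AbsolutelyContinuousOnInterval (fun x => Real.exp (L x)) a b :=
    (hexp.comp hLip.lipschitzOnWith hC).absolutelyContinuousOnInterval
  have hFTC := hAC.integral_deriv_eq_sub
  have hae : ∀ᵐ x, x ∈ uIoc a b → φ x * Real.exp (L x) = -deriv (fun x => Real.exp (L x)) x := by
    filter_upwards [(hint a b).ae_hasDerivAt_integral] with x hx hxm
    have h := (hx (uIoc_subset_uIcc hxm) a left_mem_uIcc).neg.exp
    rw [show (fun x => Real.exp (L x)) = fun x => Real.exp ((-fun x => ∫ y in a..x, φ y) x) from rfl,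
      h.deriv]
    simp only [hL, Pi.neg_apply]; ring
  rw [intervalIntegral.integral_congr_ae hae, intervalIntegral.integral_neg, hFTC]
  simp [hL]

lemma intervalIntegrable_of_le_one {φ : ℝ → ℝ} (hφ : Measurable φ) (h0 : ∀ x, 0 ≤ φ x)
    (h1 : ∀ x, φ x ≤ 1) (u v : ℝ) : IntervalIntegrable φ volume u v := by
  refine (intervalIntegrable_const (c := (1 : ℝ))).mono_fun hφ.aestronglyMeasurable
    (ae_of_all _ fun x => ?_)
  simp only
  rw [Real.norm_of_nonneg (h0 x)]; simpa using h1 x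

/-- The integrand is the density of a waiting time with hazard rate `φ`. It has full mass because `φ
= 1` beyond `R` makes the cumulative hazard diverge. -/
lemma lintegral_mul_exp_neg_integral {φ : ℝ → ℝ} (hφ : Measurable φ) (h0 : ∀ x, 0 ≤ φ x)
    (h1 : ∀ x, φ x ≤ 1) {R : ℝ} (hR : ∀ x, R < x → φ x = 1) (t : ℝ) :
    ∫⁻ x in Ioi t, ENNReal.ofReal (φ x * Real.exp (-∫ y in t..x, φ y)) = 1 := by
  have hint := intervalIntegrable_of_le_one hφ h0 h1
  set g : ℝ → ℝ := fun x => φ x * Real.exp (-∫ y in t..x, φ y) with hg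
  have hcont : Continuous fun x => ∫ y in t..x, φ y :=
    intervalIntegral.continuous_primitive hint t
  have hgm : Measurable g := hφ.mul (Real.measurable_exp.comp hcont.measurable.neg)
  have hg0 : ∀ x, 0 ≤ g x := fun x => mul_nonneg (h0 x) (Real.exp_pos _).le
  have hgint : ∀ u v, IntervalIntegrable g volume u v := fun u v =>
    (hint u v).mul_continuousOn (Real.continuous_exp.comp hcont.neg).continuousOn
  have hset : ∀ n : ℕ, ∫⁻ x in Ioc t (t + n), ENNReal.ofReal (g x) =
      ENNReal.ofReal (1 - Real.exp (-∫ y in t..(t + n), φ y)) := by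
    intro n
    have hle : t ≤ t + n := by simp
    rw [← integral_mul_exp_neg_integral hφ h0 h1, intervalIntegral.integral_of_le hle,
      ofReal_integral_eq_lintegral_ofReal ((intervalIntegrable_iff_integrableOn_Ioc_of_le hle).1
        (hgint _ _)) (ae_of_all _ hg0)]
  have hU : Ioi t = ⋃ n : ℕ, Ioc t (t + n) := by
    ext x
    simp only [mem_Ioi, mem_iUnion, mem_Ioc]
    refine ⟨fun hx => ?_, fun ⟨n, h, _⟩ => h⟩
    obtain ⟨n, hn⟩ := exists_nat_ge (x - t)
    exact ⟨n, hx, by linarith⟩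
  have hdir : Monotone fun n : ℕ => Ioc t (t + n) := fun a b hab =>
    Ioc_subset_Ioc_right (by have : (a : ℝ) ≤ b := by exact_mod_cast hab
                             linarith)
  have hlim1 : Tendsto (fun n : ℕ => ∫⁻ x in Ioc t (t + n), ENNReal.ofReal (g x)) atTop
      (𝓝 (∫⁻ x in Ioi t, ENNReal.ofReal (g x))) := by
    rw [hU]
    simp_rw [← withDensity_apply' (μ := volume) (fun x => ENNReal.ofReal (g x))]
    exact tendsto_measure_iUnion_atTop hdir
  have hlim2 : Tendsto (fun n : ℕ => ENNReal.ofReal (1 - Real.exp (-∫ y in t..(t + n), φ y)))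
      atTop (𝓝 1) := by
    rw [← ENNReal.ofReal_one]
    refine (ENNReal.continuous_ofReal.tendsto _).comp ?_
    have hinf : Tendsto (fun n : ℕ => ∫ y in t..(t + n), φ y) atTop atTop := by
      set M := max t R
      refine tendsto_atTop_mono' atTop (f₁ := fun n : ℕ => t + n - M) ?_ ?_
      · filter_upwards [eventually_ge_atTop ⌈M - t⌉₊] with n hn
        have hn' : M ≤ t + n := by have := Nat.ceil_le.1 hn; linarith
        rw [← intervalIntegral.integral_add_adjacent_intervals (hint t M) (hint M (t + n))]
        have e1 : 0 ≤ ∫ y in t..M, φ y :=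
          intervalIntegral.integral_nonneg (le_max_left _ _) fun x _ => h0 x
        have e2 : ∫ y in M..(t + n), φ y = t + n - M := by
          rw [intervalIntegral.integral_congr_ae (g := fun _ => (1 : ℝ))]
          · simp
          · refine ae_of_all _ fun x hx => hR x ?_
            rw [uIoc_of_le hn'] at hx
            exact (le_max_right t R).trans_lt hx.1
        linarith
      · have : Tendsto (fun n : ℕ => (n : ℝ) + (t - M)) atTop atTop :=
          tendsto_atTop_add_const_right _ _ tendsto_natCast_atTop_atTop
        refine this.congr fun n => by ring
    have := (Real.tendsto_exp_neg_atTop_nhds_zero.comp hinf).const_sub 1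
    simpa using this
  simp_rw [hset] at hlim1
  exact tendsto_nhds_unique hlim1 hlim2

/-- The function `t ↦ exp (-∫_t^∞ (1 - ψ))`. -/
noncomputable def expTail (ψ : ℝ → ℝ≥0∞) (t : ℝ) : ℝ≥0∞ := expNeg (∫⁻ x in Ioi t, (1 - ψ x))

lemma measurable_expTail (ψ : ℝ → ℝ≥0∞) : Measurable (expTail ψ) := by
  have : Monotone (expTail ψ) := fun s t hst =>
    expNeg_antitone (lintegral_mono_set (Ioi_subset_Ioi hst))
  exact this.measurable

/-- `expTail ψ` is invariant under one renewal step weighted by `ψ`. Indeed `e^{-(x-t)} expTail ψ x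
= e^{-∫_t^x ψ} expTail ψ t`, so the integral is `expTail ψ t` times the mass of a waiting time with
hazard rate `ψ`. -/
lemma expTail_exp {ψ : ℝ → ℝ≥0∞} (hψ : Measurable ψ) (h1 : ∀ x, ψ x ≤ 1)
    {R : ℝ} (hR : ∀ x, R < x → ψ x = 1) (t : ℝ) :
    ∫⁻ s, ψ (t + s) * expTail ψ (t + s) ∂(expMeasure 1) = expTail ψ t := by
  set φ : ℝ → ℝ := fun x => (ψ x).toReal with hφd
  have hφ : Measurable φ := hψ.ennreal_toReal
  have hne : ∀ x, ψ x ≠ ∞ := fun x => ((h1 x).trans_lt ENNReal.one_lt_top).ne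
  have hψφ : ∀ x, ψ x = ENNReal.ofReal (φ x) := fun x => (ENNReal.ofReal_toReal (hne x)).symm
  have hφ0 : ∀ x, 0 ≤ φ x := fun x => ENNReal.toReal_nonneg
  have hφ1 : ∀ x, φ x ≤ 1 := fun x => by
    simpa using ENNReal.toReal_mono ENNReal.one_ne_top (h1 x)
  have hint := intervalIntegrable_of_le_one hφ hφ0 hφ1
  have key : ∀ x, t < x → ENNReal.ofReal (Real.exp (-(x - t))) * expTail ψ x =
      ENNReal.ofReal (Real.exp (-∫ y in t..x, φ y)) * expTail ψ t := by
    intro x hx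
    have hsplit : ∫⁻ y in Ioi t, (1 - ψ y) =
        (∫⁻ y in Ioc t x, (1 - ψ y)) + ∫⁻ y in Ioi x, (1 - ψ y) := by
      rw [← Ioc_union_Ioi_eq_Ioi hx.le, lintegral_union measurableSet_Ioi]
      exact (Ioc_disjoint_Ioi le_rfl)
    have hfin : ∫⁻ y in Ioc t x, (1 - ψ y) = ENNReal.ofReal (∫ y in t..x, (1 - φ y)) := by
      rw [intervalIntegral.integral_of_le hx.le, ofReal_integral_eq_lintegral_ofReal]
      · refine lintegral_congr fun y => ?_
        rw [ENNReal.ofReal_sub _ (hφ0 y), ← hψφ, ENNReal.ofReal_one]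
      · exact (intervalIntegrable_iff_integrableOn_Ioc_of_le hx.le).1
          (intervalIntegrable_const.sub (hint _ _))
      · exact ae_of_all _ fun y => sub_nonneg.2 (hφ1 y)
    have hnn : 0 ≤ ∫ y in t..x, (1 - φ y) :=
      intervalIntegral.integral_nonneg hx.le fun y _ => sub_nonneg.2 (hφ1 y)
    unfold expTail
    rw [hsplit, expNeg_add, hfin, expNeg_ofReal hnn, ← mul_assoc,
      ← ENNReal.ofReal_mul (Real.exp_pos _).le, ← Real.exp_add]
    congr 3
    rw [intervalIntegral.integral_sub intervalIntegrable_const (hint _ _)]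
    simp only [intervalIntegral.integral_const, smul_eq_mul]
    ring
  have hm : Measurable fun s => ψ (t + s) * expTail ψ (t + s) :=
    (hψ.mul (measurable_expTail ψ)).comp (measurable_const_add t)
  rw [lintegral_expMeasure _ hm]
  calc ∫⁻ s in Ioi 0, ENNReal.ofReal (Real.exp (-s)) * (ψ (t + s) * expTail ψ (t + s))
      = ∫⁻ x in Ioi t, ENNReal.ofReal (Real.exp (-(x - t))) * (ψ x * expTail ψ x) := by
        have := (measurePreserving_add_left volume t).setLIntegral_comp_preimage_emb
          (measurableEmbedding_addLeft t)
          (fun x => ENNReal.ofReal (Real.exp (-(x - t))) * (ψ x * expTail ψ x)) (Ioi t)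
        simpa using this
    _ = ∫⁻ x in Ioi t, ENNReal.ofReal (φ x * Real.exp (-∫ y in t..x, φ y)) * expTail ψ t := by
        refine setLIntegral_congr_fun measurableSet_Ioi fun x hx => ?_
        rw [mul_left_comm, key x hx, ENNReal.ofReal_mul (hφ0 x), hψφ, mul_assoc]
    _ = expTail ψ t := by
        have hcont : Continuous fun x => ∫ y in t..x, φ y :=
          intervalIntegral.continuous_primitive hint t
        have hm' : Measurable fun x => ENNReal.ofReal (φ x * Real.exp (-∫ y in t..x, φ y)) :=
          (hφ.mul (Real.measurable_exp.comp hcont.measurable.neg)).ennreal_ofReal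
        rw [lintegral_mul_const _ hm',
          lintegral_mul_exp_neg_integral hφ hφ0 hφ1 (R := R) (fun x hx => by
            simp [hφd, hR x hx]), one_mul]

/-- The law of an i.i.d. sequence of standard exponential variables. -/
noncomputable abbrev expSeq : Measure (ℕ → ℝ) := Measure.infinitePi fun _ : ℕ => expMeasure 1

/-- The integrands form a martingale in `n`: integrating out the last waiting time with
`expTail_exp` gives back the previous one. -/
lemma lintegral_prod_expTail {ψ : ℝ → ℝ≥0∞} (hψ : Measurable ψ) (h1 : ∀ x, ψ x ≤ 1)
    {R : ℝ} (hR : ∀ x, R < x → ψ x = 1) (n : ℕ) :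
    ∫⁻ d, (∏ k ∈ Finset.range n, ψ (∑ i ∈ Finset.range (k + 1), d i)) *
      expTail ψ (∑ i ∈ Finset.range n, d i) ∂expSeq = expTail ψ 0 := by
  induction n with
  | zero => simp
  | succ n ih =>
    have hm : Measurable fun d : ℕ → ℝ =>
        (∏ k ∈ Finset.range (n + 1), ψ (∑ i ∈ Finset.range (k + 1), d i)) *
        expTail ψ (∑ i ∈ Finset.range (n + 1), d i) := by
      refine Measurable.mul (Finset.measurable_prod _ fun k _ => hψ.comp (by fun_prop))
        ((measurable_expTail ψ).comp (by fun_prop))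
    rw [lintegral_infinitePi_update _ n hm, ← ih]
    refine lintegral_congr fun d => ?_
    have hsum : ∀ s : ℝ, ∀ k ≤ n, ∑ i ∈ Finset.range k, Function.update d n s i =
        ∑ i ∈ Finset.range k, d i := fun s k hk =>
      Finset.sum_congr rfl fun i hi => Function.update_of_ne
        ((Finset.mem_range.1 hi).trans_le hk).ne _ _
    have hsum' : ∀ s : ℝ, ∑ i ∈ Finset.range (n + 1), Function.update d n s i =
        (∑ i ∈ Finset.range n, d i) + s := fun s => by
      rw [Finset.sum_range_succ, hsum s n le_rfl, Function.update_self]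
    simp_rw [Finset.prod_range_succ, hsum', mul_assoc]
    have hprod : ∀ s : ℝ, ∏ k ∈ Finset.range n,
        ψ (∑ i ∈ Finset.range (k + 1), Function.update d n s i) =
        ∏ k ∈ Finset.range n, ψ (∑ i ∈ Finset.range (k + 1), d i) := fun s =>
      Finset.prod_congr rfl fun k hk => by
        rw [hsum s (k + 1) (Nat.succ_le_of_lt (Finset.mem_range.1 hk))]
    simp_rw [hprod]
    have hm' : ∀ t, Measurable fun s => ψ (t + s) * expTail ψ (t + s) := fun t =>
      (hψ.mul (measurable_expTail ψ)).comp (measurable_const_add t)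
    rw [lintegral_const_mul _ (hm' _), expTail_exp hψ h1 hR]

lemma ae_pos_expSeq : ∀ᵐ d ∂expSeq, ∀ n, 0 < d n :=
  ae_all_iff.2 fun n => (measurePreserving_eval_infinitePi (fun _ : ℕ => expMeasure 1)
    n).quasiMeasurePreserving.ae ae_pos_expMeasure

/-- Markov's inequality for `exp(-(d₀ + ⋯ + dₙ))`, whose mean is `c^{n+1}` with `c < 1`: the sums
stay below `m` with probability at most `e^m c^{n+1}` for every `n`. -/
lemma ae_unbounded_expSeq :
    ∀ᵐ d ∂expSeq, ∀ m : ℕ, ∃ n, (m : ℝ) < ∑ i ∈ Finset.range (n + 1), d i := by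
  refine ae_all_iff.2 fun m => ?_
  set c : ℝ≥0∞ := ∫⁻ s, ENNReal.ofReal (Real.exp (-s)) ∂(expMeasure 1) with hc
  have hc1 : c < 1 := by
    have : ∫⁻ _s, 1 ∂(expMeasure 1) = 1 := by simp
    rw [← this]
    refine lintegral_strict_mono (IsProbabilityMeasure.ne_zero _) (by fun_prop) ?_ ?_
    · refine ne_top_of_le_ne_top (b := ∫⁻ _s, 1 ∂(expMeasure 1)) (by simp) (lintegral_mono_ae ?_)
      filter_upwards [ae_pos_expMeasure] with s hs
      rw [← ENNReal.ofReal_one]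
      exact ENNReal.ofReal_le_ofReal (Real.exp_le_one_iff.2 (by linarith))
    · filter_upwards [ae_pos_expMeasure] with s hs
      rw [← ENNReal.ofReal_one]
      exact (ENNReal.ofReal_lt_ofReal_iff one_pos).2 (by simpa using hs)
  have hprod : ∀ n : ℕ, ∫⁻ d, ENNReal.ofReal (Real.exp (-∑ i ∈ Finset.range n, d i)) ∂expSeq
      = c ^ n := by
    intro n
    have hind : iIndepFun (fun (i : ℕ) (d : ℕ → ℝ) => ENNReal.ofReal (Real.exp (-d i))) expSeq :=
      iIndepFun_infinitePi (X := fun _ s => ENNReal.ofReal (Real.exp (-s))) (by fun_prop)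
    have := lintegral_prod_eq_prod_lintegral_of_indepFun (Finset.range n) _ hind (by fun_prop)
    have e : ∀ i : ℕ, ∫⁻ d, ENNReal.ofReal (Real.exp (-d i)) ∂expSeq = c := fun i =>
      (measurePreserving_eval_infinitePi (fun _ : ℕ => expMeasure 1) i).lintegral_comp
        (f := fun s => ENNReal.ofReal (Real.exp (-s))) (by fun_prop)
    simp_rw [e, Finset.prod_const, Finset.card_range] at this
    rw [← this]
    refine lintegral_congr fun d => ?_
    rw [← Finset.sum_neg_distrib, Real.exp_sum,
      ENNReal.ofReal_prod_of_nonneg fun i _ => (Real.exp_pos _).le]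
  rw [ae_iff]
  set A : Set (ℕ → ℝ) := {d | ¬∃ n, (m : ℝ) < ∑ i ∈ Finset.range (n + 1), d i}
  have hA : ∀ n : ℕ, ENNReal.ofReal (Real.exp (-m)) * expSeq A ≤ c ^ (n + 1) := by
    intro n
    rw [← hprod (n + 1)]
    refine le_trans ?_ (mul_meas_ge_le_lintegral (by fun_prop) (ENNReal.ofReal (Real.exp (-m))))
    gcongr
    intro d hd
    simp only [A, mem_ofPred_eq, not_exists, not_lt] at hd
    exact ENNReal.ofReal_le_ofReal (Real.exp_le_exp.2 (neg_le_neg (hd n)))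
  have hlim : Tendsto (fun n : ℕ => c ^ (n + 1)) atTop (𝓝 0) :=
    (tendsto_add_atTop_iff_nat 1).2 (ENNReal.tendsto_pow_atTop_nhds_zero_of_lt_one hc1)
  have h0 := ge_of_tendsto' hlim hA
  rcases mul_eq_zero.1 (le_antisymm h0 (zero_le)) with h | h
  · exact absurd h (by simpa using Real.exp_pos _)
  · exact h

/-- The limit of `lintegral_prod_expTail`: the sums almost surely pass `R`, and from then on the
factor `expTail` equals one. -/
theorem lintegral_tprod_renewal {ψ : ℝ → ℝ≥0∞} (hψ : Measurable ψ) (h1 : ∀ x, ψ x ≤ 1)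
    {R : ℝ} (hR : ∀ x, R < x → ψ x = 1) :
    ∫⁻ d, ∏' k, ψ (∑ i ∈ Finset.range (k + 1), d i) ∂expSeq =
      expNeg (∫⁻ x in Ioi 0, (1 - ψ x)) := by
  have hlim : Tendsto (fun n => ∫⁻ d, (∏ k ∈ Finset.range n, ψ (∑ i ∈ Finset.range (k + 1), d i)) *
      expTail ψ (∑ i ∈ Finset.range n, d i) ∂expSeq) atTop
      (𝓝 (∫⁻ d, ∏' k, ψ (∑ i ∈ Finset.range (k + 1), d i) ∂expSeq)) := by
    refine tendsto_lintegral_of_dominated_convergence (fun _ => 1) (fun n => ?_)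
      (fun n => ae_of_all _ fun d => ?_) (by simp) ?_
    · exact Measurable.mul (Finset.measurable_prod _ fun k _ => hψ.comp (by fun_prop))
        ((measurable_expTail ψ).comp (by fun_prop))
    · exact mul_le_one' (Finset.prod_le_one' fun k _ => h1 _) (expNeg_le_one _)
    · filter_upwards [ae_pos_expSeq, ae_unbounded_expSeq] with d hd1 hd2
      have ht1 := (ENNReal.multipliable_of_le_one fun k =>
        h1 (∑ i ∈ Finset.range (k + 1), d i)).tendsto_prod_tprod_nat
      have hmono : Monotone fun n => ∑ i ∈ Finset.range n, d i := fun a b hab =>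
        Finset.sum_le_sum_of_subset_of_nonneg (Finset.range_mono hab) fun i _ _ => (hd1 i).le
      have ht2 : (fun n => expTail ψ (∑ i ∈ Finset.range n, d i)) =ᶠ[atTop] fun _ => 1 := by
        obtain ⟨m, hm⟩ := exists_nat_ge R
        obtain ⟨n, hn⟩ := hd2 m
        filter_upwards [eventually_ge_atTop (n + 1)] with k hk
        unfold expTail
        rw [← expNeg_zero]
        congr 1
        refine (setLIntegral_congr_fun measurableSet_Ioi fun x hx => ?_).trans lintegral_zero
        have h3 : R < x := by
          have := hmono hk
          simp only [mem_Ioi] at hx this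
          linarith
        rw [hR x h3, expNeg_zero, tsub_self]
      have := ENNReal.Tendsto.mul ht1 (Or.inr ENNReal.one_ne_top)
        (tendsto_const_nhds.congr' ht2.symm) (Or.inl one_ne_zero)
      simpa using this
  simp_rw [lintegral_prod_expTail hψ h1 hR] at hlim
  exact tendsto_nhds_unique hlim tendsto_const_nhds

/-! ### The marked renewal process -/

/-- The sequence of the points `(D₀ + ⋯ + Dₙ, Yₙ)`. -/
def renewalPoints (p : (ℕ → ℝ) × (ℕ → ℝ)) (n : ℕ) : ℝ × ℝ :=
  (∑ i ∈ Finset.range (n + 1), p.1 i, p.2 n)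

lemma measurable_renewalPoints : Measurable renewalPoints :=
  measurable_pi_iff.2 fun n => by unfold renewalPoints; fun_prop

/-- The law of the ordered points of a rate one Poisson process with i.i.d. marks of law `γ`. -/
noncomputable def renewalLaw (γ : Measure ℝ) : Measure (ℕ → ℝ × ℝ) :=
  (expSeq.prod (Measure.infinitePi fun _ : ℕ => γ)).map renewalPoints

instance (γ : Measure ℝ) [IsProbabilityMeasure γ] : IsProbabilityMeasure (renewalLaw γ) :=
  Measure.isProbabilityMeasure_map measurable_renewalPoints.aemeasurable

lemma ae_renewalLaw_mem_orderedSeqs (γ : Measure ℝ) [IsProbabilityMeasure γ] :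
    ∀ᵐ z ∂(renewalLaw γ), z ∈ orderedSeqs := by
  refine (ae_map_iff measurable_renewalPoints.aemeasurable measurableSet_orderedSeqs).2 ?_
  have h : ∀ᵐ d ∂expSeq, (∀ n, 0 < d n) ∧ ∀ m : ℕ, ∃ n,
    (m : ℝ) < ∑ i ∈ Finset.range (n + 1), d i := ae_pos_expSeq.and ae_unbounded_expSeq
  filter_upwards [Measure.quasiMeasurePreserving_fst.ae h] with p hp
  refine ⟨fun n => ?_, hp.2⟩
  simp only [renewalPoints]
  rw [Finset.sum_range_succ _ (n + 1)]
  linarith [hp.1 (n + 1)]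

/-- Given the abscissas, the i.i.d. second coordinates avoid `B` with probability `∏ ψ(xₖ)`, where
`ψ x` is the `γ`-measure of the complement of the section of `B` at `x`. The bound `R` makes `ψ = 1`
far out. -/
lemma renewalLaw_void (γ : Measure ℝ) [IsProbabilityMeasure γ] {B : Set (ℝ × ℝ)}
    (hB : MeasurableSet B) {R : ℝ} (hR : ∀ q ∈ B, q.1 ≤ R) :
    renewalLaw γ {z | ∀ n, z n ∉ B} = expNeg (((volume.restrict (Ioi 0)).prod γ) B) := by
  unfold renewalLaw
  rw [Measure.map_apply measurable_renewalPoints (measurableSet_void hB)]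
  have hx : ∀ k : ℕ, Measurable fun d : ℕ → ℝ => ∑ i ∈ Finset.range (k + 1), d i := by fun_prop
  refine (measure_void_marking expSeq hx γ hB).trans ?_
  have hcompl : ∀ x, γ {y | (x, y) ∉ B} = 1 - γ {y | (x, y) ∈ B} := fun x =>
    prob_compl_eq_one_sub (measurable_prodMk_left hB)
  have hψ : Measurable fun x => γ {y | (x, y) ∉ B} :=
    measurable_measure_prodMk_left hB.compl
  refine (lintegral_tprod_renewal hψ (fun x => prob_le_one) (R := R) fun x hx => ?_).trans ?_
  · have : {y | (x, y) ∉ B} = univ := eq_univ_of_forall fun y hy => (hR _ hy).not_gt hx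
    rw [this, measure_univ]
  · rw [Measure.prod_apply hB]
    congr 1
    refine lintegral_congr fun x => ?_
    rw [hcompl, ENNReal.sub_sub_cancel ENNReal.one_ne_top prob_le_one]
    rfl

/-! ### Ordering a locally finite family of points -/

/-- `σ` lists the elements of `I` by increasing value of `X`. -/
structure IsSorting (I : Set ℕ) (X : ℕ → ℝ) (σ : ℕ → ℕ) : Prop where
  range_eq : range σ = I
  strictMono : StrictMono fun n => X (σ n)
  rank_iff : ∀ (n i : ℕ), i ∈ I → ({j | j ∈ I ∧ X j < X i}.encard = n ↔ i = σ n)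

/-- The index of the `n`-th element of `I`, by increasing value of `X`. -/
noncomputable def sortIdx (I : Set ℕ) (X : ℕ → ℝ) (n : ℕ) : ℕ :=
  sInf {i | i ∈ I ∧ {j | j ∈ I ∧ X j < X i}.encard = n}

/-- The rank of `i`, the number of smaller values, is finite by local finiteness and injective on
`I`. Its range is infinite and closed downwards, hence is all of `ℕ`. -/
lemma isSorting_sortIdx {I : Set ℕ} {X : ℕ → ℝ} (hinj : InjOn X I)
    (hfin : ∀ m : ℕ, {i | i ∈ I ∧ X i ≤ m}.Finite) (hunb : ∀ m : ℕ, ∃ i ∈ I, (m : ℝ) < X i) :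
    IsSorting I X (sortIdx I X) := by
  set S : ℕ → Set ℕ := fun i => {j | j ∈ I ∧ X j < X i} with hS
  have hSfin : ∀ i, (S i).Finite := fun i => by
    obtain ⟨m, hm⟩ := exists_nat_ge (X i)
    exact (hfin m).subset fun j hj => ⟨hj.1, hj.2.le.trans hm⟩
  have hlt : ∀ i ∈ I, ∀ k, X i < X k → (S i).ncard < (S k).ncard := fun i hi k hik =>
    ncard_lt_ncard ⟨fun j hj => ⟨hj.1, hj.2.trans hik⟩, fun h =>
      lt_irrefl _ (h (show i ∈ S k from ⟨hi, hik⟩)).2⟩ (hSfin k)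
  have hrinj : InjOn (fun i => (S i).ncard) I := fun i hi k hk h => by
    rcases lt_trichotomy (X i) (X k) with h' | h' | h'
    · exact absurd h (hlt i hi k h').ne
    · exact hinj hi hk h'
    · exact absurd h (hlt k hk i h').ne'
  -- The predecessor of `k` is the element with the largest value below `X k`.
  have hdown : ∀ n, (∃ i ∈ I, (S i).ncard = n + 1) → ∃ i ∈ I, (S i).ncard = n := by
    rintro n ⟨k, hk, hkn⟩
    have hne : (S k).Nonempty := (ncard_pos (hSfin k)).1 (by omega)
    obtain ⟨i, hi, hmax⟩ := exists_max_image (S k) X (hSfin k) hne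
    refine ⟨i, hi.1, ?_⟩
    have : S k = insert i (S i) := by
      ext j
      simp only [mem_insert_iff]
      constructor
      · intro hj
        rcases (hmax j hj).lt_or_eq with h | h
        · exact Or.inr ⟨hj.1, h⟩
        · exact Or.inl (hinj hj.1 hi.1 h)
      · rintro (rfl | hj)
        · exact hi
        · exact ⟨hj.1, hj.2.trans hi.2⟩
    have h2 := ncard_insert_of_notMem (s := S i) (a := i) (fun h => lt_irrefl _ h.2) (hSfin i)
    rw [← this] at h2
    omega
  have hIinf : I.Infinite := by
    intro hI
    obtain ⟨M, hM⟩ := (hI.image X).bddAbove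
    obtain ⟨m, hm⟩ := exists_nat_ge M
    obtain ⟨i, hi, him⟩ := hunb m
    have := hM (mem_image_of_mem X hi)
    linarith
  have hsurj : ∀ n, ∃ i ∈ I, (S i).ncard = n := by
    have hinf : ((fun i => (S i).ncard) '' I).Infinite := hIinf.image hrinj
    intro n
    obtain ⟨_, ⟨i, hi, rfl⟩, hn⟩ := hinf.exists_gt n
    simp only at hn
    obtain ⟨k, hk⟩ := Nat.exists_eq_add_of_lt hn
    have : ∀ k, (∃ i ∈ I, (S i).ncard = n + k) → ∃ i ∈ I, (S i).ncard = n := by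
      intro k
      induction k with
      | zero => exact fun h => h
      | succ k ih => exact fun h => ih (hdown _ h)
    exact this (k + 1) ⟨i, hi, hk⟩
  have henc : ∀ i (n : ℕ), (S i).encard = n ↔ (S i).ncard = n := fun i n => by
    rw [← (hSfin i).cast_ncard_eq]; exact Nat.cast_inj
  have hmem : ∀ n, sortIdx I X n ∈ I ∧ (S (sortIdx I X n)).ncard = n := fun n => by
    obtain ⟨i, hi, hin⟩ := hsurj n
    have := Nat.sInf_mem (s := {i | i ∈ I ∧ (S i).encard = n}) ⟨i, hi, (henc i n).2 hin⟩
    exact ⟨this.1, (henc _ n).1 this.2⟩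
  have hrank : ∀ (n i : ℕ), i ∈ I → ((S i).encard = n ↔ i = sortIdx I X n) := by
    intro n i hi
    rw [henc]
    constructor
    · intro h
      exact hrinj hi (hmem n).1 (h.trans (hmem n).2.symm)
    · rintro rfl
      exact (hmem n).2
  refine ⟨Subset.antisymm ?_ ?_, ?_, hrank⟩
  · rintro _ ⟨n, rfl⟩; exact (hmem n).1
  · intro i hi
    exact ⟨(S i).ncard, ((hrank _ i hi).1 ((henc _ _).2 rfl)).symm⟩
  · intro a b hab
    by_contra! h
    rcases h.lt_or_eq with h | h
    · have := hlt _ (hmem b).1 _ h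
      rw [(hmem a).2, (hmem b).2] at this
      omega
    · have := hinj (hmem b).1 (hmem a).1 h
      have h2 := (hmem a).2
      rw [← this, (hmem b).2] at h2
      omega

section Random

variable {Ω : Type*} [MeasurableSpace Ω]

lemma measurable_encard {S : Ω → Set ℕ} (hS : ∀ i, MeasurableSet {ω | i ∈ S ω}) (n : ℕ) :
    MeasurableSet {ω | (S ω).encard = n} := by
  have hm : Measurable fun ω => ∑' i, {ω | i ∈ S ω}.indicator (fun _ => (1 : ℝ≥0∞)) ω :=
    Measurable.tsum fun i => measurable_const.indicator (hS i)
  have : {ω | (S ω).encard = n} =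
      (fun ω => ∑' i, {ω | i ∈ S ω}.indicator (fun _ => (1 : ℝ≥0∞)) ω) ⁻¹' {(n : ℝ≥0∞)} := by
    ext ω
    have h1 : ∑' i, {ω | i ∈ S ω}.indicator (fun _ => (1 : ℝ≥0∞)) ω =
        (((S ω).encard : ℕ∞) : ℝ≥0∞) := by
      rw [← ENNReal.tsum_set_one, tsum_subtype (S ω) (fun _ => (1 : ℝ≥0∞))]
      rfl
    simp only [mem_ofPred_eq, mem_preimage, mem_singleton_iff, h1]
    rw [← ENat.toENNReal_coe, ENat.toENNReal_inj]
  rw [this]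
  exact hm (measurableSet_singleton _)

lemma measurable_nat_sInf {A : ℕ → Set Ω} (hA : ∀ i, MeasurableSet (A i)) :
    Measurable fun ω => sInf {i | ω ∈ A i} := by
  refine measurable_to_countable' fun k => ?_
  -- The second piece accounts for the convention `sInf ∅ = 0`.
  have : (fun ω => sInf {i | ω ∈ A i}) ⁻¹' {k} =
      (A k ∩ ⋂ j ∈ Iio k, (A j)ᶜ) ∪ ({_ω | k = 0} ∩ ⋂ j, (A j)ᶜ) := by
    ext ω
    simp only [mem_preimage, mem_singleton_iff, mem_union, mem_inter_iff, mem_iInter, mem_Iio,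
      mem_compl_iff, mem_ofPred_eq]
    constructor
    · intro h
      by_cases hne : {i | ω ∈ A i}.Nonempty
      · left
        have := Nat.sInf_mem hne
        rw [h] at this
        exact ⟨this, fun j hj => fun hjA => Nat.notMem_of_lt_sInf (h ▸ hj) hjA⟩
      · right
        rw [not_nonempty_iff_eq_empty] at hne
        rw [hne, Nat.sInf_empty] at h
        exact ⟨h.symm, fun j hj => by
          have : j ∈ {i | ω ∈ A i} := hj
          rw [hne] at this; exact this⟩
    · rintro (⟨h1, h2⟩ | ⟨h1, h2⟩)
      · refine le_antisymm (Nat.sInf_le h1) ?_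
        by_contra! hlt
        exact h2 _ hlt (Nat.sInf_mem (s := {i | ω ∈ A i}) ⟨k, h1⟩)
      · have : {i | ω ∈ A i} = ∅ := eq_empty_of_forall_notMem fun j hj => h2 j hj
        rw [this, Nat.sInf_empty, h1]
  rw [this]
  exact ((hA k).inter (MeasurableSet.biInter (to_countable _) fun j _ => (hA j).compl)).union
    ((MeasurableSet.const _).inter (MeasurableSet.iInter fun j => (hA j).compl))

lemma measurable_comp_index {Y : Type*} [MeasurableSpace Y] {f : ℕ → Ω → Y}
    (hf : ∀ i, Measurable (f i)) {σ : Ω → ℕ} (hσ : Measurable σ) :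
    Measurable fun ω => f (σ ω) ω := by
  have h : Measurable fun p : ℕ × Ω => f p.1 p.2 := measurable_from_prod_countable_right hf
  exact h.comp (hσ.prodMk measurable_id)

lemma measurable_sortIdx {I : Ω → Set ℕ} {X : ℕ → Ω → ℝ}
    (hI : ∀ i, MeasurableSet {ω | i ∈ I ω}) (hX : ∀ i, Measurable (X i)) (n : ℕ) :
    Measurable fun ω => sortIdx (I ω) (fun i => X i ω) n := by
  refine measurable_nat_sInf (A := fun i => {ω | i ∈ I ω ∧
    {j | j ∈ I ω ∧ X j ω < X i ω}.encard = n}) fun i => ?_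
  exact (hI i).inter (measurable_encard (fun j => (hI j).inter (measurableSet_lt (hX j) (hX i))) n)

/-- A random locally finite family of points with the void probabilities of a Poisson process
of intensity `Leb × γ` on `(0, ∞) × ℝ` is, in increasing order, a marked renewal process. -/
theorem sorted_law {P : Measure Ω} [IsProbabilityMeasure P] {γ : Measure ℝ}
    [IsProbabilityMeasure γ] {I : Ω → Set ℕ} {X Y : ℕ → Ω → ℝ}
    (hI : ∀ i, MeasurableSet {ω | i ∈ I ω}) (hX : ∀ i, Measurable (X i))
    (hY : ∀ i, Measurable (Y i))
    (hinj : ∀ᵐ ω ∂P, InjOn (fun i => X i ω) (I ω))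
    (hfin : ∀ᵐ ω ∂P, ∀ m : ℕ, {i | i ∈ I ω ∧ X i ω ≤ m}.Finite)
    (hvoid : ∀ (B : Set (ℝ × ℝ)), MeasurableSet B → (∃ R, ∀ q ∈ B, q.1 ≤ R) →
      P {ω | ∀ i ∈ I ω, (X i ω, Y i ω) ∉ B} = expNeg (((volume.restrict (Ioi 0)).prod γ) B)) :
    (∀ᵐ ω ∂P, IsSorting (I ω) (fun i => X i ω) (sortIdx (I ω) fun i => X i ω)) ∧
    P.map (fun ω n => (X (sortIdx (I ω) (fun i => X i ω) n) ω,
      Y (sortIdx (I ω) (fun i => X i ω) n) ω)) = renewalLaw γ := by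
  -- Unboundedness comes from the void probabilities themselves: the strip over `(m, m+k]` is empty
  -- with probability `e^{-k}`, and `k` is arbitrary.
  have hunb : ∀ᵐ ω ∂P, ∀ m : ℕ, ∃ i ∈ I ω, (m : ℝ) < X i ω := by
    refine ae_all_iff.2 fun m => ?_
    rw [ae_iff]
    have hle : ∀ k : ℕ, P {ω | ¬∃ i ∈ I ω, (m : ℝ) < X i ω} ≤
        expNeg (ENNReal.ofReal k) := by
      intro k
      have hB : MeasurableSet (Ioc (m : ℝ) (m + k) ×ˢ (univ : Set ℝ)) :=
        measurableSet_Ioc.prod .univ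
      have h := hvoid _ hB ⟨m + k, fun q hq => hq.1.2⟩
      rw [Measure.prod_prod, measure_univ, mul_one, Measure.restrict_apply measurableSet_Ioc,
        inter_eq_left.2 (show Ioc (m : ℝ) (m + k) ⊆ Ioi 0 from
          fun x hx => lt_of_le_of_lt (Nat.cast_nonneg m) hx.1), Real.volume_Ioc,
        add_sub_cancel_left] at h
      rw [← h]
      refine measure_mono fun ω hω i hi hq => ?_
      exact hω ⟨i, hi, hq.1.1⟩
    have hlim : Tendsto (fun k : ℕ => expNeg (ENNReal.ofReal k)) atTop (𝓝 0) := by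
      rw [← expNeg_top]
      refine (continuous_expNeg.tendsto _).comp ?_
      simpa using ENNReal.tendsto_nat_nhds_top
    exact le_antisymm (ge_of_tendsto' hlim hle) (zero_le)
  have hsort : ∀ᵐ ω ∂P, IsSorting (I ω) (fun i => X i ω) (sortIdx (I ω) fun i => X i ω) := by
    filter_upwards [hinj, hfin, hunb] with ω h1 h2 h3 using isSorting_sortIdx h1 h2 h3
  refine ⟨hsort, ?_⟩
  have hm : Measurable fun ω n => (X (sortIdx (I ω) (fun i => X i ω) n) ω,
      Y (sortIdx (I ω) (fun i => X i ω) n) ω) :=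
    measurable_pi_iff.2 fun n => (measurable_comp_index hX (measurable_sortIdx hI hX n)).prodMk
      (measurable_comp_index hY (measurable_sortIdx hI hX n))
  have := Measure.isProbabilityMeasure_map (μ := P) hm.aemeasurable
  refine ext_of_void ?_ (ae_renewalLaw_mem_orderedSeqs γ) fun B hB hR => ?_
  · refine (ae_map_iff hm.aemeasurable measurableSet_orderedSeqs).2 ?_
    filter_upwards [hsort, hunb] with ω h1 h2
    refine ⟨fun n => h1.strictMono (Nat.lt_succ_self n), fun m => ?_⟩
    obtain ⟨i, hi, him⟩ := h2 m
    rw [← h1.range_eq] at hi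
    obtain ⟨n, rfl⟩ := hi
    exact ⟨n, him⟩
  · obtain ⟨R, hR⟩ := hR
    rw [renewalLaw_void γ hB hR, ← hvoid B hB ⟨R, hR⟩, Measure.map_apply hm (measurableSet_void hB)]
    refine measure_congr ?_
    filter_upwards [hsort] with ω h1
    refine propext ⟨fun h i hi => ?_, fun h n => h _ ?_⟩
    · rw [← h1.range_eq] at hi
      obtain ⟨n, rfl⟩ := hi
      exact h n
    · exact h1.range_eq.subset (mem_range_self n)

end Random

/-! ### Self-normalization of ordered jumps -/

lemma countingMeasure_apply {X : Type*} [MeasurableSpace X] (x : ℕ → X) {A : Set X}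
    (hA : MeasurableSet A) : countingMeasure x A = ∑' n, A.indicator (fun _ => (1 : ℝ≥0∞)) (x n) := by
  unfold countingMeasure
  rw [Measure.sum_apply _ hA]
  exact tsum_congr fun n => Measure.dirac_apply' _ hA

lemma lintegral_countingMeasure {X : Type*} [MeasurableSpace X] (x : ℕ → X) {f : X → ℝ≥0∞}
    (hf : Measurable f) : ∫⁻ y, f y ∂(countingMeasure x) = ∑' n, f (x n) := by
  unfold countingMeasure
  rw [lintegral_sum_measure]
  exact tsum_congr fun n => lintegral_dirac' _ hf

lemma map_countingMeasure {X Y : Type*} [MeasurableSpace X] [MeasurableSpace Y] (x : ℕ → X)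
    {f : X → Y} (hf : Measurable f) :
    (countingMeasure x).map f = countingMeasure (fun n => f (x n)) := by
  ext A hA
  rw [Measure.map_apply hf hA, countingMeasure_apply _ (hf hA), countingMeasure_apply _ hA]
  rfl

lemma measurable_countingMeasure {Ω X : Type*} [MeasurableSpace Ω] [MeasurableSpace X]
    {x : ℕ → Ω → X} (hx : ∀ n, Measurable (x n)) :
    Measurable fun ω => countingMeasure (fun n => x n ω) := by
  refine Measure.measurable_of_measurable_coe _ fun A hA => ?_
  simp_rw [countingMeasure_apply _ hA]
  exact Measurable.tsum fun n => (measurable_const.indicator hA).comp (hx n)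

/-- Summability makes the identity integrable, so the Bochner integral in `normalize` is the genuine
sum and not a default value. -/
lemma normalize_countingMeasure {y : ℕ → ℝ} (hy : Summable y) (h0 : ∀ n, 0 ≤ y n) :
    normalize (countingMeasure y) = countingMeasure (normalizeSeq y) := by
  have hint : Integrable (fun x : ℝ => x) (countingMeasure y) := by
    refine ⟨measurable_id.aestronglyMeasurable, ?_⟩
    unfold HasFiniteIntegral
    rw [lintegral_countingMeasure y (by fun_prop)]
    have : ∀ n, ‖y n‖ₑ = ENNReal.ofReal (y n) := fun n => by
      rw [Real.enorm_eq_ofReal (h0 n)]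
    simp_rw [this]
    rw [← ENNReal.ofReal_tsum_of_nonneg h0 hy]
    exact ENNReal.ofReal_lt_top
  have hI : ∫ x, x ∂(countingMeasure y) = ∑' n, y n := by
    unfold countingMeasure at hint ⊢
    rw [integral_sum_measure hint]
    exact tsum_congr fun n => integral_dirac _ _
  unfold normalize
  rw [hI, map_countingMeasure y (by fun_prop)]
  rfl

lemma IsSorting.injective {I : Set ℕ} {X : ℕ → ℝ} {σ : ℕ → ℕ} (h : IsSorting I X σ) :
    Function.Injective σ := fun a b hab => h.strictMono.injective (by simp only [hab])

/-- A counting measure does not depend on the enumeration: `σ` visits each index with `T ≤ s`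
exactly once, and the other indices contribute nothing. -/
lemma jumpPartition_eq_of_range {Ω : Type*} {T J : ℕ → Ω → ℝ} {s : ℝ} {ω : Ω} {σ : ℕ → ℕ}
    (hinj : Function.Injective σ) (hr : range σ = {i | T i ω ≤ s})
    (hsum : Summable fun n => J (σ n) ω) (h0 : ∀ i, 0 ≤ J i ω) :
    jumpPartition T J s ω = countingMeasure (normalizeSeq fun n => J (σ n) ω) := by
  rw [← normalize_countingMeasure hsum fun n => h0 _]
  unfold jumpPartition
  congr 1
  ext A hA
  have hS : MeasurableSet {q : ℝ × ℝ | q.1 ≤ s} := measurableSet_le (by fun_prop) (by fun_prop)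
  rw [Measure.map_apply measurable_snd hA, Measure.restrict_apply (measurable_snd hA),
    countingMeasure_apply _ ((measurable_snd hA).inter hS), countingMeasure_apply _ hA]
  rw [← hinj.tsum_eq]
  · refine tsum_congr fun n => ?_
    have : T (σ n) ω ≤ s := (hr ▸ mem_range_self n : σ n ∈ {i | T i ω ≤ s})
    by_cases h : J (σ n) ω ∈ A
    · rw [indicator_of_mem (show J (σ n) ω ∈ A from h), indicator_of_mem]
      exact ⟨h, this⟩
    · rw [indicator_of_notMem (show J (σ n) ω ∉ A from h), indicator_of_notMem]
      exact fun hh => h hh.1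
  · intro i hi
    rw [hr]
    by_contra h
    simp only [mem_ofPred_eq, not_le] at h
    exact hi (indicator_of_notMem (fun hh => h.not_ge hh.2) _)

/-- A function that lists the jumps `Jᵢ`, `Tᵢ ≤ 1`, by increasing value of `Eᵢ / Jᵢ`. -/
lemma sizeBiasedJump_eq_of_isSorting {Ω : Type*} {T J E : ℕ → Ω → ℝ} {ω : Ω} {X : ℕ → ℝ}
    {σ : ℕ → ℕ} (h : IsSorting {i | T i ω ≤ 1} X σ)
    (hX : ∀ i j, E i ω / J i ω < E j ω / J j ω ↔ X i < X j) :
    sizeBiasedJump T J E ω = fun n => J (σ n) ω := by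
  funext n
  unfold sizeBiasedJump
  have hset : {i : ℕ | T i ω ≤ 1 ∧
      {j : ℕ | T j ω ≤ 1 ∧ E j ω / J j ω < E i ω / J i ω}.encard = n} = {σ n} := by
    ext i
    simp only [hX, mem_ofPred_eq, mem_singleton_iff]
    constructor
    · rintro ⟨h1, h2⟩
      exact (h.rank_iff n i h1).1 h2
    · rintro rfl
      have hm : σ n ∈ {i | T i ω ≤ 1} := h.range_eq.subset (mem_range_self n)
      exact ⟨hm, (h.rank_iff n _ hm).2 rfl⟩
  refine (tsum_congr_set_coe (fun i => J i ω) hset).trans ?_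
  exact tsum_singleton (σ n) fun i => J i ω

lemma firstMark_eq_of_isSorting {Ω : Type*} {T J E : ℕ → Ω → ℝ} {ω : Ω} {X : ℕ → ℝ}
    {σ : ℕ → ℕ} (h : IsSorting {i | T i ω ≤ 1} X σ)
    (hX : ∀ i j, E i ω / J i ω < E j ω / J j ω ↔ X i < X j) :
    firstMark T J E ω = E (σ 0) ω / J (σ 0) ω := by
  unfold firstMark
  refine IsLeast.csInf_eq ⟨⟨σ 0, h.range_eq.subset (mem_range_self 0), rfl⟩, ?_⟩
  rintro _ ⟨i, hi, rfl⟩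
  rw [← h.range_eq] at hi
  obtain ⟨n, rfl⟩ := hi
  simp only
  rw [← not_lt, hX, not_lt]
  exact h.strictMono.monotone (Nat.zero_le n)

/-! ### Marked Poisson processes of jumps -/

section Marked

variable {μ : Measure ℝ} {Q : Measure (ℕ → ℝ × ℝ)}

lemma measurable_countingMeasure_id :
    Measurable fun x : ℕ → ℝ × ℝ => countingMeasure x :=
  measurable_countingMeasure fun n => measurable_pi_apply n

lemma campbell_tsum [SigmaFinite μ]
    (hQ : IsPoissonProcess (fun x : ℕ → ℝ × ℝ => countingMeasure x)
    ((volume.restrict (Ioi 0)).prod μ) Q) {f : ℝ × ℝ → ℝ≥0∞} (hf : Measurable f) :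
    ∫⁻ x, ∑' i, f (x i) ∂Q = ∫⁻ q, f q ∂((volume.restrict (Ioi 0)).prod μ) := by
  rw [← hQ.campbell measurable_countingMeasure_id hf]
  exact lintegral_congr fun x => (lintegral_countingMeasure x hf).symm

/-- The intensity does not charge the complement of the open quadrant, so the expected number of
points there is zero. -/
lemma ae_pos_points [SigmaFinite μ] (hμ : μ (Iic 0) = 0)
    (hQ : IsPoissonProcess (fun x : ℕ → ℝ × ℝ => countingMeasure x)
      ((volume.restrict (Ioi 0)).prod μ) Q) :
    ∀ᵐ x ∂Q, ∀ i, 0 < (x i).1 ∧ 0 < (x i).2 := by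
  set C : Set (ℝ × ℝ) := Ioi 0 ×ˢ Ioi 0 with hC
  have hCm : MeasurableSet C := measurableSet_Ioi.prod measurableSet_Ioi
  have hν : ((volume.restrict (Ioi (0 : ℝ))).prod μ) Cᶜ = 0 := by
    have : Cᶜ ⊆ (Iic (0 : ℝ) ×ˢ univ) ∪ (univ ×ˢ Iic (0 : ℝ)) := by
      intro q hq
      simp only [hC, mem_compl_iff, mem_prod, mem_Ioi, not_and_or, not_lt] at hq
      rcases hq with h | h
      · exact Or.inl ⟨h, trivial⟩
      · exact Or.inr ⟨trivial, h⟩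
    refine measure_mono_null this (measure_union_null ?_ ?_)
    · rw [Measure.prod_prod, Measure.restrict_apply measurableSet_Iic, inter_comm, Ioi_inter_Iic,
        Ioc_self, measure_empty, zero_mul]
    · rw [Measure.prod_prod, hμ, mul_zero]
  have h := campbell_tsum hQ (measurable_const.indicator (f := fun _ => (1 : ℝ≥0∞)) hCm.compl)
  rw [lintegral_indicator_const hCm.compl, hν, mul_zero, lintegral_eq_zero_iff] at h
  · filter_upwards [h] with x hx i
    have := ENNReal.tsum_eq_zero.1 hx i
    by_contra hn
    have hm : x i ∈ Cᶜ := fun hmem => hn ⟨hmem.1, hmem.2⟩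
    rw [indicator_of_mem hm] at this
    exact one_ne_zero this
  · exact Measurable.tsum fun i =>
      (measurable_const.indicator hCm.compl).comp (measurable_pi_apply i)

/-- Campbell's formula shows that `∑ min(J, 1)` over the jumps up to time `s` has finite mean. When
it converges, all but finitely many of these jumps are below `1`, so the jumps are summable too. One
null set serves for all `σ`, which permits a random enumeration. -/
lemma ae_summable_jumps [SigmaFinite μ] (hμ : μ (Iic 0) = 0)
    (hμ1 : ∫⁻ u, ENNReal.ofReal (min u 1) ∂μ ≠ ∞)
    (hQ : IsPoissonProcess (fun x : ℕ → ℝ × ℝ => countingMeasure x)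
      ((volume.restrict (Ioi 0)).prod μ) Q) (s : ℝ) :
    ∀ᵐ x ∂Q, ∀ σ : ℕ → ℕ, Function.Injective σ → (∀ n, (x (σ n)).1 ≤ s) →
      Summable fun n => (x (σ n)).2 := by
  set f : ℝ × ℝ → ℝ≥0∞ := fun q => (Iic s).indicator 1 q.1 * ENNReal.ofReal (min q.2 1) with hf
  have hfm : Measurable f :=
    ((measurable_one.indicator measurableSet_Iic).comp measurable_fst).mul (by fun_prop)
  have h := campbell_tsum hQ hfm
  have hfin : ∫⁻ q, f q ∂((volume.restrict (Ioi 0)).prod μ) ≠ ∞ := by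
    rw [hf, lintegral_prod_mul (f := (Iic s).indicator 1)
      (g := fun u => ENNReal.ofReal (min u 1))
      (measurable_one.indicator measurableSet_Iic).aemeasurable (by fun_prop)]
    refine ENNReal.mul_ne_top ?_ hμ1
    rw [lintegral_indicator_one measurableSet_Iic, Measure.restrict_apply measurableSet_Iic,
      inter_comm, Ioi_inter_Iic, Real.volume_Ioc]
    exact ENNReal.ofReal_ne_top
  rw [← h] at hfin
  have hm : Measurable fun x : ℕ → ℝ × ℝ => ∑' i, f (x i) :=
    Measurable.tsum fun i => hfm.comp (measurable_pi_apply i)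
  filter_upwards [ae_lt_top hm hfin, ae_pos_points hμ hQ] with x hx hpos σ hσ hσs
  have h1 : ∑' n, ENNReal.ofReal (min (x (σ n)).2 1) ≠ ∞ := by
    refine ne_top_of_le_ne_top hx.ne (le_trans (le_of_eq ?_) (ENNReal.tsum_comp_le_tsum_of_injective
      hσ (fun i => f (x i))))
    refine tsum_congr fun n => ?_
    simp [hf, hσs n]
  have h2 : Summable fun n => min (x (σ n)).2 1 := by
    refine (ENNReal.summable_toReal h1).congr fun n => ?_
    rw [ENNReal.toReal_ofReal (le_min (hpos _).2.le zero_le_one)]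
  have h3 := h2.tendsto_cofinite_zero.eventually (gt_mem_nhds (show (0 : ℝ) < 1 by norm_num))
  refine h2.of_norm_bounded_eventually ?_
  filter_upwards [h3] with n hn
  rw [Real.norm_of_nonneg (hpos _).2.le]
  rcases min_lt_iff.1 hn with h4 | h4
  · rw [min_eq_left h4.le]
  · exact absurd h4 (lt_irrefl _)

/-- The void probabilities of a marked Poisson process, after a change of variables. -/
lemma void_marked_points [IsProbabilityMeasure Q]
    (hQ : IsPoissonProcess (fun x : ℕ → ℝ × ℝ => countingMeasure x)
    ((volume.restrict (Ioi 0)).prod μ) Q) {A : Set ((ℝ × ℝ) × ℝ)} (hA : MeasurableSet A)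
    (hfin : (((volume.restrict (Ioi 0)).prod μ).prod (expMeasure 1)) A ≠ ∞) :
    (Q.prod expSeq) {p | ∀ i, (p.1 i, p.2 i) ∉ A} =
      expNeg ((((volume.restrict (Ioi 0)).prod μ).prod (expMeasure 1)) A) := by
  set ν := (volume.restrict (Ioi (0 : ℝ))).prod μ
  refine (measure_void_marking Q (x := fun i x => x i) (fun i => measurable_pi_apply i)
    (expMeasure 1) hA).trans ?_
  set φ : ℝ × ℝ → ℝ≥0∞ := fun q => (expMeasure 1) {y | (q, y) ∉ A} with hφ
  have hφm : Measurable φ := measurable_measure_prodMk_left hA.compl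
  have hφ1 : ∀ q, φ q ≤ 1 := fun q => prob_le_one
  have h1φ : ∀ q, 1 - φ q = (expMeasure 1) {y | (q, y) ∈ A} := fun q => by
    have : φ q = 1 - (expMeasure 1) {y | (q, y) ∈ A} :=
      prob_compl_eq_one_sub (measurable_prodMk_left hA)
    rw [this, ENNReal.sub_sub_cancel ENNReal.one_ne_top prob_le_one]
  have hint : ∫⁻ q, (1 - φ q) ∂ν = (ν.prod (expMeasure 1)) A := by
    rw [Measure.prod_apply hA]
    exact lintegral_congr fun q => h1φ q
  -- Given the points, the void probability is the product of the `φ(xᵢ)`. Its mean is the Laplace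
  -- functional at `-log φ`.
  have hneg : Measurable fun q => negLog (φ q) := negLog_measurable.comp hφm
  have hL := hQ.laplace measurable_countingMeasure_id hneg (fun c hc => ?_)
  · simp_rw [expNeg_negLog (hφ1 _)] at hL
    rw [← hint, ← hL]
    refine lintegral_congr fun x => ?_
    rw [lintegral_countingMeasure x hneg, expNeg_tsum]
    exact tprod_congr fun i => (expNeg_negLog (hφ1 _)).symm
  -- The level sets of `-log φ` have finite intensity by Markov's inequality: `-log φ ≥ c` forces `1
  -- - φ ≥ 1 - e^{-c} > 0`, and `1 - φ` has the finite integral `hint`.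
  · have hc1 : expNeg c < 1 := by
      unfold expNeg
      rw [ENNReal.inv_lt_one, EReal.one_lt_exp_iff]
      exact_mod_cast pos_iff_ne_zero.2 hc
    have hle : {q | c ≤ negLog (φ q)} ⊆ {q | 1 - expNeg c ≤ 1 - φ q} := fun q hq => by
      have := expNeg_antitone (show c ≤ negLog (φ q) from hq)
      rw [expNeg_negLog (hφ1 q)] at this
      exact tsub_le_tsub_left this 1
    refine ne_top_of_le_ne_top ?_ (measure_mono hle)
    have hpos : 1 - expNeg c ≠ 0 := (tsub_pos_of_lt hc1).ne'
    have h1m : AEMeasurable (fun q => 1 - φ q) ν := (measurable_const.sub hφm).aemeasurable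
    refine ((meas_ge_le_lintegral_div h1m hpos
      (ENNReal.sub_ne_top ENNReal.one_ne_top)).trans_lt ?_).ne
    rw [hint]
    exact ENNReal.div_lt_top hfin hpos

/-- By Campbell's formula and Fubini over the marks, the expected number of marked points in `A` is
the measure of `A`, which is finite. -/
lemma ae_finite_marked_points [SigmaFinite μ]
    (hQ : IsPoissonProcess (fun x : ℕ → ℝ × ℝ => countingMeasure x)
    ((volume.restrict (Ioi 0)).prod μ) Q) {A : Set ((ℝ × ℝ) × ℝ)} (hA : MeasurableSet A)
    (hfin : (((volume.restrict (Ioi 0)).prod μ).prod (expMeasure 1)) A ≠ ∞) :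
    ∀ᵐ p ∂(Q.prod expSeq), {i | (p.1 i, p.2 i) ∈ A}.Finite := by
  have hm : ∀ i : ℕ, Measurable fun p : (ℕ → ℝ × ℝ) × (ℕ → ℝ) =>
      A.indicator (1 : (ℝ × ℝ) × ℝ → ℝ≥0∞) (p.1 i, p.2 i) := fun i =>
    (measurable_one.indicator hA).comp (by fun_prop)
  have h : ∫⁻ p, ∑' i, A.indicator (1 : (ℝ × ℝ) × ℝ → ℝ≥0∞) (p.1 i, p.2 i) ∂(Q.prod expSeq) =
      (((volume.restrict (Ioi 0)).prod μ).prod (expMeasure 1)) A := by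
    rw [Measure.prod_apply hA, ← campbell_tsum hQ (measurable_measure_prodMk_left hA),
      lintegral_prod _ (Measurable.tsum hm).aemeasurable]
    refine lintegral_congr fun x => ?_
    have hmx : ∀ i : ℕ, Measurable fun e : ℕ → ℝ =>
        A.indicator (1 : (ℝ × ℝ) × ℝ → ℝ≥0∞) (x i, e i) := fun i =>
      (hm i).comp measurable_prodMk_left
    rw [lintegral_tsum fun i => (hmx i).aemeasurable]
    refine tsum_congr fun i => ?_
    rw [← lintegral_indicator_one (measurable_prodMk_left hA)]
    exact (measurePreserving_eval_infinitePi (fun _ : ℕ => expMeasure 1) i).lintegral_comp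
      (f := fun y => A.indicator (1 : (ℝ × ℝ) × ℝ → ℝ≥0∞) (x i, y))
      ((measurable_one.indicator hA).comp measurable_prodMk_left)
  filter_upwards [ae_lt_top (Measurable.tsum hm) (h ▸ hfin)] with p hp
  have hfs := ENNReal.finite_const_le_of_tsum_ne_top hp.ne one_ne_zero
  refine hfs.subset fun i hi => ?_
  simp only [mem_ofPred_eq] at hi ⊢
  rw [indicator_of_mem hi]; rfl

instance : NullSingletonClass (expMeasure 1) := by unfold expMeasure gammaMeasure; infer_instance

/-- Given the jumps, a tie between two indices prescribes one mark as a function of the other. The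
marks are independent without atoms, and there are countably many pairs. -/
lemma ae_injective_marks [SigmaFinite μ] (hμ : μ (Iic 0) = 0)
    (hQ : IsPoissonProcess (fun x : ℕ → ℝ × ℝ => countingMeasure x)
      ((volume.restrict (Ioi 0)).prod μ) Q) :
    ∀ᵐ p ∂(Q.prod expSeq), Function.Injective fun i => p.2 i / (p.1 i).2 := by
  have hpair : ∀ i j : ℕ, i ≠ j → ∀ᵐ p ∂(Q.prod expSeq),
      0 < (p.1 i).2 ∧ 0 < (p.1 j).2 → p.2 i / (p.1 i).2 ≠ p.2 j / (p.1 j).2 := by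
    intro i j hij
    have hms : MeasurableSet {p : (ℕ → ℝ × ℝ) × (ℕ → ℝ) |
        ¬ (0 < (p.1 i).2 ∧ 0 < (p.1 j).2 → p.2 i / (p.1 i).2 ≠ p.2 j / (p.1 j).2)} := by
      have h1 : ∀ k : ℕ, MeasurableSet {p : (ℕ → ℝ × ℝ) × (ℕ → ℝ) | 0 < (p.1 k).2} := fun k =>
        measurableSet_lt (by fun_prop) (by fun_prop)
      have h2 : MeasurableSet {p : (ℕ → ℝ × ℝ) × (ℕ → ℝ) |
          p.2 i / (p.1 i).2 = p.2 j / (p.1 j).2} :=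
        measurableSet_eq_fun (by fun_prop) (by fun_prop)
      simp only [Classical.not_imp, not_not]
      exact ((h1 i).inter (h1 j)).inter h2
    rw [ae_iff, Measure.measure_prod_null hms]
    refine ae_of_all _ fun x => ?_
    by_cases hx : 0 < (x i).2 ∧ 0 < (x j).2
    · have h2 := Measure.infinitePi_map_eval_prod (P := fun _ : ℕ => expMeasure 1) hij
      have hS : MeasurableSet {q : ℝ × ℝ | q.1 / (x i).2 = q.2 / (x j).2} :=
        measurableSet_eq_fun (by fun_prop) (by fun_prop)
      have h3 : ((expMeasure 1).prod (expMeasure 1)) {q : ℝ × ℝ | q.1 / (x i).2 = q.2 / (x j).2}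
          = 0 := by
        rw [Measure.measure_prod_null hS]
        refine ae_of_all _ fun a => ?_
        refine measure_mono_null (t := {a / (x i).2 * (x j).2}) (fun b hb => ?_)
          (measure_singleton _)
        have hb' : a / (x i).2 = b / (x j).2 := hb
        rw [mem_singleton_iff, hb', div_mul_cancel₀ _ hx.2.ne']
      rw [← h2, Measure.map_apply (by fun_prop) hS] at h3
      refine measure_mono_null (fun e he => ?_) h3
      simp only [mem_preimage, mem_ofPred_eq, Classical.not_imp, not_not] at he ⊢
      exact he.2
    · refine measure_mono_null (t := ∅) (fun e he => ?_) measure_empty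
      simp only [mem_preimage, mem_ofPred_eq, Classical.not_imp, not_not] at he
      exact hx he.1
  have hall : ∀ᵐ p ∂(Q.prod expSeq), ∀ i j : ℕ, i ≠ j →
      0 < (p.1 i).2 ∧ 0 < (p.1 j).2 → p.2 i / (p.1 i).2 ≠ p.2 j / (p.1 j).2 :=
    ae_all_iff.2 fun i => ae_all_iff.2 fun j => by
      by_cases hij : i = j
      · exact ae_of_all _ fun p h => absurd hij h
      · filter_upwards [hpair i j hij] with p hp _ using hp
  filter_upwards [hall, Measure.quasiMeasurePreserving_fst.ae (ae_pos_points hμ hQ)]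
    with p hp hpos i j hij
  by_contra hne
  exact hp i j hne ⟨(hpos i).2, (hpos j).2⟩ hij

end Marked

/-- The points `(Λ(Eᵢ / Jᵢ), Y(Jᵢ, Eᵢ))`, `Tᵢ ≤ s`, of a marked subordinator, in increasing order of
their abscissas. -/
noncomputable def sortedPoints (s : ℝ) (Λ : ℝ → ℝ) (Y : ℝ × ℝ → ℝ)
    (p : (ℕ → ℝ × ℝ) × (ℕ → ℝ)) (n : ℕ) : ℝ × ℝ :=
  let i := sortIdx {i | (p.1 i).1 ≤ s} (fun i => Λ (p.2 i / (p.1 i).2)) n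
  (Λ (p.2 i / (p.1 i).2), Y ((p.1 i).2, p.2 i))

lemma prod_prod_setOf_le {μ : Measure ℝ} [SigmaFinite μ] (s : ℝ) {C : Set (ℝ × ℝ)}
    (hC : MeasurableSet C) :
    (((volume.restrict (Ioi 0)).prod μ).prod (expMeasure 1))
      {q | q.1.1 ≤ s ∧ (q.1.2, q.2) ∈ C} = ENNReal.ofReal s * (μ.prod (expMeasure 1)) C := by
  have h1 : {q : (ℝ × ℝ) × ℝ | q.1.1 ≤ s ∧ (q.1.2, q.2) ∈ C} =
      MeasurableEquiv.prodAssoc ⁻¹' (Iic s ×ˢ C) := rfl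
  rw [h1, ← Measure.map_apply MeasurableEquiv.prodAssoc.measurable (measurableSet_Iic.prod hC),
    Measure.prodAssoc_prod, Measure.prod_prod, Measure.restrict_apply measurableSet_Iic, inter_comm,
    Ioi_inter_Iic, Real.volume_Ioc, sub_zero]

/-- Hypothesis `hdis` says that the marked jumps up to time `s`, sent to `(Λ(E/J), Y(J, E))`, have
intensity `Leb × γ`. Their void probabilities are then those required by `sorted_law`. Strict
monotonicity of `Λ` carries the absence of ties among the ratios `E/J` over to the abscissas. -/
theorem marked_jumps {μ : Measure ℝ} [SigmaFinite μ] {Q : Measure (ℕ → ℝ × ℝ)}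
    [IsProbabilityMeasure Q] (hμ : μ (Iic 0) = 0)
    (hμ1 : ∫⁻ u, ENNReal.ofReal (min u 1) ∂μ ≠ ∞)
    (hQ : IsPoissonProcess (fun x : ℕ → ℝ × ℝ => countingMeasure x)
      ((volume.restrict (Ioi 0)).prod μ) Q)
    {γ : Measure ℝ} [IsProbabilityMeasure γ] {s : ℝ} {Λ : ℝ → ℝ} (hΛ : Measurable Λ)
    (hmono : StrictMonoOn Λ (Ioi 0)) {Y : ℝ × ℝ → ℝ} (hY : Measurable Y)
    (hdis : ∀ B : Set (ℝ × ℝ), MeasurableSet B →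
      ENNReal.ofReal s * (μ.prod (expMeasure 1)) {q | (Λ (q.2 / q.1), Y q) ∈ B} =
        ((volume.restrict (Ioi 0)).prod γ) B) :
    (∀ᵐ p ∂(Q.prod expSeq), (∀ i, 0 < (p.1 i).2 ∧ 0 < p.2 i) ∧
      IsSorting {i | (p.1 i).1 ≤ s} (fun i => Λ (p.2 i / (p.1 i).2))
        (sortIdx {i | (p.1 i).1 ≤ s} fun i => Λ (p.2 i / (p.1 i).2)) ∧
      Summable fun n => (p.1 (sortIdx {i | (p.1 i).1 ≤ s}
        (fun i => Λ (p.2 i / (p.1 i).2)) n)).2) ∧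
    Measurable (sortedPoints s Λ Y) ∧
    (Q.prod expSeq).map (sortedPoints s Λ Y) = renewalLaw γ := by
  set I : (ℕ → ℝ × ℝ) × (ℕ → ℝ) → Set ℕ := fun p => {i | (p.1 i).1 ≤ s} with hIdef
  set X : ℕ → (ℕ → ℝ × ℝ) × (ℕ → ℝ) → ℝ := fun i p => Λ (p.2 i / (p.1 i).2) with hXdef
  set V : ℕ → (ℕ → ℝ × ℝ) × (ℕ → ℝ) → ℝ := fun i p => Y ((p.1 i).2, p.2 i) with hVdef
  have hI : ∀ i, MeasurableSet {p | i ∈ I p} := fun i =>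
    measurableSet_le (f := fun p : (ℕ → ℝ × ℝ) × (ℕ → ℝ) => (p.1 i).1) (by fun_prop) (by fun_prop)
  have hX : ∀ i, Measurable (X i) := fun i => hΛ.comp (by fun_prop)
  have hV : ∀ i, Measurable (V i) := fun i => hY.comp (by fun_prop)
  have hpos : ∀ᵐ p ∂(Q.prod expSeq), ∀ i, 0 < (p.1 i).2 ∧ 0 < p.2 i := by
    filter_upwards [Measure.quasiMeasurePreserving_fst.ae (ae_pos_points hμ hQ),
      Measure.quasiMeasurePreserving_snd.ae ae_pos_expSeq] with p h1 h2 i using ⟨(h1 i).2, h2 i⟩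
  have hC : ∀ {B : Set (ℝ × ℝ)}, MeasurableSet B →
      MeasurableSet {q : ℝ × ℝ | (Λ (q.2 / q.1), Y q) ∈ B} := fun {B} hB =>
    hB.preimage ((hΛ.comp (by fun_prop)).prodMk hY)
  have hA : ∀ {B : Set (ℝ × ℝ)}, MeasurableSet B → MeasurableSet {q : (ℝ × ℝ) × ℝ |
      q.1.1 ≤ s ∧ (q.1.2, q.2) ∈ {q : ℝ × ℝ | (Λ (q.2 / q.1), Y q) ∈ B}} := fun {B} hB =>
    (measurableSet_le (f := fun q : (ℝ × ℝ) × ℝ => q.1.1) (g := fun _ => s) (by fun_prop)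
      (by fun_prop)).inter ((hC hB).preimage (f := fun q : (ℝ × ℝ) × ℝ => (q.1.2, q.2))
      (by fun_prop))
  have hmeas : ∀ {B : Set (ℝ × ℝ)}, MeasurableSet B →
      (((volume.restrict (Ioi 0)).prod μ).prod (expMeasure 1)) {q : (ℝ × ℝ) × ℝ |
      q.1.1 ≤ s ∧ (q.1.2, q.2) ∈ {q : ℝ × ℝ | (Λ (q.2 / q.1), Y q) ∈ B}} =
      ((volume.restrict (Ioi 0)).prod γ) B := fun {B} hB => by
    rw [prod_prod_setOf_le s (hC hB), hdis B hB]
  have hBfin : ∀ {B : Set (ℝ × ℝ)} {R : ℝ}, (∀ q ∈ B, q.1 ≤ R) →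
      ((volume.restrict (Ioi (0 : ℝ))).prod γ) B ≠ ∞ := fun {B R} hR => by
    refine ne_top_of_le_ne_top ?_ (measure_mono (t := Iic R ×ˢ univ) fun q hq => ⟨hR q hq, trivial⟩)
    rw [Measure.prod_prod, Measure.restrict_apply measurableSet_Iic, inter_comm, Ioi_inter_Iic,
      Real.volume_Ioc, measure_univ, mul_one]
    exact ENNReal.ofReal_ne_top
  have hinj : ∀ᵐ p ∂(Q.prod expSeq), InjOn (fun i => X i p) (I p) := by
    filter_upwards [hpos, ae_injective_marks hμ hQ] with p h1 h2 i _ j _ hij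
    exact h2 (hmono.injOn (mem_Ioi.2 (div_pos (h1 i).2 (h1 i).1))
      (mem_Ioi.2 (div_pos (h1 j).2 (h1 j).1)) hij)
  have hfin : ∀ᵐ p ∂(Q.prod expSeq), ∀ m : ℕ, {i | i ∈ I p ∧ X i p ≤ m}.Finite := by
    refine ae_all_iff.2 fun m => ?_
    have hB : MeasurableSet (Iic (m : ℝ) ×ˢ (univ : Set ℝ)) := measurableSet_Iic.prod .univ
    filter_upwards [ae_finite_marked_points hQ (hA hB)
      (hmeas hB ▸ hBfin (R := m) fun q hq => hq.1)] with p hp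
    exact hp.subset fun i hi => ⟨hi.1, hi.2, trivial⟩
  have hvoid : ∀ (B : Set (ℝ × ℝ)), MeasurableSet B → (∃ R, ∀ q ∈ B, q.1 ≤ R) →
      (Q.prod expSeq) {p | ∀ i ∈ I p, (X i p, V i p) ∉ B} =
        expNeg (((volume.restrict (Ioi 0)).prod γ) B) := by
    rintro B hB ⟨R, hR⟩
    rw [← hmeas hB, ← void_marked_points hQ (hA hB) (hmeas hB ▸ hBfin hR)]
    congr 1
    ext p
    simp only [mem_ofPred_eq, not_and]
    rfl
  have hmain := sorted_law hI hX hV hinj hfin hvoid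
  refine ⟨?_, ?_, hmain.2⟩
  · filter_upwards [hpos, hmain.1, Measure.quasiMeasurePreserving_fst.ae
      (ae_summable_jumps hμ hμ1 hQ s)] with p h1 h2 h3
    exact ⟨h1, h2, h3 _ h2.injective fun n => h2.range_eq.subset (mem_range_self n)⟩
  · exact measurable_pi_iff.2 fun n => (measurable_comp_index hX (measurable_sortIdx hI hX n)).prodMk
      (measurable_comp_index hV (measurable_sortIdx hI hX n))

/-! ### The stable and gamma subordinators -/

instance (α : ℝ) : SigmaFinite (stableLevy α) := by
  unfold stableLevy; exact SigmaFinite.withDensity_ofReal _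

instance : SigmaFinite gammaLevy := by
  unfold gammaLevy; exact SigmaFinite.withDensity_ofReal _

lemma stableLevy_Iic (α : ℝ) : stableLevy α (Iic 0) = 0 := by
  refine withDensity_absolutelyContinuous _ _ ?_
  rw [Measure.restrict_apply measurableSet_Iic, inter_comm, Ioi_inter_Iic, Ioc_self, measure_empty]

lemma gammaLevy_Iic : gammaLevy (Iic 0) = 0 := by
  refine withDensity_absolutelyContinuous _ _ ?_
  rw [Measure.restrict_apply measurableSet_Iic, inter_comm, Ioi_inter_Iic, Ioc_self, measure_empty]

lemma lintegral_stableLevy (α : ℝ) {f : ℝ → ℝ≥0∞} (hf : Measurable f) :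
    ∫⁻ u, f u ∂(stableLevy α) =
      ∫⁻ u in Ioi 0, ENNReal.ofReal (α / Real.Gamma (1 - α) * u ^ (-(α + 1))) * f u := by
  unfold stableLevy
  rw [lintegral_withDensity_eq_lintegral_mul _ (by fun_prop) hf]
  rfl

lemma lintegral_gammaLevy {f : ℝ → ℝ≥0∞} (hf : Measurable f) :
    ∫⁻ u, f u ∂gammaLevy = ∫⁻ u in Ioi 0, ENNReal.ofReal (u⁻¹ * Real.exp (-u)) * f u := by
  unfold gammaLevy
  rw [lintegral_withDensity_eq_lintegral_mul _ (by fun_prop) hf]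
  rfl

/-- Near zero the integrand is of order `u^{-α}`, integrable as `α < 1`; at infinity it is of order
`u^{-α-1}`, integrable as `α > 0`. -/
lemma lintegral_min_stableLevy {α : ℝ} (h0 : 0 < α) (h1 : α < 1) :
    ∫⁻ u, ENNReal.ofReal (min u 1) ∂(stableLevy α) ≠ ∞ := by
  have hG : 0 < Real.Gamma (1 - α) := Real.Gamma_pos_of_pos (by linarith)
  have hc : 0 ≤ α / Real.Gamma (1 - α) := by positivity
  rw [lintegral_stableLevy α (by fun_prop), ← Ioc_union_Ioi_eq_Ioi zero_le_one,
    lintegral_union measurableSet_Ioi (Ioc_disjoint_Ioi le_rfl)]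
  refine ENNReal.add_ne_top.2 ⟨?_, ?_⟩
  · have hi : IntegrableOn (fun u : ℝ => α / Real.Gamma (1 - α) * u ^ (-α)) (Ioc 0 1) :=
      ((intervalIntegrable_iff_integrableOn_Ioc_of_le zero_le_one).1
        (intervalIntegral.intervalIntegrable_rpow' (by linarith))).const_mul _
    refine ne_top_of_le_ne_top hi.lintegral_lt_top.ne
      (setLIntegral_mono' measurableSet_Ioc fun u hu => ?_)
    rw [← ENNReal.ofReal_mul (mul_nonneg hc (Real.rpow_nonneg hu.1.le _))]
    refine ENNReal.ofReal_le_ofReal ?_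
    rw [min_eq_left hu.2, mul_assoc, ← Real.rpow_add_one hu.1.ne']
    simp
  · have hi : IntegrableOn (fun u : ℝ => α / Real.Gamma (1 - α) * u ^ (-(α + 1))) (Ioi 1) :=
      (integrableOn_Ioi_rpow_of_lt (by linarith) one_pos).const_mul _
    refine ne_top_of_le_ne_top hi.lintegral_lt_top.ne
      (setLIntegral_mono' measurableSet_Ioi fun u hu => ?_)
    refine mul_le_of_le_one_right' ?_
    rw [← ENNReal.ofReal_one]
    exact ENNReal.ofReal_le_ofReal (min_le_right _ _)

lemma lintegral_min_gammaLevy : ∫⁻ u, ENNReal.ofReal (min u 1) ∂gammaLevy ≠ ∞ := by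
  rw [lintegral_gammaLevy (by fun_prop)]
  have hi : IntegrableOn (fun u : ℝ => Real.exp (-u)) (Ioi 0) := integrableOn_exp_neg_Ioi 0
  refine ne_top_of_le_ne_top hi.lintegral_lt_top.ne
    (setLIntegral_mono' measurableSet_Ioi fun u hu => ?_)
  have hu' : (0 : ℝ) < u := hu
  rw [← ENNReal.ofReal_mul (by positivity)]
  refine ENNReal.ofReal_le_ofReal ?_
  calc u⁻¹ * Real.exp (-u) * min u 1 ≤ u⁻¹ * Real.exp (-u) * u := by
        gcongr; exact min_le_left _ _
    _ = Real.exp (-u) := by field_simp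

/-- The derivative of `(e/u)^α` is `-α e^α u^{-α-1}`, proportional to the stable density, so the
image measure is a multiple of Lebesgue measure. -/
lemma stableLevy_change_of_variables {α : ℝ} (h0 : 0 < α) (h1 : α < 1) {e : ℝ} (he : 0 < e)
    {f : ℝ → ℝ≥0∞} (hf : Measurable f) :
    ∫⁻ u, f ((e / u) ^ α) ∂(stableLevy α) =
      ENNReal.ofReal (e ^ (-α) / Real.Gamma (1 - α)) * ∫⁻ x in Ioi 0, f x := by
  have hG : 0 < Real.Gamma (1 - α) := Real.Gamma_pos_of_pos (by linarith)
  have himage : (fun u : ℝ => (e / u) ^ α) '' Ioi 0 = Ioi 0 := by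
    ext x
    constructor
    · rintro ⟨u, hu, rfl⟩
      exact Real.rpow_pos_of_pos (div_pos he hu) _
    · intro hx
      have hx' : (0 : ℝ) < x := hx
      refine ⟨e / x ^ (1 / α), div_pos he (Real.rpow_pos_of_pos hx' _), ?_⟩
      simp only
      rw [div_div_cancel₀ he.ne', ← Real.rpow_mul hx'.le, one_div_mul_cancel h0.ne', Real.rpow_one]
  have hinj : InjOn (fun u : ℝ => (e / u) ^ α) (Ioi 0) := by
    intro u hu v hv huv
    have hu' : (0 : ℝ) < u := hu
    have hv' : (0 : ℝ) < v := hv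
    have := (Real.rpow_left_inj (div_pos he hu').le (div_pos he hv').le h0.ne').1 huv
    rw [div_eq_div_iff hu'.ne' hv'.ne'] at this
    exact (mul_left_cancel₀ he.ne' this).symm
  have hderiv : ∀ u ∈ Ioi (0 : ℝ), HasDerivWithinAt (fun u : ℝ => (e / u) ^ α)
      (-(α * e ^ α * u ^ (-(α + 1)))) (Ioi 0) u := by
    intro u hu
    have hu' : (0 : ℝ) < u := hu
    have h2 : HasDerivAt (fun u : ℝ => e ^ α * u ^ (-α)) (e ^ α * (-α * u ^ (-α - 1))) u :=
      (Real.hasDerivAt_rpow_const (Or.inl hu'.ne')).const_mul _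
    have h3 : HasDerivWithinAt (fun u : ℝ => (e / u) ^ α) (e ^ α * (-α * u ^ (-α - 1)))
        (Ioi 0) u := by
      refine h2.hasDerivWithinAt.congr (fun v hv => ?_) ?_
      · rw [Real.div_rpow he.le (le_of_lt hv), Real.rpow_neg (le_of_lt hv)]; rfl
      · rw [Real.div_rpow he.le hu'.le, Real.rpow_neg hu'.le]; rfl
    convert! h3 using 1
    rw [neg_add']; ring
  have hcv := lintegral_image_eq_lintegral_abs_deriv_mul measurableSet_Ioi hderiv hinj f
  rw [himage] at hcv
  have hfe : Measurable fun u : ℝ => f ((e / u) ^ α) := hf.comp (by fun_prop)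
  rw [hcv, lintegral_stableLevy α hfe, ← lintegral_const_mul _ (by fun_prop)]
  refine setLIntegral_congr_fun measurableSet_Ioi fun u hu => ?_
  have hu' : (0 : ℝ) < u := hu
  have hpu : 0 ≤ u ^ (-(α + 1)) := Real.rpow_nonneg hu'.le _
  rw [← mul_assoc, ← ENNReal.ofReal_mul (by positivity), abs_neg, abs_of_nonneg (by positivity),
    Real.rpow_neg he.le]
  congr 2
  have : e ^ α ≠ 0 := (Real.rpow_pos_of_pos he _).ne'
  field_simp

/-- At fixed mark `e`, the constant `e^{-α}/Γ(1-α)` of the change of variables times the exponential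
density is the `gamma(1-α, 1)` density. -/
lemma stable_disintegration {α : ℝ} (h0 : 0 < α) (h1 : α < 1) {B : Set (ℝ × ℝ)}
    (hB : MeasurableSet B) :
    ENNReal.ofReal 1 * ((stableLevy α).prod (expMeasure 1)) {q | ((q.2 / q.1) ^ α, q.2) ∈ B} =
      ((volume.restrict (Ioi 0)).prod (gammaMeasure (1 - α) 1)) B := by
  have := isProbabilityMeasure_gammaMeasure (a := 1 - α) (by linarith) one_pos
  have hC : MeasurableSet {q : ℝ × ℝ | ((q.2 / q.1) ^ α, q.2) ∈ B} := hB.preimage (by fun_prop)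
  rw [ENNReal.ofReal_one, one_mul, Measure.prod_apply_symm hC, Measure.prod_apply_symm hB,
    lintegral_expMeasure _ (measurable_measure_prodMk_right hC),
    lintegral_gammaMeasure _ (measurable_measure_prodMk_right hB)]
  refine setLIntegral_congr_fun measurableSet_Ioi fun e he => ?_
  have he' : (0 : ℝ) < e := he
  have hBe : MeasurableSet ((fun x => (x, e)) ⁻¹' B) := measurable_prodMk_right hB
  have h3 := stableLevy_change_of_variables h0 h1 he' (f := ((fun x => (x, e)) ⁻¹' B).indicator 1)
    (measurable_one.indicator hBe)
  rw [lintegral_indicator_one hBe] at h3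
  have h4 : (stableLevy α) ((fun x => (x, e)) ⁻¹' {q : ℝ × ℝ | ((q.2 / q.1) ^ α, q.2) ∈ B}) =
      ∫⁻ u, ((fun x => (x, e)) ⁻¹' B).indicator 1 ((e / u) ^ α) ∂(stableLevy α) := by
    rw [← lintegral_indicator_one (measurable_prodMk_right hC)]
    rfl
  rw [h4, h3, ← mul_assoc, ← ENNReal.ofReal_mul (Real.exp_pos _).le]
  congr 2
  rw [show 1 - α - 1 = -α by ring]
  ring

/-- The map `j ↦ θ log(y/j)` decreases from `(0,y)` onto `(0,∞)`, with derivative `-θ/j`. -/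
lemma gamma_change_of_variables {θ : ℝ} (hθ : 0 < θ) {y : ℝ} (hy : 0 < y)
    {f : ℝ → ℝ≥0∞} :
    ∫⁻ j in Ioo 0 y, ENNReal.ofReal (θ * j⁻¹) * f (θ * Real.log (y / j)) =
      ∫⁻ x in Ioi 0, f x := by
  have himage : (fun j : ℝ => θ * Real.log (y / j)) '' Ioo 0 y = Ioi 0 := by
    ext x
    constructor
    · rintro ⟨j, hj, rfl⟩
      exact mul_pos hθ (Real.log_pos ((one_lt_div hj.1).2 hj.2))
    · intro hx
      have hx' : (0 : ℝ) < x := hx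
      refine ⟨y * Real.exp (-(x / θ)), ⟨by positivity, ?_⟩, ?_⟩
      · exact mul_lt_of_lt_one_right hy (by simpa using div_pos hx' hθ)
      · simp only
        rw [Real.exp_neg, ← div_eq_mul_inv, div_div_cancel₀ hy.ne', Real.log_exp]
        field_simp
  have hinj : InjOn (fun j : ℝ => θ * Real.log (y / j)) (Ioo 0 y) := by
    intro u hu v hv huv
    have := Real.log_injOn_pos (mem_Ioi.2 (div_pos hy hu.1)) (mem_Ioi.2 (div_pos hy hv.1))
      (mul_left_cancel₀ hθ.ne' huv)
    rw [div_eq_div_iff hu.1.ne' hv.1.ne'] at this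
    exact (mul_left_cancel₀ hy.ne' this).symm
  have hderiv : ∀ u ∈ Ioo (0 : ℝ) y, HasDerivWithinAt (fun j : ℝ => θ * Real.log (y / j))
      (-(θ * u⁻¹)) (Ioo 0 y) u := by
    intro u hu
    have h2 : HasDerivAt (fun u : ℝ => θ * (Real.log y - Real.log u)) (θ * (0 - u⁻¹)) u :=
      ((hasDerivAt_const u (Real.log y)).sub (Real.hasDerivAt_log hu.1.ne')).const_mul θ
    have h3 : HasDerivWithinAt (fun j : ℝ => θ * Real.log (y / j)) (θ * (0 - u⁻¹))
        (Ioo 0 y) u := by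
      refine h2.hasDerivWithinAt.congr (fun v hv => ?_) ?_
      · rw [Real.log_div hy.ne' hv.1.ne']
      · rw [Real.log_div hy.ne' hu.1.ne']
    convert! h3 using 1
    ring
  have hcv := lintegral_image_eq_lintegral_abs_deriv_mul measurableSet_Ioo hderiv hinj f
  rw [himage] at hcv
  rw [hcv]
  refine setLIntegral_congr_fun measurableSet_Ioo fun u hu => ?_
  have hu' := hu.1
  rw [abs_neg, abs_of_nonneg (by positivity)]

/-- With `y = j + e` the density is `e^{-y} θ/j` on `j < y`, and `1 + e/j = y/j`. Exchanging the
integrals, the inner one over `j` is `gamma_change_of_variables`. The shape `1 - 0` is `1 - α` at `α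
= 0`. -/
lemma gamma_disintegration {θ : ℝ} (hθ : 0 < θ) {B : Set (ℝ × ℝ)} (hB : MeasurableSet B) :
    ENNReal.ofReal θ * (gammaLevy.prod (expMeasure 1))
      {q | (θ * Real.log (1 + q.2 / q.1), q.1 + q.2) ∈ B} =
      ((volume.restrict (Ioi 0)).prod (gammaMeasure (1 - 0) 1)) B := by
  rw [sub_zero]
  change _ = ((volume.restrict (Ioi 0)).prod (expMeasure 1)) B
  have hC : MeasurableSet {q : ℝ × ℝ | (θ * Real.log (1 + q.2 / q.1), q.1 + q.2) ∈ B} :=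
    hB.preimage (by fun_prop)
  set b : ℝ × ℝ → ℝ≥0∞ := B.indicator 1 with hb
  have hbm : Measurable b := measurable_one.indicator hB
  have e1 : ∀ j ∈ Ioi (0 : ℝ), (expMeasure 1) (Prod.mk j ⁻¹'
      {q : ℝ × ℝ | (θ * Real.log (1 + q.2 / q.1), q.1 + q.2) ∈ B}) =
      ∫⁻ y in Ioi 0, (Ioi j).indicator
        (fun y => ENNReal.ofReal (Real.exp (-(y - j))) * b (θ * Real.log (y / j), y)) y := by
    intro j hj
    have hj' : (0 : ℝ) < j := hj
    rw [← lintegral_indicator_one (measurable_prodMk_left hC), lintegral_expMeasure _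
      (measurable_one.indicator (measurable_prodMk_left hC)), setLIntegral_indicator
      measurableSet_Ioi, inter_eq_left.2 (Ioi_subset_Ioi hj'.le)]
    have := (measurePreserving_add_left volume j).setLIntegral_comp_preimage_emb
      (measurableEmbedding_addLeft j)
      (fun y => ENNReal.ofReal (Real.exp (-(y - j))) * b (θ * Real.log (y / j), y)) (Ioi j)
    rw [← this]
    have hpre : (fun x => j + x) ⁻¹' Ioi j = Ioi 0 := by ext x; simp
    rw [hpre]
    refine setLIntegral_congr_fun measurableSet_Ioi fun e he => ?_
    simp only [add_sub_cancel_left]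
    rw [add_div, div_self hj'.ne']
    rfl
  rw [Measure.prod_apply hC, lintegral_gammaLevy (measurable_measure_prodMk_left hC),
    ← lintegral_const_mul _ (by
      exact (by fun_prop : Measurable fun u : ℝ => ENNReal.ofReal (u⁻¹ * Real.exp (-u))).mul
        (measurable_measure_prodMk_left hC)),
    Measure.prod_apply_symm hB, lintegral_expMeasure _ (measurable_measure_prodMk_right hB)]
  set F : ℝ → ℝ → ℝ≥0∞ := fun j y => (Ioi j).indicator
    (fun y => ENNReal.ofReal (Real.exp (-y)) * (ENNReal.ofReal (θ * j⁻¹) *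
      b (θ * Real.log (y / j), y))) y with hF
  have hFm : Measurable (Function.uncurry F) := by
    have h1 : Measurable fun p : ℝ × ℝ => ENNReal.ofReal (Real.exp (-p.2)) *
        (ENNReal.ofReal (θ * p.1⁻¹) * b (θ * Real.log (p.2 / p.1), p.2)) :=
      Measurable.mul (by fun_prop) (Measurable.mul (by fun_prop) (hbm.comp (by fun_prop)))
    have h2 : MeasurableSet {p : ℝ × ℝ | p.1 < p.2} := measurableSet_lt measurable_fst measurable_snd
    exact h1.indicator h2
  have step1 : ∀ j ∈ Ioi (0 : ℝ), ENNReal.ofReal θ * (ENNReal.ofReal (j⁻¹ * Real.exp (-j)) *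
      (expMeasure 1) (Prod.mk j ⁻¹'
        {q : ℝ × ℝ | (θ * Real.log (1 + q.2 / q.1), q.1 + q.2) ∈ B})) =
      ∫⁻ y in Ioi 0, F j y := by
    intro j hj
    have hj' : (0 : ℝ) < j := hj
    rw [e1 j hj, ← lintegral_const_mul', ← lintegral_const_mul']
    · refine lintegral_congr fun y => ?_
      simp only [hF, indicator]
      split_ifs
      · simp only [← mul_assoc]
        rw [← ENNReal.ofReal_mul hθ.le, ← ENNReal.ofReal_mul (by positivity),
          ← ENNReal.ofReal_mul (by positivity)]
        congr 2
        rw [show -(y - j) = -y + j by ring, Real.exp_add, Real.exp_neg j]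
        field_simp
      · simp
    · exact ENNReal.ofReal_ne_top
    · exact ENNReal.ofReal_ne_top
  rw [setLIntegral_congr_fun measurableSet_Ioi step1, lintegral_lintegral_swap hFm.aemeasurable]
  refine setLIntegral_congr_fun measurableSet_Ioi fun y hy => ?_
  have hy' : (0 : ℝ) < y := hy
  have hBy : MeasurableSet ((fun x => (x, y)) ⁻¹' B) := measurable_prodMk_right hB
  have hFi : ∀ j, F j y = (Iio y).indicator (fun j => ENNReal.ofReal (Real.exp (-y)) *
      (ENNReal.ofReal (θ * j⁻¹) * b (θ * Real.log (y / j), y))) j := fun j => rfl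
  simp_rw [hFi]
  rw [setLIntegral_indicator measurableSet_Iio, inter_comm, Ioi_inter_Iio,
    lintegral_const_mul' _ _ ENNReal.ofReal_ne_top,
    gamma_change_of_variables hθ hy' (f := fun x => b (x, y)), ← lintegral_indicator_one hBy]
  rfl

/-! ### Beta, gamma and exponential variables -/

lemma lintegral_betaMeasure_one {b : ℝ} (hb : 0 < b) (f : ℝ → ℝ≥0∞) (hf : Measurable f) :
    ∫⁻ u, f u ∂(betaMeasure b 1) = ∫⁻ u in Ioo 0 1, ENNReal.ofReal (b * u ^ (b - 1)) * f u := by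
  have hm : Measurable (betaPDF b 1) := (measurable_betaPDFReal b 1).ennreal_ofReal
  have hbeta : beta b 1 = 1 / b := by
    have hG : Real.Gamma b ≠ 0 := (Real.Gamma_pos_of_pos hb).ne'
    unfold beta
    rw [Real.Gamma_one, Real.Gamma_add_one hb.ne']
    field_simp
  unfold betaMeasure
  rw [lintegral_withDensity_eq_lintegral_mul _ hm hf, ← lintegral_indicator measurableSet_Ioo]
  refine lintegral_congr fun u => ?_
  by_cases hu : u ∈ Ioo (0 : ℝ) 1
  · rw [indicator_of_mem hu, Pi.mul_apply, betaPDF_of_pos_lt_one hu.1 hu.2, hbeta]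
    simp
  · rw [indicator_of_notMem hu, Pi.mul_apply]
    rw [mem_Ioo, not_and_or, not_lt, not_lt] at hu
    rcases hu with h | h
    · rw [betaPDF_eq_zero_of_nonpos h, zero_mul]
    · rw [betaPDF_eq_zero_of_one_le h, zero_mul]

lemma lintegral_expMeasure_add {x : ℝ} (hx : 0 < x) {k : ℝ → ℝ≥0∞} (hk : Measurable k) :
    ∫⁻ s, k (x + s) ∂(expMeasure 1) =
      ∫⁻ y in Ioi 0, (Ioi x).indicator (fun y => ENNReal.ofReal (Real.exp (-(y - x))) * k y) y := by
  rw [lintegral_expMeasure (fun s => k (x + s)) (hk.comp (measurable_const_add x)),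
    setLIntegral_indicator measurableSet_Ioi, inter_eq_left.2 (Ioi_subset_Ioi hx.le)]
  have := (measurePreserving_add_left volume x).setLIntegral_comp_preimage_emb
    (measurableEmbedding_addLeft x)
    (fun y => ENNReal.ofReal (Real.exp (-(y - x))) * k y) (Ioi x)
  rw [← this]
  have hpre : (fun s => x + s) ⁻¹' Ioi x = Ioi 0 := by ext s; simp
  rw [hpre]
  refine setLIntegral_congr_fun measurableSet_Ioi fun e he => ?_
  simp only [add_sub_cancel_left]

/-- The substitution `x = y u^α` turns `x^{c-1} dx` into `y^c α u^{αc-1} du`, that is `y^c/c` times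
the `beta(αc, 1)` law. -/
lemma beta_change_of_variables {c α : ℝ} (hc : 0 < c) (hα : 0 < α) {y : ℝ} (hy : 0 < y)
    {f : ℝ → ℝ≥0∞} (hf : Measurable f) :
    ∫⁻ x in Ioo 0 y, ENNReal.ofReal (x ^ (c - 1)) * f ((x / y) ^ (1 / α)) =
      ENNReal.ofReal (y ^ c / c) * ∫⁻ u, f u ∂(betaMeasure (α * c) 1) := by
  have hmaps : ∀ u ∈ Ioo (0 : ℝ) 1, u ^ α ∈ Ioo (0 : ℝ) 1 := fun u hu =>
    ⟨Real.rpow_pos_of_pos hu.1 _, Real.rpow_lt_one hu.1.le hu.2 hα⟩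
  have hpow : ∀ u : ℝ, 0 < u → (y * u ^ α / y) ^ (1 / α) = u := fun u hu => by
    rw [mul_div_cancel_left₀ _ hy.ne', ← Real.rpow_mul hu.le, mul_one_div_cancel hα.ne',
      Real.rpow_one]
  have himage : (fun u : ℝ => y * u ^ α) '' Ioo 0 1 = Ioo 0 y := by
    ext x
    constructor
    · rintro ⟨u, hu, rfl⟩
      exact ⟨mul_pos hy (hmaps u hu).1, mul_lt_of_lt_one_right hy (hmaps u hu).2⟩
    · intro hx
      have hxy : 0 < x / y := div_pos hx.1 hy
      refine ⟨(x / y) ^ (1 / α), ⟨Real.rpow_pos_of_pos hxy _, Real.rpow_lt_one hxy.le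
        ((div_lt_one hy).2 hx.2) (by positivity)⟩, ?_⟩
      simp only
      rw [← Real.rpow_mul hxy.le, one_div_mul_cancel hα.ne', Real.rpow_one, mul_div_cancel₀ _ hy.ne']
  have hinj : InjOn (fun u : ℝ => y * u ^ α) (Ioo 0 1) := by
    intro u hu v hv huv
    rw [← hpow u hu.1, ← hpow v hv.1]
    simp only at huv
    rw [huv]
  have hderiv : ∀ u ∈ Ioo (0 : ℝ) 1, HasDerivWithinAt (fun u : ℝ => y * u ^ α)
      (y * (α * u ^ (α - 1))) (Ioo 0 1) u := fun u hu =>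
    ((Real.hasDerivAt_rpow_const (Or.inl hu.1.ne')).const_mul y).hasDerivWithinAt
  have hcv := lintegral_image_eq_lintegral_abs_deriv_mul measurableSet_Ioo hderiv hinj
    (fun x => ENNReal.ofReal (x ^ (c - 1)) * f ((x / y) ^ (1 / α)))
  rw [himage] at hcv
  rw [hcv, lintegral_betaMeasure_one (by positivity) f hf, ← lintegral_const_mul _ (by fun_prop)]
  refine setLIntegral_congr_fun measurableSet_Ioo fun u hu => ?_
  have hu0 := hu.1
  have hp : 0 ≤ y * (α * u ^ (α - 1)) := by positivity
  rw [hpow u hu0, abs_of_nonneg hp, ← mul_assoc (ENNReal.ofReal _),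
    ← mul_assoc (ENNReal.ofReal (y ^ c / c)), ← ENNReal.ofReal_mul hp,
    ← ENNReal.ofReal_mul (by positivity)]
  congr 2
  have e1 : u ^ (α - 1) * (u ^ α) ^ (c - 1) = u ^ (α * c - 1) := by
    rw [← Real.rpow_mul hu0.le, ← Real.rpow_add hu0]; congr 1; ring
  have e2 : y * y ^ (c - 1) = y ^ c := by
    rw [mul_comm, ← Real.rpow_add_one hy.ne']; congr 1; ring
  rw [Real.mul_rpow hy.le (Real.rpow_nonneg hu0.le _), ← e1, ← e2]
  field_simp

/-- If `x ~ gamma(c, 1)` and `s ~ Exp(1)` are independent then `(x / (x + s))^{1/α}` and `x + s` are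
independent with laws `beta(α c, 1)` and `gamma(c + 1, 1)`. -/
lemma lintegral_beta_gamma {c α : ℝ} (hc : 0 < c) (hα : 0 < α) {f F : ℝ → ℝ≥0∞}
    (hf : Measurable f) (hF : Measurable F) :
    ∫⁻ x, ∫⁻ s, f ((x / (x + s)) ^ (1 / α)) * F (x + s) ∂(expMeasure 1) ∂(gammaMeasure c 1) =
      (∫⁻ u, f u ∂(betaMeasure (α * c) 1)) * ∫⁻ y, F y ∂(gammaMeasure (c + 1) 1) := by
  have hG : 0 < Real.Gamma c := Real.Gamma_pos_of_pos hc
  have hjm : Measurable fun p : ℝ × ℝ => f ((p.1 / (p.1 + p.2)) ^ (1 / α)) * F (p.1 + p.2) :=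
    (hf.comp (by fun_prop)).mul (hF.comp (by fun_prop))
  have : SFinite (expMeasure 1) := inferInstance
  rw [lintegral_gammaMeasure _ hjm.lintegral_prod_right']
  -- With `y = x + s`, the joint density of `(x, y)` is `x^{c-1} e^{-y}/Γ(c)` on `x < y`.
  -- Integrating over `x` first gives `y^c/c`, and `c Γ(c) = Γ(c+1)`.
  set K : ℝ → ℝ → ℝ≥0∞ := fun x y => (Ioi x).indicator (fun y =>
    ENNReal.ofReal (Real.exp (-y) / Real.Gamma c) * F y *
      (ENNReal.ofReal (x ^ (c - 1)) * f ((x / y) ^ (1 / α)))) y with hK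
  have hKm : Measurable (Function.uncurry K) := by
    have h1 : Measurable fun p : ℝ × ℝ => ENNReal.ofReal (Real.exp (-p.2) / Real.Gamma c) * F p.2 *
        (ENNReal.ofReal (p.1 ^ (c - 1)) * f ((p.1 / p.2) ^ (1 / α))) :=
      Measurable.mul (Measurable.mul (by fun_prop) (hF.comp measurable_snd))
        (Measurable.mul (by fun_prop) (hf.comp (by fun_prop)))
    have h2 : MeasurableSet {p : ℝ × ℝ | p.1 < p.2} := measurableSet_lt measurable_fst measurable_snd
    exact h1.indicator h2
  have step1 : ∀ x ∈ Ioi (0 : ℝ), ENNReal.ofReal (x ^ (c - 1) * Real.exp (-x) / Real.Gamma c) *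
      ∫⁻ s, f ((x / (x + s)) ^ (1 / α)) * F (x + s) ∂(expMeasure 1) = ∫⁻ y in Ioi 0, K x y := by
    intro x hx
    have hx' : (0 : ℝ) < x := hx
    have hkm : Measurable fun y => f ((x / y) ^ (1 / α)) * F y := (hf.comp (by fun_prop)).mul hF
    rw [lintegral_expMeasure_add hx' hkm, ← lintegral_const_mul' _ _ ENNReal.ofReal_ne_top]
    refine lintegral_congr fun y => ?_
    simp only [hK, indicator]
    split_ifs
    · have e : ∀ a b A B : ℝ≥0∞, a * (b * (A * B)) = (a * b) * (A * B) := fun a b A B => by ring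
      have e' : ∀ a b A B : ℝ≥0∞, a * B * (b * A) = (a * b) * (A * B) := fun a b A B => by ring
      rw [e (ENNReal.ofReal _) (ENNReal.ofReal _) (f _) (F _),
        e' (ENNReal.ofReal _) (ENNReal.ofReal _) (f _) (F _),
        ← ENNReal.ofReal_mul (by positivity), ← ENNReal.ofReal_mul (by positivity)]
      congr 2
      rw [show -(y - x) = -y + x by ring, Real.exp_add, Real.exp_neg x]
      field_simp
    · simp
  rw [setLIntegral_congr_fun measurableSet_Ioi step1, lintegral_lintegral_swap hKm.aemeasurable,
    lintegral_gammaMeasure F hF, ← lintegral_const_mul _ (by fun_prop)]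
  refine setLIntegral_congr_fun measurableSet_Ioi fun y hy => ?_
  have hy' : (0 : ℝ) < y := hy
  have hKi : ∀ x, K x y = (Iio y).indicator (fun x =>
    ENNReal.ofReal (Real.exp (-y) / Real.Gamma c) * F y *
      (ENNReal.ofReal (x ^ (c - 1)) * f ((x / y) ^ (1 / α)))) x := fun x => rfl
  simp_rw [hKi]
  have hm : Measurable fun x => ENNReal.ofReal (x ^ (c - 1)) * f ((x / y) ^ (1 / α)) :=
    Measurable.mul (by fun_prop) (hf.comp (by fun_prop))
  rw [setLIntegral_indicator measurableSet_Iio, inter_comm, Ioi_inter_Iio,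
    lintegral_const_mul _ hm, beta_change_of_variables hc hα hy' hf]
  have e : ∀ a b A B : ℝ≥0∞, a * A * (b * B) = B * (a * b * A) := fun a b A B => by ring
  rw [e, ← ENNReal.ofReal_mul (by positivity)]
  congr 3
  rw [Real.Gamma_add_one hc.ne', add_sub_cancel_right]
  field_simp

/-- If `s ~ Exp(1)` then `e^{-s/θ} ~ beta(θ, 1)`. -/
lemma map_exp_expMeasure {θ : ℝ} (hθ : 0 < θ) :
    (expMeasure 1).map (fun s => Real.exp (-s / θ)) = betaMeasure θ 1 := by
  refine Measure.ext_of_lintegral _ fun f hf => ?_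
  have hfe : Measurable fun s => f (Real.exp (-s / θ)) := hf.comp (by fun_prop)
  rw [lintegral_map hf (by fun_prop), lintegral_betaMeasure_one hθ f hf,
    lintegral_expMeasure _ hfe]
  have himage : (fun s : ℝ => Real.exp (-s / θ)) '' Ioi 0 = Ioo 0 1 := by
    ext x
    constructor
    · rintro ⟨s, hs, rfl⟩
      have hs' : (0 : ℝ) < s := hs
      refine ⟨Real.exp_pos _, Real.exp_lt_one_iff.2 (?_ : -s / θ < 0)⟩
      exact div_neg_of_neg_of_pos (by linarith) hθ
    · intro hx
      refine ⟨-(θ * Real.log x), ?_, ?_⟩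
      · have := mul_pos hθ (neg_pos.2 (Real.log_neg hx.1 hx.2))
        simp only [mem_Ioi]; linarith
      · simp only [neg_neg]
        rw [mul_div_cancel_left₀ _ hθ.ne', Real.exp_log hx.1]
  have hinj : InjOn (fun s : ℝ => Real.exp (-s / θ)) (Ioi 0) := by
    intro u _ v _ huv
    have := Real.exp_injective huv
    rw [div_left_inj' hθ.ne'] at this
    linarith
  have hderiv : ∀ s ∈ Ioi (0 : ℝ), HasDerivWithinAt (fun s : ℝ => Real.exp (-s / θ))
      (Real.exp (-s / θ) * (-1 / θ)) (Ioi 0) s := fun s _ =>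
    (((hasDerivAt_id s).neg.div_const θ).exp).hasDerivWithinAt
  have hcv := lintegral_image_eq_lintegral_abs_deriv_mul measurableSet_Ioi hderiv hinj
    (fun u => ENNReal.ofReal (θ * u ^ (θ - 1)) * f u)
  rw [himage] at hcv
  rw [hcv]
  refine setLIntegral_congr_fun measurableSet_Ioi fun s hs => ?_
  rw [← mul_assoc, ← ENNReal.ofReal_mul (abs_nonneg _)]
  congr 2
  have habs : |Real.exp (-s / θ) * (-1 / θ)| = Real.exp (-s / θ) * (1 / θ) := by
    rw [neg_div θ 1, mul_neg, abs_neg, abs_of_nonneg (by positivity)]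
  have hexp : Real.exp (-s) = Real.exp (-s / θ) * Real.exp (-s / θ * (θ - 1)) := by
    rw [← Real.exp_add]
    congr 1
    field_simp
    ring
  rw [habs, ← Real.exp_mul, hexp]
  field_simp

/-- With `b = θ/α` this is the effect of the change of measure on the first waiting time, and it
explains the constant `Γ(θ/α+1)`. -/
lemma expMeasure_withDensity {b : ℝ} (hb : 0 < b + 1) :
    (expMeasure 1).withDensity (fun x => ENNReal.ofReal (x ^ b / Real.Gamma (b + 1))) =
      gammaMeasure (b + 1) 1 := by
  have hG := Real.Gamma_pos_of_pos hb
  refine Measure.ext_of_lintegral _ fun f hf => ?_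
  rw [lintegral_withDensity_eq_lintegral_mul _ (by fun_prop) hf,
    lintegral_expMeasure _ (Measurable.mul (by fun_prop) hf), lintegral_gammaMeasure _ hf]
  refine setLIntegral_congr_fun measurableSet_Ioi fun x hx => ?_
  simp only [Pi.mul_apply]
  rw [← mul_assoc, ← ENNReal.ofReal_mul (Real.exp_pos _).le, add_sub_cancel_right]
  congr 2
  ring

/-! ### Ratios of gamma sums -/

instance {a : ℝ} [Fact (0 < a)] : IsProbabilityMeasure (gammaMeasure a 1) :=
  isProbabilityMeasure_gammaMeasure Fact.out one_pos

/-- The laws of the waiting times, when the first one is `gamma(a, 1)` and the others `Exp(1)`. -/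
noncomputable def waitLaw (a : ℝ) : ℕ → Measure ℝ :=
  Function.update (fun _ => expMeasure 1) 0 (gammaMeasure a 1)

instance {a : ℝ} [Fact (0 < a)] (n : ℕ) : IsProbabilityMeasure (waitLaw a n) := by
  unfold waitLaw
  by_cases h : n = 0
  · subst h; rw [Function.update_self]; infer_instance
  · rw [Function.update_of_ne h]; infer_instance

lemma waitLaw_zero (a : ℝ) : waitLaw a 0 = gammaMeasure a 1 := by simp [waitLaw]

lemma waitLaw_succ (a : ℝ) (n : ℕ) : waitLaw a (n + 1) = expMeasure 1 := by simp [waitLaw]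

/-- The ratios `((d₀ + ⋯ + dₙ) / (d₀ + ⋯ + dₙ₊₁))^{1/α}`. -/
noncomputable def sumRatio (α : ℝ) (d : ℕ → ℝ) (n : ℕ) : ℝ :=
  ((∑ i ∈ Finset.range (n + 1), d i) / ∑ i ∈ Finset.range (n + 2), d i) ^ (1 / α)

lemma measurable_sumRatio (α : ℝ) : Measurable (sumRatio α) :=
  measurable_pi_iff.2 fun n => by unfold sumRatio; fun_prop

/-- The test function `F` of the running sum carries the induction: integrating out the newest
waiting time leaves a function `H` of the previous sum. By `lintegral_beta_gamma`, the new ratio is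
independent of the new sum. -/
lemma lintegral_prod_sumRatio {a α : ℝ} [ha : Fact (0 < a)] (hα : 0 < α)
    {t : ℕ → ℝ → ℝ≥0∞} (ht : ∀ n, Measurable (t n)) (n : ℕ) {F : ℝ → ℝ≥0∞} (hF : Measurable F) :
    ∫⁻ d, (∏ k ∈ Finset.range n, t k (sumRatio α d k)) * F (∑ i ∈ Finset.range (n + 1), d i)
        ∂(Measure.infinitePi (waitLaw a)) =
      (∏ k ∈ Finset.range n, ∫⁻ u, t k u ∂(betaMeasure (α * (a + k)) 1)) *
        ∫⁻ y, F y ∂(gammaMeasure (a + n) 1) := by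
  have hr : ∀ k, Measurable fun d : ℕ → ℝ => t k (sumRatio α d k) := fun k =>
    (ht k).comp ((measurable_pi_apply k).comp (measurable_sumRatio α))
  induction n generalizing F with
  | zero =>
    simp only [Finset.range_zero, Finset.prod_empty, one_mul, zero_add, Finset.sum_range_one,
      Nat.cast_zero, add_zero]
    rw [← waitLaw_zero a]
    exact (measurePreserving_eval_infinitePi (waitLaw a) 0).lintegral_comp hF
  | succ n ih =>
    have hm : Measurable fun d : ℕ → ℝ => (∏ k ∈ Finset.range (n + 1), t k (sumRatio α d k)) *
        F (∑ i ∈ Finset.range (n + 1 + 1), d i) :=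
      (Finset.measurable_prod _ fun k _ => hr k).mul (hF.comp (by fun_prop))
    rw [lintegral_infinitePi_update (waitLaw a) (n + 1) hm]
    set H : ℝ → ℝ≥0∞ := fun x =>
      ∫⁻ s, t n ((x / (x + s)) ^ (1 / α)) * F (x + s) ∂(expMeasure 1) with hH
    have hjm : Measurable fun p : ℝ × ℝ => t n ((p.1 / (p.1 + p.2)) ^ (1 / α)) * F (p.1 + p.2) :=
      ((ht n).comp (by fun_prop)).mul (hF.comp (by fun_prop))
    have hHm : Measurable H := hjm.lintegral_prod_right'
    have hstep : ∀ d : ℕ → ℝ, ∫⁻ s, (∏ k ∈ Finset.range (n + 1),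
        t k (sumRatio α (Function.update d (n + 1) s) k)) *
        F (∑ i ∈ Finset.range (n + 1 + 1), Function.update d (n + 1) s i) ∂(waitLaw a (n + 1)) =
        (∏ k ∈ Finset.range n, t k (sumRatio α d k)) *
          H (∑ i ∈ Finset.range (n + 1), d i) := by
      intro d
      have hsum : ∀ s : ℝ, ∀ k ≤ n + 1, ∑ i ∈ Finset.range k, Function.update d (n + 1) s i =
          ∑ i ∈ Finset.range k, d i := fun s k hk =>
        Finset.sum_congr rfl fun i hi => Function.update_of_ne
          ((Finset.mem_range.1 hi).trans_le hk).ne _ _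
      have hsum' : ∀ s : ℝ, ∑ i ∈ Finset.range (n + 1 + 1), Function.update d (n + 1) s i =
          (∑ i ∈ Finset.range (n + 1), d i) + s := fun s => by
        rw [Finset.sum_range_succ, hsum s (n + 1) le_rfl, Function.update_self]
      have hprod : ∀ s : ℝ, ∏ k ∈ Finset.range n, t k (sumRatio α (Function.update d (n + 1) s) k)
          = ∏ k ∈ Finset.range n, t k (sumRatio α d k) := fun s =>
        Finset.prod_congr rfl fun k hk => by
          have hk' := Finset.mem_range.1 hk
          unfold sumRatio
          rw [hsum s (k + 1) (by omega), hsum s (k + 2) (by omega)]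
      have hlast : ∀ s : ℝ, sumRatio α (Function.update d (n + 1) s) n =
          ((∑ i ∈ Finset.range (n + 1), d i) / ((∑ i ∈ Finset.range (n + 1), d i) + s)) ^ (1 / α) :=
        fun s => by unfold sumRatio; rw [hsum s (n + 1) le_rfl, ← hsum' s]
      simp_rw [Finset.prod_range_succ, hprod, hlast, hsum', mul_assoc, waitLaw_succ]
      have hm' : ∀ x, Measurable fun s => t n ((x / (x + s)) ^ (1 / α)) * F (x + s) := fun x =>
        hjm.comp measurable_prodMk_left
      rw [lintegral_const_mul _ (hm' _)]
    simp_rw [hstep]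
    rw [ih hHm, Finset.prod_range_succ, mul_assoc]
    congr 1
    have hpos : 0 < a + n := add_pos_of_pos_of_nonneg ha.out (Nat.cast_nonneg n)
    rw [hH, lintegral_beta_gamma hpos hα (ht n) hF]
    congr 3
    push_cast; ring

lemma map_sumRatio {a α : ℝ} [ha : Fact (0 < a)] (hα : 0 < α)
    [∀ n : ℕ, IsProbabilityMeasure (betaMeasure (α * (a + n)) 1)] :
    (Measure.infinitePi (waitLaw a)).map (sumRatio α) =
      Measure.infinitePi fun n : ℕ => betaMeasure (α * (a + n)) 1 := by
  refine Measure.eq_infinitePi _ fun s t ht => ?_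
  classical
  have hms : MeasurableSet ((s : Set ℕ).pi t) := MeasurableSet.pi s.countable_toSet fun i _ => ht i
  rw [Measure.map_apply (measurable_sumRatio α) hms,
    ← lintegral_indicator_one (measurable_sumRatio α hms)]
  obtain ⟨N, hN⟩ := s.exists_nat_subset_range
  -- Cylinder sets are tested by products of indicators, with factor `1` at the unconstrained
  -- coordinates below `N`.
  set f : ℕ → ℝ → ℝ≥0∞ := fun n => if n ∈ s then (t n).indicator 1 else 1 with hf
  have hfm : ∀ n, Measurable (f n) := fun n => by
    simp only [hf]
    split_ifs
    · exact measurable_one.indicator (ht n)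
    · exact measurable_one
  have h := lintegral_prod_sumRatio (a := a) hα hfm N (F := fun _ => 1) measurable_const
  have hpos : 0 < a + N := add_pos_of_pos_of_nonneg ha.out (Nat.cast_nonneg N)
  have := isProbabilityMeasure_gammaMeasure hpos one_pos
  simp only [mul_one, lintegral_const, measure_univ] at h
  have hsub : ∀ g : ℕ → ℝ≥0∞, (∀ k, k ∉ s → g k = 1) → ∏ k ∈ Finset.range N, g k = ∏ k ∈ s, g k :=
    fun g hg => (Finset.prod_subset hN fun k _ hk => hg k hk).symm
  rw [hsub _ (fun k hk => by
    have : IsProbabilityMeasure (betaMeasure (α * (a + k)) 1) := inferInstance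
    simp [hf, hk])] at h
  have e : ∀ k ∈ s, ∫⁻ u, f k u ∂(betaMeasure (α * (a + k)) 1) =
      (betaMeasure (α * (a + k)) 1) (t k) := fun k hk => by
    simp only [hf, if_pos hk]
    exact lintegral_indicator_one (ht k)
  rw [Finset.prod_congr rfl e] at h
  rw [← h]
  refine lintegral_congr fun d => ?_
  rw [hsub _ (fun k hk => by simp [hf, hk])]
  by_cases hd : d ∈ sumRatio α ⁻¹' (s : Set ℕ).pi t
  · rw [indicator_of_mem hd]
    refine (Finset.prod_eq_one fun k hk => ?_).symm
    simp only [hf, if_pos hk]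
    exact indicator_of_mem (hd k hk) _
  · rw [indicator_of_notMem hd]
    simp only [mem_preimage, Set.mem_pi, not_forall] at hd
    obtain ⟨k, hk, hkt⟩ := hd
    refine (Finset.prod_eq_zero hk ?_).symm
    simp only [hf, if_pos (Finset.mem_coe.1 hk)]
    exact indicator_of_notMem hkt _

/-! ### Independent pairs of sequences -/

lemma map_sumElim_infinitePi (mG mD : ℕ → Measure ℝ) [∀ n, IsProbabilityMeasure (mG n)]
    [∀ n, IsProbabilityMeasure (mD n)] [∀ i, IsProbabilityMeasure (Sum.elim mG mD i)] :
    ((Measure.infinitePi mG).prod (Measure.infinitePi mD)).map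
      (fun p => (Sum.elim p.1 p.2 : ℕ ⊕ ℕ → ℝ)) = Measure.infinitePi (Sum.elim mG mD) := by
  have hm : Measurable fun p : (ℕ → ℝ) × (ℕ → ℝ) => (Sum.elim p.1 p.2 : ℕ ⊕ ℕ → ℝ) :=
    measurable_pi_iff.2 fun i => by
      rcases i with i | i <;> simp only [Sum.elim_inl, Sum.elim_inr] <;> fun_prop
  refine Measure.eq_infinitePi _ fun s t ht => ?_
  rw [Measure.map_apply hm (MeasurableSet.pi s.countable_toSet fun i _ => ht i)]
  have : (fun p : (ℕ → ℝ) × (ℕ → ℝ) => (Sum.elim p.1 p.2 : ℕ ⊕ ℕ → ℝ)) ⁻¹' (s : Set (ℕ ⊕ ℕ)).pi t =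
      ((s.toLeft : Set ℕ).pi fun i => t (Sum.inl i)) ×ˢ
        ((s.toRight : Set ℕ).pi fun i => t (Sum.inr i)) := by
    ext p
    simp [Set.mem_pi]
  rw [this, Measure.prod_prod, Measure.infinitePi_pi _ fun i _ => ht _,
    Measure.infinitePi_pi _ fun i _ => ht _, ← Finset.toLeft_disjSum_toRight (u := s),
    Finset.prod_disjSum]
  simp

lemma hasLaw_prod_of_iIndepFun {Ω : Type*} [MeasurableSpace Ω] {P : Measure Ω}
    {G D : ℕ → Ω → ℝ} {mG mD : ℕ → Measure ℝ} [∀ n, IsProbabilityMeasure (mG n)]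
    [∀ n, IsProbabilityMeasure (mD n)] (hG : ∀ n, HasLaw (G n) (mG n) P)
    (hD : ∀ n, HasLaw (D n) (mD n) P) (h : iIndepFun (Sum.elim G D) P) :
    HasLaw (fun ω => (fun n => G n ω, fun n => D n ω))
      ((Measure.infinitePi mG).prod (Measure.infinitePi mD)) P := by
  have : ∀ i, IsProbabilityMeasure (Sum.elim mG mD i) := by
    rintro (i | i)
    · exact inferInstanceAs (IsProbabilityMeasure (mG i))
    · exact inferInstanceAs (IsProbabilityMeasure (mD i))
  have hlaw : ∀ i, HasLaw (Sum.elim G D i) (Sum.elim mG mD i) P := by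
    rintro (i | i)
    · exact hG i
    · exact hD i
  have h1 := h.hasLaw_infinitePi hlaw (aemeasurable_pi_iff.2 fun i => (hlaw i).aemeasurable)
  rw [← map_sumElim_infinitePi] at h1
  have hm : Measurable fun p : (ℕ → ℝ) × (ℕ → ℝ) => (Sum.elim p.1 p.2 : ℕ ⊕ ℕ → ℝ) :=
    measurable_pi_iff.2 fun i => by
      rcases i with i | i <;> simp only [Sum.elim_inl, Sum.elim_inr] <;> fun_prop
  set r : (ℕ ⊕ ℕ → ℝ) → (ℕ → ℝ) × (ℕ → ℝ) := fun w =>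
    (fun n => w (Sum.inl n), fun n => w (Sum.inr n))
  have hr : Measurable r := by fun_prop
  have h2 : HasLaw r ((Measure.infinitePi mG).prod (Measure.infinitePi mD))
      (((Measure.infinitePi mG).prod (Measure.infinitePi mD)).map
        (fun p => (Sum.elim p.1 p.2 : ℕ ⊕ ℕ → ℝ))) := by
    refine ⟨hr.aemeasurable, ?_⟩
    rw [Measure.map_map hr hm]
    exact Measure.map_id
  exact h2.comp h1

lemma iIndepFun_sumElim_prod (mG mD : ℕ → Measure ℝ) [∀ n, IsProbabilityMeasure (mG n)]
    [∀ n, IsProbabilityMeasure (mD n)] :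
    iIndepFun (Sum.elim (fun n (p : (ℕ → ℝ) × (ℕ → ℝ)) => p.1 n) (fun n p => p.2 n))
      ((Measure.infinitePi mG).prod (Measure.infinitePi mD)) := by
  have : ∀ i, IsProbabilityMeasure (Sum.elim mG mD i) := by
    rintro (i | i)
    · exact inferInstanceAs (IsProbabilityMeasure (mG i))
    · exact inferInstanceAs (IsProbabilityMeasure (mD i))
  have hm : Measurable fun p : (ℕ → ℝ) × (ℕ → ℝ) => (Sum.elim p.1 p.2 : ℕ ⊕ ℕ → ℝ) :=
    measurable_pi_iff.2 fun i => by
      rcases i with i | i <;> simp only [Sum.elim_inl, Sum.elim_inr] <;> fun_prop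
  have e : (fun (p : (ℕ → ℝ) × (ℕ → ℝ)) i => Sum.elim
      (fun n (p : (ℕ → ℝ) × (ℕ → ℝ)) => p.1 n) (fun n p => p.2 n) i p) =
      fun p => (Sum.elim p.1 p.2 : ℕ ⊕ ℕ → ℝ) := by
    funext p i; rcases i with i | i <;> rfl
  have hlaw : ∀ i, HasLaw (Sum.elim (fun n (p : (ℕ → ℝ) × (ℕ → ℝ)) => p.1 n) (fun n p => p.2 n) i)
      (Sum.elim mG mD i) ((Measure.infinitePi mG).prod (Measure.infinitePi mD)) := by
    rintro (i | i)
    · exact ((measurePreserving_eval_infinitePi mG i).comp measurePreserving_fst).hasLaw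
    · exact ((measurePreserving_eval_infinitePi mD i).comp measurePreserving_snd).hasLaw
  rw [iIndepFun_iff_hasLaw_Pi_infinitePi hlaw (by rw [e]; exact hm.aemeasurable), e]
  exact ⟨hm.aemeasurable, map_sumElim_infinitePi mG mD⟩

/-- Changing the density of the law of a random variable. -/
lemma hasLaw_withDensity_comp {Ω X : Type*} [MeasurableSpace Ω] [MeasurableSpace X]
    {P : Measure Ω} [SFinite P] {μ : Measure X} {Z : Ω → X} (h : HasLaw Z μ P) {f : X → ℝ≥0∞}
    (hf : Measurable f) : HasLaw Z (μ.withDensity f) (P.withDensity fun ω => f (Z ω)) := by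
  have hZ : AEMeasurable Z (P.withDensity fun ω => f (Z ω)) :=
    h.aemeasurable.mono_ac (withDensity_absolutelyContinuous _ _)
  refine ⟨hZ, ?_⟩
  ext A hA
  have hnull : NullMeasurableSet (Z ⁻¹' A) P := h.aemeasurable.nullMeasurableSet_preimage hA
  rw [Measure.map_apply_of_aemeasurable hZ hA, withDensity_apply' _ (Z ⁻¹' A),
    withDensity_apply _ hA, ← lintegral_indicator hA, ← lintegral_indicator₀ hnull, ← h.map_eq,
    lintegral_map' (hf.indicator hA).aemeasurable h.aemeasurable]
  rfl

/-! ### Normalized sequences -/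

lemma measurable_normalizeSeq : Measurable normalizeSeq := by
  have h : Measurable fun x : ℕ → ℝ => ∑' j, x j := Measurable.tsum fun i => measurable_pi_apply i
  exact measurable_pi_iff.2 fun n => (measurable_pi_apply n).div h

lemma measurableSet_summable : MeasurableSet {x : ℕ → ℝ | Summable x} := by
  have e : {x : ℕ → ℝ | Summable x} = {x | ∑' n, ‖x n‖ₑ < ∞} := by
    ext x
    simp only [mem_ofPred_eq]
    rw [← summable_norm_iff, lt_top_iff_ne_top]
    simp only [enorm_eq_nnnorm]
    rw [ENNReal.tsum_coe_ne_top_iff_summable, ← NNReal.summable_coe]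
    rfl
  rw [e]
  exact measurableSet_lt (Measurable.tsum fun n => (measurable_pi_apply n).enorm) measurable_const

lemma normalizeSeq_const_mul {c : ℝ} (hc : c ≠ 0) (x : ℕ → ℝ) :
    normalizeSeq (fun n => c * x n) = normalizeSeq x := by
  funext n
  unfold normalizeSeq
  rw [tsum_mul_left, mul_div_mul_left _ _ hc]

/-- The sequence `gₙ u₀ ⋯ uₙ₋₁`. -/
def perpetuitySeq (q : (ℕ → ℝ) × (ℕ → ℝ)) (n : ℕ) : ℝ :=
  q.1 n * ∏ i ∈ Finset.range n, q.2 i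

lemma measurable_perpetuitySeq : Measurable perpetuitySeq :=
  measurable_pi_iff.2 fun n => by unfold perpetuitySeq; fun_prop

/-- A normalized perpetuity has the law of any sequence that is almost surely a multiple of a
perpetuity with the same input. -/
lemma hasLaw_normalizeSeq_perpetuityTerm {Ω W : Type*} [MeasurableSpace Ω] [MeasurableSpace W]
    {P : Measure Ω} {κ : Measure W} {ν : Measure ((ℕ → ℝ) × (ℕ → ℝ))} {G U : ℕ → Ω → ℝ}
    (hGU : HasLaw (fun ω => (fun n => G n ω, fun n => U n ω)) ν P)
    {r : W → (ℕ → ℝ) × (ℕ → ℝ)} (hr : HasLaw r ν κ) {v : W → ℕ → ℝ} {c : W → ℝ}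
    (hv : ∀ᵐ w ∂κ, c w ≠ 0 ∧ v w = (fun n => c w * perpetuitySeq (r w) n) ∧ Summable (v w)) :
    (∀ᵐ ω ∂P, Summable (perpetuityTerm G U ω)) ∧
      HasLaw (fun ω => normalizeSeq (perpetuityTerm G U ω))
        (κ.map fun w => normalizeSeq (v w)) P := by
  have hS : Measurable fun q => Summable (perpetuitySeq q) :=
    measurableSet_setOfPred.1 (measurable_perpetuitySeq measurableSet_summable)
  have hN : Measurable fun q => normalizeSeq (perpetuitySeq q) :=
    measurable_normalizeSeq.comp measurable_perpetuitySeq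
  constructor
  · refine (hGU.ae_iff hS).2 ((hr.ae_iff hS).1 ?_)
    filter_upwards [hv] with w ⟨h1, h2, h3⟩
    rw [h2] at h3
    exact (summable_mul_left_iff h1).1 h3
  · refine HasLaw.comp_of_hasLaw_comp (f := fun q => normalizeSeq (perpetuitySeq q))
      hN.aemeasurable hr hGU ⟨hN.comp_aemeasurable hr.aemeasurable, ?_⟩
    refine Measure.map_congr ?_
    filter_upwards [hv] with w ⟨h1, h2, h3⟩
    rw [h2, normalizeSeq_const_mul h1]

/-! ### Canonical versions of the jumps and of the marks -/

/-- Being a Poisson process is a property of the law, so the points may be moved to the canonical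
space of sequences. -/
lemma IsPoissonProcess.map_hasLaw {Ω Y X : Type*} [MeasurableSpace Ω] [MeasurableSpace Y]
    [MeasurableSpace X] {N : Y → Measure X} (hN : Measurable N) {Z : Ω → Y} (hZ : Measurable Z)
    {ν : Measure X} {P : Measure Ω} [IsProbabilityMeasure P]
    (h : IsPoissonProcess (fun ω => N (Z ω)) ν P) : IsPoissonProcess N ν (P.map Z) := by
  have := Measure.isProbabilityMeasure_map (μ := P) hZ.aemeasurable
  have hm : ∀ {B : Set X}, MeasurableSet B → Measurable fun y => N y B := fun hB =>
    (Measure.measurable_coe hB).comp hN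
  refine ⟨fun B hB hfin => ⟨(hm hB).aemeasurable, ?_⟩, fun k B hB hdisj => ?_⟩
  · rw [Measure.map_map (hm hB) hZ]
    exact (h.hasLaw_count B hB hfin).map_eq
  · have h1 := h.indep_count k B hB hdisj
    have hmZ : ∀ i, AEMeasurable (fun ω => N (Z ω) (B i)) P := fun i =>
      ((hm (hB i)).comp hZ).aemeasurable
    rw [iIndepFun_iff_map_fun_eq_pi_map hmZ] at h1
    rw [iIndepFun_iff_map_fun_eq_pi_map fun i => (hm (hB i)).aemeasurable,
      Measure.map_map (measurable_pi_iff.2 fun i => hm (hB i)) hZ]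
    simp_rw [Measure.map_map (hm (hB _)) hZ]
    exact h1

lemma IsSubordinatorJumps.measurable_points {Ω : Type*} [MeasurableSpace Ω] {P : Measure Ω}
    {μ : Measure ℝ} {T J : ℕ → Ω → ℝ} (h : IsSubordinatorJumps μ T J P) :
    Measurable fun ω i => (T i ω, J i ω) :=
  measurable_pi_iff.2 fun i => (h.measurable_time i).prodMk (h.measurable_jump i)

lemma IsSubordinatorJumps.isPoissonProcess_map
    {Ω : Type*} [MeasurableSpace Ω] {P : Measure Ω} [IsProbabilityMeasure P]
    {μ : Measure ℝ} {T J : ℕ → Ω → ℝ} (h : IsSubordinatorJumps μ T J P) :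
    IsPoissonProcess (fun x : ℕ → ℝ × ℝ => countingMeasure x)
      ((volume.restrict (Ioi 0)).prod μ) (P.map fun ω i => (T i ω, J i ω)) :=
  IsPoissonProcess.map_hasLaw measurable_countingMeasure_id h.measurable_points h.poisson

lemma IsExpMarking.hasLaw_prod
    {Ω : Type*} [MeasurableSpace Ω] {P : Measure Ω} [IsProbabilityMeasure P]
    {μ : Measure ℝ} {T J E : ℕ → Ω → ℝ} (h : IsSubordinatorJumps μ T J P)
    (hE : IsExpMarking T J E P) :
    HasLaw (fun ω => (fun i => (T i ω, J i ω), fun i => E i ω))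
      ((P.map fun ω i => (T i ω, J i ω)).prod expSeq) P := by
  have h1 : HasLaw (fun ω i => E i ω) expSeq P := hE.indep_marks.hasLaw_infinitePi hE.hasLaw_mark
    (aemeasurable_pi_iff.2 fun i => (hE.hasLaw_mark i).aemeasurable)
  have h2 : HasLaw (fun ω i => (T i ω, J i ω)) (P.map fun ω i => (T i ω, J i ω)) P :=
    ⟨h.measurable_points.aemeasurable, rfl⟩
  have := Measure.isProbabilityMeasure_map (μ := P) h.measurable_points.aemeasurable
  exact hE.indep_points.symm.hasLaw_prod h2 h1

/-! ### The stable case -/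

lemma div_add_one_pos {α θ : ℝ} (h0 : 0 < α) (hθ : -α < θ) : 0 < θ / α + 1 := by
  rw [div_add_one h0.ne']
  exact div_pos (by linarith) h0

/-- The law of the input `((Dₙ), (Gₙ))` of the gamma arrivals. -/
noncomputable def arrivalInputLaw (α θ : ℝ) : Measure ((ℕ → ℝ) × (ℕ → ℝ)) :=
  (Measure.infinitePi (waitLaw (θ / α + 1))).prod
    (Measure.infinitePi fun _ : ℕ => gammaMeasure (1 - α) 1)

lemma isProbabilityMeasure_arrivalInputLaw {α θ : ℝ} (h0 : 0 < α) (h1 : α < 1) (hθ : -α < θ) :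
    IsProbabilityMeasure (arrivalInputLaw α θ) := by
  have hb := div_add_one_pos h0 hθ
  have : Fact (0 < θ / α + 1) := ⟨hb⟩
  have := isProbabilityMeasure_gammaMeasure (a := 1 - α) (by linarith) one_pos
  unfold arrivalInputLaw
  infer_instance

/-- The sequence `gₙ (d₀ + ⋯ + dₙ)^{-1/α}`. -/
noncomputable def arrivalSeq (α : ℝ) (p : (ℕ → ℝ) × (ℕ → ℝ)) (n : ℕ) : ℝ :=
  p.2 n * (∑ i ∈ Finset.range (n + 1), p.1 i) ^ (-1 / α)

lemma measurable_arrivalSeq (α : ℝ) : Measurable (arrivalSeq α) :=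
  measurable_pi_iff.2 fun n => by unfold arrivalSeq; fun_prop

/-- The first abscissa is the first waiting time, so the density tilts a single factor of the
product measure. -/
lemma renewalLaw_withDensity {b : ℝ} (hb : 0 < b + 1) (γ : Measure ℝ) [IsProbabilityMeasure γ] :
    (renewalLaw γ).withDensity
        (fun z => ENNReal.ofReal ((z 0).1 ^ b / Real.Gamma (b + 1))) =
      ((Measure.infinitePi (waitLaw (b + 1))).prod (Measure.infinitePi fun _ : ℕ => γ)).map
        renewalPoints := by
  have : Fact (0 < b + 1) := ⟨hb⟩
  have : ∀ i, IsProbabilityMeasure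
      (Function.update (fun _ : ℕ => expMeasure 1) 0 (gammaMeasure (b + 1) 1) i) := fun i =>
    inferInstanceAs (IsProbabilityMeasure (waitLaw (b + 1) i))
  set f : ℝ → ℝ≥0∞ := fun x => ENNReal.ofReal (x ^ b / Real.Gamma (b + 1)) with hf
  have hfm : Measurable f := by fun_prop
  have h1 : HasLaw renewalPoints (renewalLaw γ) (expSeq.prod (Measure.infinitePi fun _ => γ)) :=
    ⟨measurable_renewalPoints.aemeasurable, rfl⟩
  have h2 := hasLaw_withDensity_comp h1 (f := fun z : ℕ → ℝ × ℝ => f (z 0).1)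
    (hfm.comp (by fun_prop))
  have h3 : (expSeq.prod (Measure.infinitePi fun _ : ℕ => γ)).withDensity
      (fun p => f (renewalPoints p 0).1) =
      (Measure.infinitePi (waitLaw (b + 1))).prod (Measure.infinitePi fun _ : ℕ => γ) := by
    have e : ∀ p, (renewalPoints p 0).1 = p.1 0 := fun p => by simp [renewalPoints]
    simp_rw [e]
    rw [← prod_withDensity_left (f := fun d : ℕ → ℝ => f (d 0)) (hfm.comp (by fun_prop)),
      infinitePi_withDensity_eval (fun _ : ℕ => expMeasure 1) 0 hfm (gammaMeasure (b + 1) 1)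
        (expMeasure_withDensity hb)]
    rfl
  rw [h3] at h2
  exact h2.map_eq.symm

/-- With `X = (E/J)^α` one has `J = E X^{-1/α}` and `Z₁^θ = X₁^{θ/α}`. Both the ordered jumps and
the density of the biased measure are therefore functions of the sorted points, whose law under `P`
is the renewal law. -/
theorem stable_sizeBiased {Ω : Type*} [MeasurableSpace Ω] {P : Measure Ω} [IsProbabilityMeasure P]
    {α θ : ℝ} (h0 : 0 < α) (h1 : α < 1) (hθ : -α < θ) {T J E : ℕ → Ω → ℝ}
    (h : IsSubordinatorJumps (stableLevy α) T J P) (hE : IsExpMarking T J E P) :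
    HasLaw (sizeBiasedJump T J E) ((arrivalInputLaw α θ).map (arrivalSeq α))
        (biased α θ T J E P) ∧
      ∀ᵐ ω ∂P, Summable (sizeBiasedJump T J E ω) ∧
        countingMeasure (normalizeSeq (sizeBiasedJump T J E ω)) = jumpPartition T J 1 ω := by
  have hb := div_add_one_pos h0 hθ
  have := isProbabilityMeasure_gammaMeasure (a := 1 - α) (by linarith) one_pos
  have := Measure.isProbabilityMeasure_map (μ := P) h.measurable_points.aemeasurable
  have hmono : StrictMonoOn (fun z : ℝ => z ^ α) (Ioi 0) := fun x hx y _ hxy =>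
    Real.rpow_lt_rpow (le_of_lt hx) hxy h0
  obtain ⟨hae, hm, hmap⟩ := marked_jumps (stableLevy_Iic α) (lintegral_min_stableLevy h0 h1)
    h.isPoissonProcess_map (s := 1) (Λ := fun z => z ^ α) (by fun_prop) hmono
    (Y := fun q => q.2) measurable_snd fun B hB => stable_disintegration h0 h1 hB
  have hΨ := hE.hasLaw_prod h
  have hP := ae_of_ae_map hΨ.aemeasurable (by rw [hΨ.map_eq]; exact hae)
  set z : Ω → ℕ → ℝ × ℝ := fun ω => sortedPoints 1 (fun z => z ^ α) (fun q => q.2)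
    (fun i => (T i ω, J i ω), fun i => E i ω) with hz
  have hzlaw : HasLaw z (renewalLaw (gammaMeasure (1 - α) 1)) P :=
    HasLaw.fun_comp ⟨hm.aemeasurable, hmap⟩ hΨ
  have hfacts : ∀ᵐ ω ∂P, sizeBiasedJump T J E ω = (fun n => (z ω n).2 * (z ω n).1 ^ (-1 / α)) ∧
      firstMark T J E ω ^ θ = (z ω 0).1 ^ (θ / α) ∧ Summable (sizeBiasedJump T J E ω) ∧
      countingMeasure (normalizeSeq (sizeBiasedJump T J E ω)) = jumpPartition T J 1 ω := by
    filter_upwards [hP] with ω ⟨hpos, hsort, hsum⟩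
    have hr : ∀ i, 0 < E i ω / J i ω := fun i => div_pos (hpos i).2 (hpos i).1
    have hX : ∀ i j, E i ω / J i ω < E j ω / J j ω ↔ (E i ω / J i ω) ^ α < (E j ω / J j ω) ^ α :=
      fun i j => (Real.rpow_lt_rpow_iff (hr i).le (hr j).le h0).symm
    have hsb := sizeBiasedJump_eq_of_isSorting hsort hX
    refine ⟨?_, ?_, ?_, ?_⟩
    · rw [hsb]
      funext n
      simp only [hz, sortedPoints]
      rw [← Real.rpow_mul (hr _).le, mul_div_cancel₀ _ h0.ne', Real.rpow_neg_one, inv_div,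
        mul_div_cancel₀ _ (hpos _).2.ne']
    · rw [firstMark_eq_of_isSorting hsort hX]
      simp only [hz, sortedPoints]
      rw [← Real.rpow_mul (hr _).le, mul_div_cancel₀ _ h0.ne']
    · rw [hsb]; exact hsum
    · rw [hsb]
      exact (jumpPartition_eq_of_range hsort.injective hsort.range_eq hsum
        fun i => (hpos i).1.le).symm
  refine ⟨?_, hfacts.mono fun ω hω => hω.2.2⟩
  have hbiased : biased α θ T J E P = P.withDensity
      fun ω => ENNReal.ofReal ((z ω 0).1 ^ (θ / α) / Real.Gamma (θ / α + 1)) := by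
    refine withDensity_congr_ae ?_
    filter_upwards [hfacts] with ω hω
    rw [hω.2.1]
  have hzb : HasLaw z ((arrivalInputLaw α θ).map renewalPoints) (biased α θ T J E P) := by
    rw [hbiased, arrivalInputLaw, ← renewalLaw_withDensity hb]
    exact hasLaw_withDensity_comp hzlaw
      (f := fun z : ℕ → ℝ × ℝ => ENNReal.ofReal ((z 0).1 ^ (θ / α) / Real.Gamma (θ / α + 1)))
      (by fun_prop)
  have hH : Measurable fun (w : ℕ → ℝ × ℝ) (n : ℕ) => (w n).2 * (w n).1 ^ (-1 / α) :=
    measurable_pi_iff.2 fun n => by fun_prop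
  have hlaw : HasLaw (fun (w : ℕ → ℝ × ℝ) (n : ℕ) => (w n).2 * (w n).1 ^ (-1 / α))
      ((arrivalInputLaw α θ).map (arrivalSeq α)) ((arrivalInputLaw α θ).map renewalPoints) :=
    ⟨hH.aemeasurable, by rw [Measure.map_map hH measurable_renewalPoints]; rfl⟩
  refine (hlaw.fun_comp hzb).congr ?_
  have hac : biased α θ T J E P ≪ P := withDensity_absolutelyContinuous _ _
  exact hac.ae_le (hfacts.mono fun ω hω => hω.1)

lemma hasLaw_arrivalInput {Ω : Type*} [MeasurableSpace Ω] {P : Measure Ω} {α θ : ℝ}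
    (h0 : 0 < α) (h1 : α < 1) (hθ : -α < θ) {G D : ℕ → Ω → ℝ} (h : IsGammaArrivalInput α θ G D P) :
    HasLaw (fun ω => (fun n => D n ω, fun n => G n ω)) (arrivalInputLaw α θ) P := by
  have hb := div_add_one_pos h0 hθ
  have : Fact (0 < θ / α + 1) := ⟨hb⟩
  have := isProbabilityMeasure_gammaMeasure (a := 1 - α) (by linarith) one_pos
  have hD : ∀ n, HasLaw (D n) (waitLaw (θ / α + 1) n) P := by
    rintro (_ | n)
    · rw [waitLaw_zero]; exact h.hasLaw_first
    · rw [waitLaw_succ]; exact h.hasLaw_exp n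
  have h2 := hasLaw_prod_of_iIndepFun h.hasLaw_gamma hD h.indep
  exact HasLaw.fun_comp (Y := Prod.swap) ⟨measurable_swap.aemeasurable, Measure.prod_swap⟩ h2

/-- The gamma arrivals are a multiple of a perpetuity with beta and gamma input. -/
lemma arrivalSeq_eq_perpetuitySeq (α : ℝ) {p : (ℕ → ℝ) × (ℕ → ℝ)}
    (hp : ∀ n, 0 < p.1 n) :
    arrivalSeq α p = fun n => p.1 0 ^ (-1 / α) * perpetuitySeq (p.2, sumRatio α p.1) n := by
  have hS : ∀ n, 0 < ∑ i ∈ Finset.range (n + 1), p.1 i := fun n =>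
    Finset.sum_pos (fun i _ => hp i) ⟨0, by simp⟩
  -- The product of the ratios of successive sums telescopes.
  have key : ∀ n, (∑ i ∈ Finset.range (n + 1), p.1 i) ^ (-1 / α) =
      p.1 0 ^ (-1 / α) * ∏ i ∈ Finset.range n, sumRatio α p.1 i := by
    intro n
    induction n with
    | zero => simp
    | succ n ih =>
      rw [Finset.prod_range_succ, ← mul_assoc, ← ih]
      unfold sumRatio
      rw [Real.div_rpow (hS n).le (hS (n + 1)).le, neg_div, Real.rpow_neg (hS n).le,
        Real.rpow_neg (hS (n + 1)).le]
      have := Real.rpow_pos_of_pos (hS n) (1 / α)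
      field_simp
  funext n
  simp only [arrivalSeq, perpetuitySeq]
  rw [key]
  ring

lemma ae_pos_arrivalInputLaw {α θ : ℝ} (h0 : 0 < α) (h1 : α < 1) (hθ : -α < θ) :
    ∀ᵐ p ∂(arrivalInputLaw α θ), ∀ n, 0 < p.1 n := by
  have hb := div_add_one_pos h0 hθ
  have : Fact (0 < θ / α + 1) := ⟨hb⟩
  have := isProbabilityMeasure_gammaMeasure (a := 1 - α) (by linarith) one_pos
  refine Measure.quasiMeasurePreserving_fst.ae (p := fun d : ℕ → ℝ => ∀ n, 0 < d n)
    (ae_all_iff.2 fun n => ?_)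
  refine (measurePreserving_eval_infinitePi (waitLaw (θ / α + 1)) n).quasiMeasurePreserving.ae ?_
  rcases n with _ | n
  · rw [waitLaw_zero]; exact ae_pos_gammaMeasure _
  · rw [waitLaw_succ]; exact ae_pos_expMeasure

/-- The law of the input `((Gₙ), (Uₙ))` of the beta/gamma perpetuities. -/
noncomputable def perpetuityInputLaw (α θ : ℝ) : Measure ((ℕ → ℝ) × (ℕ → ℝ)) :=
  (Measure.infinitePi fun _ : ℕ => gammaMeasure (1 - α) 1).prod
    (Measure.infinitePi fun n : ℕ => betaMeasure (θ + (n + 1) * α) 1)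

lemma add_natCast_mul_pos {α θ : ℝ} (h0 : 0 ≤ α) (hθ : -α < θ) (n : ℕ) : 0 < θ + (n + 1) * α := by
  have : 0 ≤ n * α := by positivity
  linarith

lemma hasLaw_sumRatio_arrivalInputLaw {α θ : ℝ} (h0 : 0 < α) (h1 : α < 1) (hθ : -α < θ) :
    HasLaw (fun p : (ℕ → ℝ) × (ℕ → ℝ) => (p.2, sumRatio α p.1)) (perpetuityInputLaw α θ)
      (arrivalInputLaw α θ) := by
  have hb := div_add_one_pos h0 hθ
  have : Fact (0 < θ / α + 1) := ⟨hb⟩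
  have := isProbabilityMeasure_gammaMeasure (a := 1 - α) (by linarith) one_pos
  -- The beta parameter of the ratio with index `n`, counted from `0`: the sum in its numerator is
  -- `gamma(θ/α + 1 + n, 1)`.
  have e : ∀ n : ℕ, α * (θ / α + 1 + n) = θ + (n + 1) * α := fun n => by field_simp; ring
  have : ∀ n : ℕ, IsProbabilityMeasure (betaMeasure (α * (θ / α + 1 + n)) 1) := fun n => by
    rw [e]; exact isProbabilityMeasureBeta (add_natCast_mul_pos h0.le hθ n) one_pos
  have hmap := map_sumRatio (a := θ / α + 1) h0
  simp_rw [e] at hmap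
  have hm : Measurable fun p : (ℕ → ℝ) × (ℕ → ℝ) => (p.2, sumRatio α p.1) :=
    measurable_snd.prodMk ((measurable_sumRatio α).comp measurable_fst)
  refine ⟨hm.aemeasurable, ?_⟩
  have h2 : (fun p : (ℕ → ℝ) × (ℕ → ℝ) => (p.2, sumRatio α p.1)) =
      Prod.map id (sumRatio α) ∘ Prod.swap := rfl
  rw [h2, ← Measure.map_map (measurable_id.prodMap (measurable_sumRatio α)) measurable_swap,
    arrivalInputLaw, Measure.prod_swap,
    ← Measure.map_prod_map _ _ measurable_id (measurable_sumRatio α), Measure.map_id, hmap]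
  rfl

lemma hasLaw_perpetuityInput {Ω : Type*} [MeasurableSpace Ω] {P : Measure Ω} {α θ : ℝ}
    (h0 : 0 ≤ α) (h1 : α < 1) (hθ : -α < θ) {G U : ℕ → Ω → ℝ}
    (h : IsBetaGammaInput (1 - α) 1 (fun n => θ + (n + 1) * α) (fun _ => 1) G U P) :
    HasLaw (fun ω => (fun n => G n ω, fun n => U n ω)) (perpetuityInputLaw α θ) P := by
  have := isProbabilityMeasure_gammaMeasure (a := 1 - α) (by linarith) one_pos
  have : ∀ n : ℕ, IsProbabilityMeasure (betaMeasure (θ + (n + 1) * α) 1) := fun n =>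
    isProbabilityMeasureBeta (add_natCast_mul_pos h0 hθ n) one_pos
  exact hasLaw_prod_of_iIndepFun h.hasLaw_gamma h.hasLaw_beta h.indep

lemma measurable_countingMeasure_real : Measurable fun x : ℕ → ℝ => countingMeasure x :=
  measurable_countingMeasure fun n => measurable_pi_apply n

section Stable

variable {Ω : Type*} [MeasurableSpace Ω] {P : Measure Ω} [IsProbabilityMeasure P] {α θ : ℝ}
  {T J E : ℕ → Ω → ℝ}

lemma hasLaw_normalizeSeq_sizeBiasedJump (h0 : 0 < α) (h1 : α < 1) (hθ : -α < θ)
    (h : IsSubordinatorJumps (stableLevy α) T J P) (hE : IsExpMarking T J E P) :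
    HasLaw (fun ω => normalizeSeq (sizeBiasedJump T J E ω))
      ((arrivalInputLaw α θ).map fun p => normalizeSeq (arrivalSeq α p)) (biased α θ T J E P) := by
  refine HasLaw.fun_comp ⟨measurable_normalizeSeq.aemeasurable, ?_⟩
    (stable_sizeBiased h0 h1 hθ h hE).1
  rw [Measure.map_map measurable_normalizeSeq (measurable_arrivalSeq α)]
  rfl

lemma ae_biased_countingMeasure_sizeBiasedJump (h0 : 0 < α) (h1 : α < 1) (hθ : -α < θ)
    (h : IsSubordinatorJumps (stableLevy α) T J P) (hE : IsExpMarking T J E P) :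
    ∀ᵐ ω ∂(biased α θ T J E P),
      countingMeasure (normalizeSeq (sizeBiasedJump T J E ω)) = jumpPartition T J 1 ω := by
  have hac : biased α θ T J E P ≪ P := withDensity_absolutelyContinuous _ _
  exact hac.ae_le ((stable_sizeBiased h0 h1 hθ h hE).2.mono fun ω hω => hω.2)

/-- Summability is an event of the law: the jumps are almost surely summable under `P`, hence under
the biased measure, where they have the law of the arrivals. -/
lemma ae_summable_arrivalSeq (h0 : 0 < α) (h1 : α < 1) (hθ : -α < θ)
    (h : IsSubordinatorJumps (stableLevy α) T J P) (hE : IsExpMarking T J E P) :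
    ∀ᵐ p ∂(arrivalInputLaw α θ), Summable (arrivalSeq α p) := by
  obtain ⟨hlaw, hae⟩ := stable_sizeBiased h0 h1 hθ h hE
  have hac : biased α θ T J E P ≪ P := withDensity_absolutelyContinuous _ _
  have hS : Measurable fun x : ℕ → ℝ => Summable x := measurableSet_setOfPred.1 measurableSet_summable
  exact ae_of_ae_map (measurable_arrivalSeq α).aemeasurable
    ((hlaw.ae_iff hS).1 (hac.ae_le (hae.mono fun ω hω => hω.1)))

end Stable

lemma stable_perpetuity {Ω : Type*} [MeasurableSpace Ω] {P : Measure Ω} {α θ : ℝ} (h0 : 0 < α)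
    (h1 : α < 1) (hθ : -α < θ) (hS : ∀ᵐ p ∂(arrivalInputLaw α θ), Summable (arrivalSeq α p))
    {G U : ℕ → Ω → ℝ}
    (h : IsBetaGammaInput (1 - α) 1 (fun n => θ + (n + 1) * α) (fun _ => 1) G U P) :
    (∀ᵐ ω ∂P, Summable (perpetuityTerm G U ω)) ∧
      HasLaw (fun ω => normalizeSeq (perpetuityTerm G U ω))
        ((arrivalInputLaw α θ).map fun p => normalizeSeq (arrivalSeq α p)) P := by
  refine hasLaw_normalizeSeq_perpetuityTerm (hasLaw_perpetuityInput h0.le h1 hθ h)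
    (hasLaw_sumRatio_arrivalInputLaw h0 h1 hθ) (c := fun p => p.1 0 ^ (-1 / α)) ?_
  filter_upwards [hS, ae_pos_arrivalInputLaw h0 h1 hθ] with p hp1 hp2
  exact ⟨(Real.rpow_pos_of_pos (hp2 0) _).ne', arrivalSeq_eq_perpetuitySeq α hp2, hp1⟩

/-! ### The gamma case -/

/-- The sequence `gₙ exp(-(d₀ + ⋯ + dₙ) / θ)`. -/
noncomputable def expArrivalSeq (θ : ℝ) (p : (ℕ → ℝ) × (ℕ → ℝ)) (n : ℕ) : ℝ :=
  p.2 n * Real.exp (-(∑ i ∈ Finset.range (n + 1), p.1 i) / θ)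

lemma measurable_expArrivalSeq (θ : ℝ) : Measurable (expArrivalSeq θ) :=
  measurable_pi_iff.2 fun n => by unfold expArrivalSeq; fun_prop

/-- Auxiliary exponential marks are adjoined to the canonical space of the jumps. With `X = θ log(1
+ E/J)` one has `J = (J + E) e^{-X/θ}`, so the sorted points determine the jumps, and the marks
disappear from the partition. -/
theorem gamma_jumpPartition {Ω : Type*} [MeasurableSpace Ω] {P : Measure Ω}
    [IsProbabilityMeasure P] {θ : ℝ} (hθ : 0 < θ) {T J : ℕ → Ω → ℝ}
    (h : IsSubordinatorJumps gammaLevy T J P) :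
    (∀ᵐ p ∂(expSeq.prod (Measure.infinitePi fun _ : ℕ => gammaMeasure (1 - 0) 1)),
        Summable (expArrivalSeq θ p)) ∧
      HasLaw (jumpPartition T J θ)
        ((expSeq.prod (Measure.infinitePi fun _ : ℕ => gammaMeasure (1 - 0) 1)).map
          fun p => countingMeasure (normalizeSeq (expArrivalSeq θ p))) P := by
  have := isProbabilityMeasure_gammaMeasure (a := (1 : ℝ) - 0) (by norm_num) one_pos
  have hmp := h.measurable_points
  have := Measure.isProbabilityMeasure_map (μ := P) hmp.aemeasurable
  set Q := P.map fun ω i => (T i ω, J i ω) with hQ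
  have hmono : StrictMonoOn (fun z : ℝ => θ * Real.log (1 + z)) (Ioi 0) := fun x hx y _ hxy => by
    have hx' : (0 : ℝ) < x := hx
    exact mul_lt_mul_of_pos_left (Real.log_lt_log (by linarith) (by linarith)) hθ
  obtain ⟨hae, hm, hmap⟩ := marked_jumps gammaLevy_Iic lintegral_min_gammaLevy
    h.isPoissonProcess_map (s := θ) (Λ := fun z => θ * Real.log (1 + z)) (by fun_prop) hmono
    (Y := fun q => q.1 + q.2) (by fun_prop) fun B hB => gamma_disintegration hθ hB
  set z := sortedPoints θ (fun z => θ * Real.log (1 + z)) (fun q => q.1 + q.2) with hz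
  set H : (ℕ → ℝ × ℝ) → ℕ → ℝ := fun w n => (w n).2 * Real.exp (-(w n).1 / θ) with hH
  have hHm : Measurable H := measurable_pi_iff.2 fun n => by fun_prop
  set N : (ℕ → ℝ × ℝ) → Measure ℝ := fun w => countingMeasure (normalizeSeq (H w)) with hN
  have hNm : Measurable N :=
    measurable_countingMeasure_real.comp (measurable_normalizeSeq.comp hHm)
  have hS : Measurable fun w => Summable (H w) :=
    measurableSet_setOfPred.1 (hHm measurableSet_summable)
  set jp : (ℕ → ℝ × ℝ) → Measure ℝ :=
    jumpPartition (fun i x => (x i).1) (fun i x => (x i).2) θ with hjp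
  have hfacts : ∀ᵐ p ∂(Q.prod expSeq), Summable (H (z p)) ∧ jp p.1 = N (z p) := by
    filter_upwards [hae] with p ⟨hpos, hsort, hsum⟩
    have e : H (z p) = fun n => (p.1 (sortIdx {i | (p.1 i).1 ≤ θ}
        (fun i => θ * Real.log (1 + p.2 i / (p.1 i).2)) n)).2 := by
      funext n
      simp only [hH, hz, sortedPoints]
      set i := sortIdx {i | (p.1 i).1 ≤ θ} (fun i => θ * Real.log (1 + p.2 i / (p.1 i).2)) n
      obtain ⟨hj, he⟩ := hpos i
      have hq : 0 < 1 + p.2 i / (p.1 i).2 := by positivity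
      rw [neg_div, mul_div_cancel_left₀ _ hθ.ne', Real.exp_neg, Real.exp_log hq]
      field_simp
    refine ⟨by rw [e]; exact hsum, ?_⟩
    simp only [hN]
    rw [e]
    exact jumpPartition_eq_of_range (T := fun i (x : ℕ → ℝ × ℝ) => (x i).1)
      (J := fun i x => (x i).2) (ω := p.1) hsort.injective hsort.range_eq hsum
      fun i => (hpos i).1.le
  have hzlaw : HasLaw z (renewalLaw (gammaMeasure (1 - 0) 1)) (Q.prod expSeq) :=
    ⟨hm.aemeasurable, hmap⟩
  -- The partition of the jumps alone agrees almost surely with a measurable function of jumps and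
  -- marks. By Fubini some fixed sequence of marks `e` gives a measurable version.
  have hjpm : AEMeasurable jp Q := by
    have h1 : ∀ᵐ p ∂(expSeq.prod Q), jp p.2 = N (z (p.2, p.1)) :=
      (Measure.measurePreserving_swap (μ := expSeq) (ν := Q)).quasiMeasurePreserving.ae
        (hfacts.mono fun p hp => hp.2)
    obtain ⟨e, he⟩ := (Measure.ae_ae_of_ae_prod h1).exists
    exact ⟨fun x => N (z (x, e)), hNm.comp (hm.comp measurable_prodMk_right), he⟩
  refine ⟨?_, ?_⟩
  · have h1 := (hzlaw.ae_iff hS).1 (hfacts.mono fun p hp => hp.1)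
    exact ae_of_ae_map (p := fun w => Summable (H w)) measurable_renewalPoints.aemeasurable h1
  · have hpts : HasLaw (fun ω i => (T i ω, J i ω)) Q P := ⟨hmp.aemeasurable, rfl⟩
    have e : jumpPartition T J θ = fun ω => jp fun i => (T i ω, J i ω) := by
      funext ω
      simp only [hjp, jumpPartition]
    rw [e]
    refine HasLaw.fun_comp ⟨hjpm, ?_⟩ hpts
    have hfst : HasLaw (Prod.fst : (ℕ → ℝ × ℝ) × (ℕ → ℝ) → _) Q (Q.prod expSeq) :=
      measurePreserving_fst.hasLaw
    have h2 : HasLaw (fun p : (ℕ → ℝ × ℝ) × (ℕ → ℝ) => jp p.1) (Q.map jp) (Q.prod expSeq) :=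
      HasLaw.fun_comp (Y := jp) ⟨hjpm, rfl⟩ hfst
    rw [← h2.map_eq, Measure.map_congr (hfacts.mono fun p hp => hp.2),
      ← Function.comp_def N z, ← Measure.map_map hNm hm, hmap, renewalLaw,
      Measure.map_map hNm measurable_renewalPoints]
    rfl

/-- The exponential of the sum is a product: `e^{-d₀/θ}` is common to all terms and disappears in
the normalization, and the other factors are i.i.d. `beta(θ, 1)`. -/
lemma gamma_perpetuity {Ω : Type*} [MeasurableSpace Ω] {P : Measure Ω} {θ : ℝ} (hθ : 0 < θ)
    (hS : ∀ᵐ p ∂(expSeq.prod (Measure.infinitePi fun _ : ℕ => gammaMeasure (1 - 0) 1)),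
      Summable (expArrivalSeq θ p)) {G U : ℕ → Ω → ℝ}
    (h : IsBetaGammaInput (1 - 0) 1 (fun n => θ + (n + 1) * 0) (fun _ => 1) G U P) :
    (∀ᵐ ω ∂P, Summable (perpetuityTerm G U ω)) ∧
      HasLaw (fun ω => normalizeSeq (perpetuityTerm G U ω))
        ((expSeq.prod (Measure.infinitePi fun _ : ℕ => gammaMeasure (1 - 0) 1)).map
          fun p => normalizeSeq (expArrivalSeq θ p)) P := by
  have := isProbabilityMeasure_gammaMeasure (a := (1 : ℝ) - 0) (by norm_num) one_pos
  have := isProbabilityMeasureBeta hθ one_pos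
  -- The shift by one sets `d₀` aside as the common factor.
  set f : (ℕ → ℝ) → ℕ → ℝ := fun d n => Real.exp (-d (n + 1) / θ) with hf
  have hfm : Measurable f := measurable_pi_iff.2 fun n => by fun_prop
  have hmap : expSeq.map f = Measure.infinitePi fun n : ℕ => betaMeasure (θ + (n + 1) * 0) 1 := by
    have hs : Measurable fun (d : ℕ → ℝ) (n : ℕ) => d (n + 1) := by fun_prop
    have he : Measurable fun (d : ℕ → ℝ) (n : ℕ) => Real.exp (-d n / θ) :=
      measurable_pi_iff.2 fun n => by fun_prop
    have h1 : expSeq.map (fun (d : ℕ → ℝ) (n : ℕ) => d (n + 1)) = expSeq :=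
      Measure.map_infinitePi_infinitePi_of_inj (P := fun _ : ℕ => expMeasure 1)
        (f := fun n : ℕ => n + 1) (add_left_injective 1)
    have h2 : f = (fun (d : ℕ → ℝ) (n : ℕ) => Real.exp (-d n / θ)) ∘
      fun (d : ℕ → ℝ) (n : ℕ) => d (n + 1) := rfl
    rw [h2, ← Measure.map_map he hs, h1]
    simp only [mul_zero, add_zero]
    rw [← map_exp_expMeasure hθ]
    exact Measure.infinitePi_map_pi (μ := fun _ : ℕ => expMeasure 1)
      (f := fun _ s => Real.exp (-s / θ)) fun _ => by fun_prop
  have hr : HasLaw (fun p : (ℕ → ℝ) × (ℕ → ℝ) => (p.2, f p.1)) (perpetuityInputLaw 0 θ)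
      (expSeq.prod (Measure.infinitePi fun _ : ℕ => gammaMeasure (1 - 0) 1)) := by
    refine ⟨(measurable_snd.prodMk (hfm.comp measurable_fst)).aemeasurable, ?_⟩
    have h2 : (fun p : (ℕ → ℝ) × (ℕ → ℝ) => (p.2, f p.1)) = Prod.map id f ∘ Prod.swap := rfl
    rw [h2, ← Measure.map_map (measurable_id.prodMap hfm) measurable_swap, Measure.prod_swap,
      ← Measure.map_prod_map _ _ measurable_id hfm, Measure.map_id, hmap]
    rfl
  refine hasLaw_normalizeSeq_perpetuityTerm
    (hasLaw_perpetuityInput le_rfl one_pos (by simpa using hθ) h) hr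
    (c := fun p => Real.exp (-p.1 0 / θ)) ?_
  filter_upwards [hS] with p hp
  refine ⟨(Real.exp_pos _).ne', ?_, hp⟩
  funext n
  simp only [expArrivalSeq, perpetuitySeq, hf]
  rw [← Real.exp_sum, Finset.sum_range_succ', ← Finset.sum_div, Finset.sum_neg_distrib, neg_add_rev,
    add_div, Real.exp_add]
  ring

/-! ### Poisson-Dirichlet distributions -/

theorem IsPoissonDirichlet.hasLaw_perpetuity {α θ : ℝ} {ρ : Measure (Measure ℝ)}
    (hρ : IsPoissonDirichlet α θ ρ) {Ω : Type*} [MeasurableSpace Ω] {P : Measure Ω}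
    {G U : ℕ → Ω → ℝ}
    (h : IsBetaGammaInput (1 - α) 1 (fun n => θ + (n + 1) * α) (fun _ => 1) G U P) :
    (∀ᵐ ω ∂P, Summable (perpetuityTerm G U ω)) ∧
      HasLaw (fun ω => countingMeasure (normalizeSeq (perpetuityTerm G U ω))) ρ P := by
  have hm := measurable_countingMeasure_real
  rcases hρ with ⟨rfl, hθ, Ω₀, _, P₀, T, J, _, hTJ, hlaw⟩ |
    ⟨h0, h1, hθ, Ω₀, _, P₀, T, J, E, _, hTJ, hE, hlaw⟩
  · obtain ⟨hS, hjp⟩ := gamma_jumpPartition hθ hTJ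
    obtain ⟨hsum, hperp⟩ := gamma_perpetuity hθ hS h
    refine ⟨hsum, HasLaw.fun_comp ⟨hm.aemeasurable, ?_⟩ hperp⟩
    have hm' : Measurable fun p => normalizeSeq (expArrivalSeq θ p) :=
      measurable_normalizeSeq.comp (measurable_expArrivalSeq θ)
    rw [Measure.map_map (g := fun x : ℕ → ℝ => countingMeasure x) hm hm', ← hlaw.map_eq, hjp.map_eq]
    rfl
  · obtain ⟨hsum, hperp⟩ := stable_perpetuity h0 h1 hθ
      (ae_summable_arrivalSeq h0 h1 hθ hTJ hE) h
    refine ⟨hsum, HasLaw.fun_comp ⟨hm.aemeasurable, ?_⟩ hperp⟩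
    have h2 := HasLaw.fun_comp (Y := fun x : ℕ → ℝ => countingMeasure x) ⟨hm.aemeasurable, rfl⟩
      (hasLaw_normalizeSeq_sizeBiasedJump h0 h1 hθ hTJ hE)
    rw [← h2.map_eq, ← hlaw.map_eq]
    exact Measure.map_congr (ae_biased_countingMeasure_sizeBiasedJump h0 h1 hθ hTJ hE)

theorem IsPoissonDirichlet.isBetaGammaPerpetuity {α θ : ℝ} (h0 : 0 ≤ α) (h1 : α < 1) (hθ : -α < θ)
    {ρ : Measure (Measure ℝ)} (hρ : IsPoissonDirichlet α θ ρ) :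
    IsBetaGammaPerpetuity (1 - α) 1 (fun n => θ + (n + 1) * α) (fun _ => 1) ρ := by
  have := isProbabilityMeasure_gammaMeasure (a := 1 - α) (by linarith) one_pos
  have : ∀ n : ℕ, IsProbabilityMeasure (betaMeasure (θ + (n + 1) * α) 1) := fun n =>
    isProbabilityMeasureBeta (add_natCast_mul_pos h0 hθ n) one_pos
  have : IsProbabilityMeasure (perpetuityInputLaw α θ) := by
    unfold perpetuityInputLaw; infer_instance
  -- The coordinates under the product measure realize the input, which proves existence.
  have hin : IsBetaGammaInput (1 - α) 1 (fun n => θ + (n + 1) * α) (fun _ => 1)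
      (fun n (p : (ℕ → ℝ) × (ℕ → ℝ)) => p.1 n) (fun n p => p.2 n) (perpetuityInputLaw α θ) :=
    ⟨fun n => ((measurePreserving_eval_infinitePi (fun _ : ℕ => gammaMeasure (1 - α) 1) n).comp
        measurePreserving_fst).hasLaw,
      fun n => ((measurePreserving_eval_infinitePi
        (fun n : ℕ => betaMeasure (θ + (n + 1) * α) 1) n).comp measurePreserving_snd).hasLaw,
      iIndepFun_sumElim_prod _ _⟩
  obtain ⟨hsum, hlaw⟩ := hρ.hasLaw_perpetuity hin
  exact ⟨by linarith, one_pos, add_natCast_mul_pos h0 hθ, fun _ => one_pos, _, _, _, _, _, this, hin,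
    hsum, hlaw⟩

end MassPartition

theorem proposition2p2 (α θ : ℝ) (hα0 : 0 ≤ α) (hα1 : α < 1) (hθ : -α < θ) :
    -- every PD(α, θ) law is in the beta/gamma family with the stated parameters, and it is
    -- the law of the normalized perpetuity for every choice of such independent variables
    (∀ ρ : Measure (Measure ℝ), IsPoissonDirichlet α θ ρ →
      IsBetaGammaPerpetuity (1 - α) 1 (fun n => θ + (n + 1) * α) (fun _ => 1) ρ ∧
      ∀ {Ω' : Type*} [MeasurableSpace Ω'] (P' : Measure Ω') [IsProbabilityMeasure P']
        (G U : ℕ → Ω' → ℝ),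
        IsBetaGammaInput (1 - α) 1 (fun n => θ + (n + 1) * α) (fun _ => 1) G U P' →
        (∀ᵐ ω ∂P', Summable (perpetuityTerm G U ω)) ∧
        HasLaw (fun ω => countingMeasure (normalizeSeq (perpetuityTerm G U ω))) ρ P') ∧
    -- for α > 0, the normalized jumps in size-biased order, under the biased measure
    (0 < α →
      ∀ {Ω : Type*} [MeasurableSpace Ω] (P : Measure Ω) [IsProbabilityMeasure P]
        (T J E : ℕ → Ω → ℝ),
        IsSubordinatorJumps (stableLevy α) T J P → IsExpMarking T J E P →
        IsProbabilityMeasure (biased α θ T J E P) ∧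
        (∀ᵐ ω ∂(biased α θ T J E P),
          countingMeasure (normalizeSeq (sizeBiasedJump T J E ω)) = jumpPartition T J 1 ω) ∧
        (∀ {Ω' : Type*} [MeasurableSpace Ω'] (P' : Measure Ω') [IsProbabilityMeasure P']
          (G U : ℕ → Ω' → ℝ),
          IsBetaGammaInput (1 - α) 1 (fun n => θ + (n + 1) * α) (fun _ => 1) G U P' →
          IdentDistrib (fun ω => normalizeSeq (sizeBiasedJump T J E ω))
            (fun ω => normalizeSeq (perpetuityTerm G U ω)) (biased α θ T J E P) P') ∧
        (∀ {Ω' : Type*} [MeasurableSpace Ω'] (P' : Measure Ω') [IsProbabilityMeasure P']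
          (G D : ℕ → Ω' → ℝ),
          IsGammaArrivalInput α θ G D P' →
          (∀ᵐ ω ∂P', Summable (arrivalTerm α G D ω)) ∧
          IdentDistrib (fun ω => normalizeSeq (sizeBiasedJump T J E ω))
            (fun ω => normalizeSeq (arrivalTerm α G D ω)) (biased α θ T J E P) P')) := by
  refine ⟨fun ρ hρ => ⟨hρ.isBetaGammaPerpetuity hα0 hα1 hθ, fun P' _ G U h =>
    hρ.hasLaw_perpetuity h⟩, fun h0 Ω _ P _ T J E hTJ hE => ?_⟩
  have hlaw := hasLaw_normalizeSeq_sizeBiasedJump h0 hα1 hθ hTJ hE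
  refine ⟨?_, ae_biased_countingMeasure_sizeBiasedJump h0 hα1 hθ hTJ hE, fun P' _ G U h => ?_,
    fun P' _ G D h => ?_⟩
  · have := isProbabilityMeasure_arrivalInputLaw h0 hα1 hθ
    have := Measure.isProbabilityMeasure_map (μ := arrivalInputLaw α θ)
      (measurable_arrivalSeq α).aemeasurable
    -- The image of the biased measure under the ordered jumps is a probability law, so its total
    -- mass is one.
    exact (stable_sizeBiased h0 hα1 hθ hTJ hE).1.isProbabilityMeasure
  · have hperp := (stable_perpetuity h0 hα1 hθ (ae_summable_arrivalSeq h0 hα1 hθ hTJ hE) h).2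
    exact ⟨hlaw.aemeasurable, hperp.aemeasurable, hlaw.map_eq.trans hperp.map_eq.symm⟩
  · have hin := hasLaw_arrivalInput h0 hα1 hθ h
    have hS : Measurable fun p => Summable (arrivalSeq α p) :=
      measurableSet_setOfPred.1 (measurable_arrivalSeq α measurableSet_summable)
    have hN : Measurable fun p => normalizeSeq (arrivalSeq α p) :=
      measurable_normalizeSeq.comp (measurable_arrivalSeq α)
    have harr : HasLaw (fun ω => normalizeSeq (arrivalTerm α G D ω))
        ((arrivalInputLaw α θ).map fun p => normalizeSeq (arrivalSeq α p)) P' :=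
      HasLaw.fun_comp (Y := fun p => normalizeSeq (arrivalSeq α p)) ⟨hN.aemeasurable, rfl⟩ hin
    exact ⟨(hin.ae_iff hS).2 (ae_summable_arrivalSeq h0 hα1 hθ hTJ hE),
      hlaw.aemeasurable, harr.aemeasurable, hlaw.map_eq.trans harr.map_eq.symm⟩
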